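/- Let $p\ge 3$ and $k\ge 1$ be integers, $\lambda=2\cos(\pi/p)$, $S=\begin{pmatrix}1&\lambda\\0&1\end{pmatrix}$, $T=\begin{pmatrix}0&-1\\1&0\end{pmatrix}$, $U=ST$, and let $G_p=\langle S,T\rangle/\{\pm I\}$ be the Hecke group, acting by linear fractional transformations. For $M=\begin{pmatrix}a&b\\c&d\end{pmatrix}$ put $(f\mid M)(z)=(cz+d)^{-2k}f(Mz)$. A rational period function (RPF) of weight $2k$ on $G_p$ is a rational function $q$ over $\mathbb C$ with $$q+q\mid T=0,\qquad q+q\mid U+\dots+q\mid U^{p-1}=0 .$$ A $\lambda$-form is $Q=[A,B,C]=Ax^2+Bxy+Cy^2$ with $A,B,C\in\mathbb Z[\lambda]$ and $D=B^2-4AC>0$, required to satisfy $(A)+(B)+(C)=(1)$ if $\mathbb Z[\lambda]$ is a principal ideal domain. Forms $Q_1,Q_2$ are $G_p$-equivalent if $Q_2=Q_1\circ V$ for some $V\in G_p$. Put $\alpha_Q=\frac{-B+\sqrt D}{2A}$. A hyperbolic point is a fixed point $\alpha\in\mathbb R$ of some $M\in G_p$ with $|\operatorname{tr}M|>2$. Its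 form $Q_\alpha$ is the one of the two forms $\pm\frac1g[c,d-a,-b]$ with $\alpha_{Q_\alpha}=\alpha$, where $\begin{pmatrix}a&b\\c&d\end{pmatrix}$ generates the stabilizer of $\alpha$ in $G_p$ and where $g$ is a positive generator of the ideal $(c,d-a,-b)$ (fixed once and for all for each ideal) if $\mathbb Z[\lambda]$ is a principal ideal domain, and $g=1$ otherwise. If $Q_\alpha=[A,B,C]$ has discriminant $D$, the Hecke conjugate of $\alpha$ is $\alpha'=\frac{-B-\sqrt D}{2A}$. The forms $Q_\alpha$ are called hyperbolic, and a $G_p$-equivalence class of forms is hyperbolic if all its forms are. For a hyperbolic class $\mathcal A$ let $Z_{\mathcal A}$ be the set of hyperbolic points $x$ such that $Q_x=[A,B,C]\in\mathcal A$ and $A>0>C$. For a hyperbolic point $\alpha$ let $q_{k,\alpha}$ be the principal part at $z=\alpha$ of $$\frac{(\alpha-\alpha')^k}{(z-\alpha)^k(z-\alpha')^k}.$$ **Theorem.** Let $q$ be an RPF of weight $2k$ on $G_p$. Then there are finitely many distinct hyperbolic $G_p$-equivalence classes $\mathcal A_1,\dots,\mathcal A_L$ ($L\ge 0$) of $\lambda$-forms,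 with each $Z_{\mathcal A_\ell}$ finite and non-empty and with $\bigcup_{\ell}Z_{\mathcal A_\ell}$ equal to the set of positive poles of $q$, and there are complex constants $C_1,\dots,C_L,c_0,\dots,c_{2k-1},a_0,b_1$ such that $$q(z)=\sum_{\ell=1}^{L}C_\ell\sum_{\alpha\in Z_{\mathcal A_\ell}}\bigl(q_{k,\alpha}(z)-q_{k,T\alpha}(z)\bigr)+c_0\,q_{k,0}(z)+\sum_{n=1}^{2k-1}\frac{c_n}{z^n},$$ where $T\alpha=-1/\alpha$, and where $q_{k,0}(z)=a_0(1-z^{-2k})$ if $2k\neq2$ and $q_{k,0}(z)=a_0(1-z^{-2})+b_1z^{-1}$ if $2k=2$. -/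

import Mathlib

open scoped MatrixGroups

noncomputable section

namespace Hecke

/-! ### The ring `ℤ[λ_p]` and the Hecke group -/

/-- `λ_p = 2 cos (π / p)`. -/
def lam (p : ℕ) : ℝ := 2 * Real.cos (Real.pi / p)

/-- The ring `ℤ[λ_p]`, as a subring of the reals. -/
abbrev Ring (p : ℕ) : Subalgebra ℤ ℝ := Algebra.adjoin ℤ {lam p}

/-- `λ_p` as an element of `ℤ[λ_p]`. -/
def lamR (p : ℕ) : Ring p := ⟨lam p, Algebra.self_mem_adjoin_singleton ℤ (lam p)⟩

/-- The matrix `S = (1 λ; 0 1)`. -/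
def S (p : ℕ) : SL(2, Ring p) := ⟨!![1, lamR p; 0, 1], by simp [Matrix.det_fin_two]⟩

/-- The matrix `T = (0 -1; 1 0)`. -/
def T (p : ℕ) : SL(2, Ring p) := ⟨!![0, -1; 1, 0], by simp [Matrix.det_fin_two]⟩

/-- The matrix `U = S T`. -/
def U (p : ℕ) : SL(2, Ring p) := S p * T p

/-- The Hecke group `G_p`, as a group of matrices: the subgroup generated by `S` and `T`.
It contains `-I = T ^ 2`; an element of the group of transformations is a pair `±M`. -/
def group (p : ℕ) : Subgroup SL(2, Ring p) := Subgroup.closure {S p, T p}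

/-! ### Hyperbolic points -/

/-- `M x = x` for the action by linear fractional transformations, at a real point `x`. -/
def Fixes {p : ℕ} (M : SL(2, Ring p)) (x : ℝ) : Prop :=
  (M 0 0 : ℝ) * x + (M 0 1 : ℝ) = ((M 1 0 : ℝ) * x + (M 1 1 : ℝ)) * x

/-- `x` is a fixed point of a hyperbolic element of `G_p`. -/
def IsHyperbolicPoint (p : ℕ) (x : ℝ) : Prop :=
  ∃ M ∈ group p, 2 < |(M 0 0 : ℝ) + (M 1 1 : ℝ)| ∧ Fixes M x

/-- `M` generates (modulo `±I`) the group of the elements of `G_p` that fix `x`. -/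
def IsStabilizerGenerator (p : ℕ) (x : ℝ) (M : SL(2, Ring p)) : Prop :=
  M ∈ group p ∧ Fixes M x ∧ ∀ N ∈ group p, Fixes N x → ∃ n : ℤ, N = M ^ n ∨ N = -M ^ n

/-! ### Binary quadratic forms -/

/-- An indefinite binary quadratic form `[A, B, C] = A x² + B x y + C y²` over `ℤ[λ_p]`, which is
required to be primitive when `ℤ[λ_p]` is a principal ideal domain. -/
@[ext]
structure BQF (p : ℕ) where
  A : Ring p
  B : Ring p
  C : Ring p
  indefinite : 0 < (B : ℝ) ^ 2 - 4 * (A : ℝ) * (C : ℝ)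
  primitive : IsPrincipalIdealRing (Ring p) →
    Ideal.span {A} ⊔ Ideal.span {B} ⊔ Ideal.span {C} = ⊤

namespace BQF

variable {p : ℕ}

/-- The form `[1, 0, -1]`. -/
instance : Inhabited (BQF p) :=
  ⟨{ A := 1
     B := 0
     C := -1
     indefinite := by norm_num
     primitive := fun _ => by simp }⟩

/-- The value of the form at `(x, y) = (v 0, v 1)`. -/
def eval (Q : BQF p) (v : Fin 2 → Ring p) : Ring p :=
  Q.A * v 0 ^ 2 + Q.B * v 0 * v 1 + Q.C * v 1 ^ 2

/-- The discriminant. -/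
def disc (Q : BQF p) : ℝ := (Q.B : ℝ) ^ 2 - 4 * (Q.A : ℝ) * (Q.C : ℝ)

/-- The number `α_Q = (-B + √D) / (2A)`. -/
def root (Q : BQF p) : ℝ := (-(Q.B : ℝ) + √Q.disc) / (2 * (Q.A : ℝ))

/-- The number `α_{-Q} = (-B - √D) / (2A)`. -/
def conjRoot (Q : BQF p) : ℝ := (-(Q.B : ℝ) - √Q.disc) / (2 * (Q.A : ℝ))

/-- `G_p`-equivalence of forms: `Q₂ = Q₁ ∘ V` for some `V ∈ G_p`. -/
instance equiv (p : ℕ) : Setoid (BQF p) where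
  r Q₁ Q₂ := ∃ V ∈ group p, ∀ v : Fin 2 → Ring p,
    Q₂.eval v = Q₁.eval (Matrix.mulVec (V : Matrix (Fin 2) (Fin 2) (Ring p)) v)
  iseqv :=
    { refl := fun Q => ⟨1, one_mem _, fun v => by simp⟩
      symm := by
        rintro Q₁ Q₂ ⟨V, hV, h⟩
        refine ⟨V⁻¹, inv_mem hV, fun v => ?_⟩
        rw [h, Matrix.mulVec_mulVec, ← Matrix.SpecialLinearGroup.coe_mul, mul_inv_cancel,
          Matrix.SpecialLinearGroup.coe_one, Matrix.one_mulVec]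
      trans := by
        rintro Q₁ Q₂ Q₃ ⟨V, hV, h⟩ ⟨W, hW, h'⟩
        refine ⟨V * W, mul_mem hV hW, fun v => ?_⟩
        rw [h', h, Matrix.mulVec_mulVec, Matrix.SpecialLinearGroup.coe_mul] }

/-- A form is simple if `A > 0 > C`. -/
def IsSimple (Q : BQF p) : Prop := 0 < (Q.A : ℝ) ∧ (Q.C : ℝ) < 0

end BQF

/-! ### The form and the conjugate of a hyperbolic point -/

open scoped Classical in
/-- The normalizing factor of an ideal of `ℤ[λ_p]`: a positive generator of it, chosen once and for
all for each ideal, if `ℤ[λ_p]` is a principal ideal domain, and `1` otherwise. -/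
def idealGen (p : ℕ) (I : Ideal (Ring p)) : Ring p :=
  if IsPrincipalIdealRing (Ring p) then
    Classical.epsilon fun g : Ring p => 0 < (g : ℝ) ∧ Ideal.span {g} = I
  else 1

/-- `Q` is the form of the hyperbolic point `x`: with `M = (a b; c d)` a generator of the
stabilizer of `x` and `g` the normalizing factor of the ideal `(c, d - a, -b)`, it is the one of the
two forms `± (1 / g) [c, d - a, -b]` with `α_Q = x`. -/
def IsFormOf (p : ℕ) (x : ℝ) (Q : BQF p) : Prop :=
  IsHyperbolicPoint p x ∧ Q.root = x ∧
  ∃ M : SL(2, Ring p), IsStabilizerGenerator p x M ∧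
    ∃ g : Ring p, g = idealGen p (Ideal.span {M 1 0, M 1 1 - M 0 0, -M 0 1}) ∧
      ((g * Q.A = M 1 0 ∧ g * Q.B = M 1 1 - M 0 0 ∧ g * Q.C = -M 0 1) ∨
       (g * Q.A = -M 1 0 ∧ g * Q.B = -(M 1 1 - M 0 0) ∧ g * Q.C = M 0 1))

/-- The form `Q_x` of a hyperbolic point `x` (only meaningful for hyperbolic `x`). -/
def formOf (p : ℕ) (x : ℝ) : BQF p := Classical.epsilon (IsFormOf p x)

/-- The Hecke conjugate `x'` of a hyperbolic point `x`. -/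
def conj (p : ℕ) (x : ℝ) : ℝ := (formOf p x).conjRoot

/-- A form is hyperbolic if it is the form of a hyperbolic point. -/
def BQF.IsHyperbolic {p : ℕ} (Q : BQF p) : Prop := ∃ x : ℝ, IsFormOf p x Q

/-- The `G_p`-equivalence classes of forms. -/
abbrev FormClass (p : ℕ) : Type := Quotient (BQF.equiv p)

/-- A class is hyperbolic if its forms are. -/
def IsHyperbolicClass {p : ℕ} (𝒜 : FormClass p) : Prop :=
  ∀ Q : BQF p, (⟦Q⟧ : FormClass p) = 𝒜 → Q.IsHyperbolic

/-- `Z_𝒜`: the hyperbolic points whose form is simple and belongs to `𝒜`. -/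
def simplePoints {p : ℕ} (𝒜 : FormClass p) : Set ℝ :=
  {x | IsHyperbolicPoint p x ∧ (⟦formOf p x⟧ : FormClass p) = 𝒜 ∧ (formOf p x).IsSimple}

/-! ### Rational period functions -/

open RatFunc

section RationalFunctions

variable {K : Type*} [Field K]

/-- The rational function `(c z + d)^(-2k) f((a z + b) / (c z + d))`. -/
def slashBy (k : ℕ) (a b c d : K) (f : RatFunc K) : RatFunc K :=
  ((RatFunc.C c * X + RatFunc.C d) ^ (2 * k))⁻¹ *
    f.eval RatFunc.C ((RatFunc.C a * X + RatFunc.C b) / (RatFunc.C c * X + RatFunc.C d))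

/-- `z` is a pole of the rational function `f`. -/
def IsPole (f : RatFunc K) (z : K) : Prop := f.denom.IsRoot z

/-- The principal part of `f` at `a`: the sum of the terms `b_n / (z - a)^n`, `n ≥ 1`, of the Laurent
expansion of `f` at `a`. Here `laurent a f` is `f(z + a)`, and the multiplicity of `a` as a root of
the denominator is the order of the pole. -/
def principalPart (a : K) (f : RatFunc K) : RatFunc K :=
  ∑ n ∈ Finset.Icc 1 (f.denom.rootMultiplicity a),
    RatFunc.C (((laurent a f : RatFunc K) : LaurentSeries K).coeff (-(n : ℤ))) /
      (X - RatFunc.C a) ^ n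

/-- The rational function `(a - a')^k / ((z - a)^k (z - a')^k)`. -/
def twoPoles (k : ℕ) (a a' : K) : RatFunc K :=
  RatFunc.C ((a - a') ^ k) / ((X - RatFunc.C a) ^ k * (X - RatFunc.C a') ^ k)

/-- `q_{k,0}`, with its constants `a₀` and `b₁`: it is `a₀ (1 - z^(-2k))` if `2k ≠ 2`, and
`a₀ (1 - z^(-2)) + b₁ z^(-1)` if `2k = 2`. -/
def qZero (k : ℕ) (a₀ b₁ : K) : RatFunc K :=
  if 2 * k = 2 then RatFunc.C a₀ * (1 - (X ^ 2)⁻¹) + RatFunc.C b₁ * X⁻¹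
  else RatFunc.C a₀ * (1 - (X ^ (2 * k))⁻¹)

end RationalFunctions

/-- The weight `2k` slash operator `(f | M)(z) = (c z + d)^(-2k) f(M z)`. -/
def slash {p : ℕ} (k : ℕ) (f : RatFunc ℂ) (M : SL(2, Ring p)) : RatFunc ℂ :=
  slashBy k ((M 0 0 : ℝ) : ℂ) ((M 0 1 : ℝ) : ℂ) ((M 1 0 : ℝ) : ℂ) ((M 1 1 : ℝ) : ℂ) f

/-- `q` is a rational period function of weight `2k` on `G_p`. -/
def IsRPF (p k : ℕ) (q : RatFunc ℂ) : Prop :=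
  q + slash k q (T p) = 0 ∧ ∑ n ∈ Finset.range p, slash k q (U p ^ n) = 0

/-- `q_{k,α}`, the principal part at `α` of `(α - α')^k / ((z - α)^k (z - α')^k)`, where `α'` is the
Hecke conjugate of `α`. -/
def qPart (p k : ℕ) (α : ℝ) : RatFunc ℂ :=
  principalPart (α : ℂ) (twoPoles k (α : ℂ) (conj p α : ℂ))

end Hecke

end

/-!
Write `f | M` for the weight `2k` action. The key is a continued fraction algorithm for the Hecke
group. The matrices `-U ^ (j + 1) T`, `0 ≤ j < p - 1`, called letters, have non-negative entries
(quotients of sines) and map the half-line `[0, ∞)` onto the parts of a partition of it. Hence every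
`x ≥ 0` has an expansion in letters, with a shift `next`. Rewriting an element of `G_p` in the
letters and `T` shows that equivalent points of `[0, ∞)` have expansions with a common tail, and that
the transformation between them is read off from the initial parts (`exists_prefixWord_of_maps`).
So hyperbolic points have eventually periodic expansions with stabilizers generated by the shortest
period, which makes the form `Q_α` and the conjugate `α'` well defined and equivariant
(`formOf_of_maps`). The points `α > 0 > α'`, which are those with a simple form, are exactly the
hyperbolic points with a purely periodic expansion, because the expansion of `-α'` records the
letters that precede that of `α` (`exists_periodic_of_isSimple`, `isHyperbolicPoint_of_periodic`).

Applying `T` to the second relation of a rational period function `q` gives `q = ∑ q | letter`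
(`IsRPF.eq_sum_letters`). Thus every pole is carried to a pole by some letter. For a non-real pole
this is a contradiction, since a product of letters has no non-real fixed point and the set of poles
is finite. On the finite set of positive poles it is an injection with inverse `next`
(`IsRPF.next_posPoles`), so the positive poles have purely periodic expansions; they form full
cycles of `next`, which are the sets `Z_𝒜`.

If the word `V` is a period of a positive pole `x`, then `q - q | V` is regular at `x`. Comparison of
leading terms, with a multiplier of `V` at `x` that is not `±1`, forces the order of the pole to be
`k` (`order_eq_of_regular_sub_slash`). Since `((x - x') / ((z - x) (z - x'))) ^ k` is invariant under
`V`, subtracting the right multiple `C` of it lowers the order, and the pole disappears. The constant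
`C` is the same along a cycle, and the relation `q | T = -q` transports the polar part from `x` to
`-1 / x` with the opposite sign.

After subtraction of these principal parts the only possible pole is at `0`. The letter that fixes
`0` is parabolic; comparing terms of second order shows that the order of this pole is at most `2k`
(`IsRPF.order_zero_le`). The relation `q | T = -q` turns this into a bound at infinity, with opposite
values of `z ^ (2k) q` at `0` and of `q` at infinity. Principal parts vanish at infinity, so what is
left is a polynomial in `1 / z` of degree at most `2k` whose extreme coefficients are opposite
(`exists_eq_of_regular`).
-/

noncomputable section

namespace Hecke

/-! ### Matrices over `ℤ[λ]` and their action on the real line -/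

section Matrices

variable {p : ℕ}

lemma coe_mul_apply (M N : SL(2, Ring p)) (i j : Fin 2) :
    (((M * N) i j : Ring p) : ℝ) = (M i 0 : ℝ) * (N 0 j : ℝ) + (M i 1 : ℝ) * (N 1 j : ℝ) := by
  simp [Matrix.SpecialLinearGroup.coe_mul, Matrix.mul_apply, Fin.sum_univ_two]

lemma coe_neg_apply (M : SL(2, Ring p)) (i j : Fin 2) :
    (((-M) i j : Ring p) : ℝ) = -(M i j : ℝ) := by
  simp [Matrix.SpecialLinearGroup.coe_neg]

lemma coe_det (M : SL(2, Ring p)) :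
    (M 0 0 : ℝ) * (M 1 1 : ℝ) - (M 0 1 : ℝ) * (M 1 0 : ℝ) = 1 := by
  have h := M.det_coe
  rw [Matrix.det_fin_two] at h
  have h' := congrArg (fun x : Ring p => (x : ℝ)) h
  simpa using h'

lemma inv_apply₀₀ (M : SL(2, Ring p)) : M⁻¹ 0 0 = M 1 1 := by
  simp [Matrix.SpecialLinearGroup.coe_inv, Matrix.adjugate_fin_two]
lemma inv_apply₀₁ (M : SL(2, Ring p)) : M⁻¹ 0 1 = -M 0 1 := by
  simp [Matrix.SpecialLinearGroup.coe_inv, Matrix.adjugate_fin_two]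
lemma inv_apply₁₀ (M : SL(2, Ring p)) : M⁻¹ 1 0 = -M 1 0 := by
  simp [Matrix.SpecialLinearGroup.coe_inv, Matrix.adjugate_fin_two]
lemma inv_apply₁₁ (M : SL(2, Ring p)) : M⁻¹ 1 1 = M 0 0 := by
  simp [Matrix.SpecialLinearGroup.coe_inv, Matrix.adjugate_fin_two]

@[simp] lemma one_apply₀₀ : (1 : SL(2, Ring p)) 0 0 = 1 := by simp
@[simp] lemma one_apply₀₁ : (1 : SL(2, Ring p)) 0 1 = 0 := by simp
@[simp] lemma one_apply₁₀ : (1 : SL(2, Ring p)) 1 0 = 0 := by simp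
@[simp] lemma one_apply₁₁ : (1 : SL(2, Ring p)) 1 1 = 1 := by simp

lemma SL_ext {M N : SL(2, Ring p)} (h₀₀ : (M 0 0 : ℝ) = N 0 0) (h₀₁ : (M 0 1 : ℝ) = N 0 1)
    (h₁₀ : (M 1 0 : ℝ) = N 1 0) (h₁₁ : (M 1 1 : ℝ) = N 1 1) : M = N := by
  refine Subtype.ext (Matrix.ext fun i j => Subtype.ext ?_)
  fin_cases i <;> fin_cases j
  exacts [h₀₀, h₀₁, h₁₀, h₁₁]

/-- `M x = y` for the action by linear fractional transformations, at real points `x`, `y`. -/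
def Maps (M : SL(2, Ring p)) (x y : ℝ) : Prop :=
  (M 1 0 : ℝ) * x + (M 1 1 : ℝ) ≠ 0 ∧
    (M 0 0 : ℝ) * x + (M 0 1 : ℝ) = ((M 1 0 : ℝ) * x + (M 1 1 : ℝ)) * y

lemma Maps.one (x : ℝ) : Maps (1 : SL(2, Ring p)) x x := by simp [Maps]

lemma Maps.mul {M N : SL(2, Ring p)} {x y z : ℝ} (hM : Maps M y z) (hN : Maps N x y) :
    Maps (M * N) x z := by
  obtain ⟨h1, h2⟩ := hM
  obtain ⟨h3, h4⟩ := hN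
  have key : ((M * N) 1 0 : ℝ) * x + ((M * N) 1 1 : ℝ)
      = ((M 1 0 : ℝ) * y + M 1 1) * ((N 1 0 : ℝ) * x + N 1 1) := by
    simp only [coe_mul_apply]; linear_combination (M 1 0 : ℝ) * h4
  refine ⟨by rw [key]; exact mul_ne_zero h1 h3, ?_⟩
  rw [key]; simp only [coe_mul_apply]
  linear_combination (M 0 0 : ℝ) * h4 + ((N 1 0 : ℝ) * x + N 1 1) * h2

lemma Maps.inv {M : SL(2, Ring p)} {x y : ℝ} (h : Maps M x y) : Maps M⁻¹ y x := by
  obtain ⟨h1, h2⟩ := h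
  have hd := coe_det M
  have key : ((M 1 0 : ℝ) * x + M 1 1) * (-(M 1 0 : ℝ) * y + M 0 0) = 1 := by
    linear_combination (M 1 0 : ℝ) * h2 + hd
  simp only [Maps, inv_apply₀₀, inv_apply₀₁, inv_apply₁₀, inv_apply₁₁, NegMemClass.coe_neg]
  refine ⟨right_ne_zero_of_mul_eq_one key, mul_left_cancel₀ h1 ?_⟩
  linear_combination (-x) * key - (M 1 1 : ℝ) * h2 + hd * x

lemma Maps.neg {M : SL(2, Ring p)} {x y : ℝ} (h : Maps M x y) : Maps (-M) x y := by
  obtain ⟨h1, h2⟩ := h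
  simp only [Maps, coe_neg_apply]
  exact ⟨by contrapose! h1; linarith, by linarith⟩

lemma Maps.unique {M : SL(2, Ring p)} {x y z : ℝ} (h : Maps M x y) (h' : Maps M x z) : y = z :=
  mul_left_cancel₀ h.1 (h.2.symm.trans h'.2)

lemma Maps.injective {M : SL(2, Ring p)} {x y z : ℝ} (h : Maps M x z) (h' : Maps M y z) :
    x = y := h.inv.unique h'.inv

lemma fixes_iff_maps {M : SL(2, Ring p)} {x : ℝ} : Fixes M x ↔ Maps M x x := by
  refine ⟨fun h => ⟨fun h0 => ?_, h⟩, fun h => h.2⟩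
  have hd := coe_det M
  unfold Fixes at h
  rw [h0, zero_mul] at h
  have : (1 : ℝ) = 0 := by linear_combination -hd + (M 0 0 : ℝ) * h0 - (M 1 0 : ℝ) * h
  exact one_ne_zero this

/-- Equality of matrices up to sign, that is, of the transformations they define. -/
def SignEq (M N : SL(2, Ring p)) : Prop := M = N ∨ M = -N

namespace SignEq

variable {M N K L : SL(2, Ring p)}

lemma refl (M : SL(2, Ring p)) : SignEq M M := Or.inl rfl
lemma symm (h : SignEq M N) : SignEq N M := by
  rcases h with rfl | rfl
  · exact refl _
  · exact Or.inr (neg_neg _).symm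
lemma trans (h : SignEq M N) (h' : SignEq N K) : SignEq M K := by
  rcases h with rfl | rfl <;> rcases h' with rfl | rfl <;> simp [SignEq]
lemma mul (h : SignEq M N) (h' : SignEq K L) : SignEq (M * K) (N * L) := by
  rcases h with rfl | rfl <;> rcases h' with rfl | rfl <;> simp [SignEq]
lemma of_neg (M : SL(2, Ring p)) : SignEq (-M) M := Or.inr rfl
lemma maps (h : SignEq M N) {x y : ℝ} (hM : Maps N x y) : Maps M x y := by
  rcases h with rfl | rfl
  · exact hM
  · exact hM.neg
lemma abs_trace (h : SignEq M N) :
    |(M 0 0 : ℝ) + M 1 1| = |(N 0 0 : ℝ) + N 1 1| := by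
  rcases h with rfl | rfl
  · rfl
  · rw [coe_neg_apply, coe_neg_apply, ← neg_add, abs_neg]
lemma abs_den (h : SignEq M N) (x : ℝ) :
    |(M 1 0 : ℝ) * x + M 1 1| = |(N 1 0 : ℝ) * x + N 1 1| := by
  rcases h with rfl | rfl
  · rfl
  · rw [coe_neg_apply, coe_neg_apply, ← abs_neg]; ring_nf

end SignEq

lemma T_mul_T : T p * T p = -1 := by
  apply SL_ext <;> rw [coe_mul_apply, coe_neg_apply] <;> simp [T]

lemma T_inv : (T p)⁻¹ = -T p := by
  rw [inv_eq_iff_mul_eq_one, mul_neg, T_mul_T, neg_neg]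

lemma S_mem : S p ∈ group p := Subgroup.subset_closure (by simp)
lemma T_mem : T p ∈ group p := Subgroup.subset_closure (by simp)
lemma U_mem : U p ∈ group p := mul_mem S_mem T_mem
lemma neg_one_mem : (-1 : SL(2, Ring p)) ∈ group p := T_mul_T (p := p) ▸ mul_mem T_mem T_mem
lemma neg_mem_group {M : SL(2, Ring p)} (h : M ∈ group p) : -M ∈ group p := by
  simpa using mul_mem neg_one_mem h

lemma maps_T {x : ℝ} (hx : x ≠ 0) : Maps (T p) x (-1 / x) := by
  refine ⟨by simpa [T] using hx, ?_⟩
  simp only [T]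
  simp
  field_simp

end Matrices

/-! ### The letters `-U ^ (j + 1) T` and the partition of the half-line -/

section Letters

variable {p : ℕ}

/-- `sin (n π / p) / sin (π / p)`: the absolute values of the entries of the powers of `U`. -/
def sinQuot (p n : ℕ) : ℝ := Real.sin (n * (Real.pi / p)) / Real.sin (Real.pi / p)

lemma sin_pi_div_pos (hp : 3 ≤ p) : 0 < Real.sin (Real.pi / p) := by
  have h3 : (3 : ℝ) ≤ p := by exact_mod_cast hp
  apply Real.sin_pos_of_pos_of_lt_pi (by positivity)
  rw [div_lt_iff₀ (by linarith)]
  nlinarith [Real.pi_pos]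

@[simp] lemma sinQuot_zero : sinQuot p 0 = 0 := by simp [sinQuot]

lemma sinQuot_one (hp : 3 ≤ p) : sinQuot p 1 = 1 := by
  simp [sinQuot, (sin_pi_div_pos hp).ne']

lemma sinQuot_add_two (n : ℕ) :
    sinQuot p (n + 2) = lam p * sinQuot p (n + 1) - sinQuot p n := by
  simp only [sinQuot, lam]
  generalize Real.pi / p = t
  rw [← mul_div_assoc, ← sub_div]
  congr 1
  have e1 : ((n + 2 : ℕ) : ℝ) * t = ((n + 1 : ℕ) : ℝ) * t + t := by push_cast; ring
  have e2 : (n : ℝ) * t = ((n + 1 : ℕ) : ℝ) * t - t := by push_cast; ring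
  rw [e1, e2, Real.sin_add, Real.sin_sub]; ring

lemma sinQuot_self (hp : 3 ≤ p) : sinQuot p p = 0 := by
  have : (p : ℝ) ≠ 0 := by positivity
  simp [sinQuot, mul_div_cancel₀ _ this]

lemma sinQuot_pos (hp : 3 ≤ p) {n : ℕ} (h0 : 0 < n) (hn : n < p) : 0 < sinQuot p n := by
  refine div_pos (Real.sin_pos_of_pos_of_lt_pi ?_ ?_) (sin_pi_div_pos hp)
  · have := Real.pi_pos; positivity
  · have h1 : (n : ℝ) < p := by exact_mod_cast hn
    have h2 : (0 : ℝ) < p := by positivity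
    rw [mul_div_assoc', div_lt_iff₀ h2]
    nlinarith [Real.pi_pos]

lemma sinQuot_nonneg (hp : 3 ≤ p) {n : ℕ} (hn : n ≤ p) : 0 ≤ sinQuot p n := by
  rcases Nat.eq_zero_or_pos n with rfl | h0
  · simp
  rcases hn.eq_or_lt with rfl | hn
  · rw [sinQuot_self hp]
  · exact (sinQuot_pos hp h0 hn).le

/-- The matrix `-U ^ (j + 1) T`. For `j + 1 < p` its entries are non-negative, and these `p - 1`
matrices map the half-line `[0, ∞)` onto the parts of a partition of it. -/
def letter (p j : ℕ) : SL(2, Ring p) := -(U p ^ (j + 1) * T p)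

lemma U_mul_letter (j : ℕ) : U p * letter p j = letter p (j + 1) := by
  simp only [letter]
  rw [mul_neg, ← mul_assoc, ← pow_succ']

lemma letter_zero : letter p 0 = S p := by
  simp only [letter, U, zero_add, pow_one]
  rw [mul_assoc, T_mul_T]; simp

lemma letter_mem (j : ℕ) : letter p j ∈ group p :=
  neg_mem_group (mul_mem (pow_mem U_mem _) T_mem)

lemma letter_entries (hp : 3 ≤ p) (j : ℕ) :
    (letter p j 0 0 : ℝ) = sinQuot p (j + 1) ∧ (letter p j 0 1 : ℝ) = sinQuot p (j + 2) ∧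
    (letter p j 1 0 : ℝ) = sinQuot p j ∧ (letter p j 1 1 : ℝ) = sinQuot p (j + 1) := by
  induction j with
  | zero =>
    rw [letter_zero, sinQuot_add_two]
    simp [S, sinQuot_one hp, lamR]
  | succ j ih =>
    obtain ⟨h1, h2, h3, h4⟩ := ih
    have e1 : (U p 0 0 : ℝ) = lam p := by rw [U, coe_mul_apply]; simp [S, T, lamR]
    have e2 : (U p 0 1 : ℝ) = -1 := by rw [U, coe_mul_apply]; simp [S, T]
    have e3 : (U p 1 0 : ℝ) = 1 := by rw [U, coe_mul_apply]; simp [S, T]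
    have e4 : (U p 1 1 : ℝ) = 0 := by rw [U, coe_mul_apply]; simp [S, T]
    simp only [← U_mul_letter, coe_mul_apply, h1, h2, h3, h4, e1, e2, e3, e4]
    rw [sinQuot_add_two (j + 1), sinQuot_add_two j]
    refine ⟨by ring, by ring, by ring, by ring⟩

lemma letter_last (hp : 3 ≤ p) : letter p (p - 1) = T p := by
  obtain ⟨h1, h2, h3, h4⟩ := letter_entries hp (p - 1)
  obtain ⟨n, rfl⟩ : ∃ n, p = n + 2 := ⟨p - 2, by omega⟩
  have e1 : n + 2 - 1 = n + 1 := rfl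
  have hs := sinQuot_self hp
  have hd := coe_det (letter (n + 2) (n + 1))
  simp only [e1] at *
  have e : sinQuot (n + 2) (n + 1) = 1 := by
    simp only [sinQuot]
    rw [div_eq_one_iff_eq (sin_pi_div_pos hp).ne', ← Real.sin_pi_sub]
    congr 1
    push_cast; field_simp; ring
  rw [h1, h2, h3, h4] at hd
  rw [show n + 1 + 1 = n + 2 from rfl, hs] at *
  rw [e] at hd h3
  apply SL_ext
  · rw [h1]; simp [T]
  · rw [h2]; simp [T]; linarith
  · rw [h3]; simp [T]
  · rw [h4]; simp [T]

lemma sinQuot_sq (hp : 3 ≤ p) (j : ℕ) :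
    sinQuot p (j + 1) * sinQuot p (j + 1) - sinQuot p (j + 2) * sinQuot p j = 1 := by
  obtain ⟨h1, h2, h3, h4⟩ := letter_entries hp j
  have := coe_det (letter p j)
  rwa [h1, h2, h3, h4] at this

lemma sinQuot_pred (hp : 3 ≤ p) : sinQuot p (p - 2 + 1) = 1 := by
  have h1 := sinQuot_sq hp (p - 2)
  rw [show p - 2 + 2 = p by omega, sinQuot_self hp] at h1
  have h2 := sinQuot_pos hp (n := p - 2 + 1) (by omega) (by omega)
  nlinarith

/-- The index of the letter whose image contains `x ≥ 0`. -/
def digit (p : ℕ) (x : ℝ) : ℕ := sInf {j | sinQuot p (j + 2) ≤ x * sinQuot p (j + 1)}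

/-- The preimage of `x ≥ 0` by the letter whose image contains it. -/
def next (p : ℕ) (x : ℝ) : ℝ :=
  (sinQuot p (digit p x + 1) * x - sinQuot p (digit p x + 2)) /
    (sinQuot p (digit p x + 1) - sinQuot p (digit p x) * x)

lemma digit_spec (hp : 3 ≤ p) {x : ℝ} (hx : 0 ≤ x) :
    digit p x + 1 < p ∧ sinQuot p (digit p x + 2) ≤ x * sinQuot p (digit p x + 1) ∧
      x * sinQuot p (digit p x) < sinQuot p (digit p x + 1) := by
  have hmem : p - 2 ∈ {j | sinQuot p (j + 2) ≤ x * sinQuot p (j + 1)} := by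
    have e : p - 2 + 2 = p := by omega
    simp only [Set.mem_ofPred_eq, e, sinQuot_self hp]
    exact mul_nonneg hx (sinQuot_nonneg hp (by omega))
  refine ⟨?_, Nat.sInf_mem ⟨_, hmem⟩, ?_⟩
  · have : digit p x ≤ p - 2 := Nat.sInf_le hmem
    omega
  · by_cases h0 : digit p x = 0
    · rw [h0, sinQuot_zero, zero_add, sinQuot_one hp]; simp
    · obtain ⟨n, hn⟩ := Nat.exists_eq_succ_of_ne_zero h0
      have := Nat.notMem_of_lt_sInf (show n < digit p x by omega)
      simp only [Set.mem_ofPred_eq, not_le] at this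
      rw [hn]; exact this

lemma next_nonneg (hp : 3 ≤ p) {x : ℝ} (hx : 0 ≤ x) : 0 ≤ next p x := by
  obtain ⟨-, h2, h3⟩ := digit_spec hp hx
  exact div_nonneg (by linarith) (by linarith)

lemma letter_den_pos (hp : 3 ≤ p) {j : ℕ} (hj : j + 1 < p) {x : ℝ} (hx : 0 ≤ x) :
    0 < (letter p j 1 0 : ℝ) * x + letter p j 1 1 := by
  obtain ⟨-, -, h3, h4⟩ := letter_entries hp j
  rw [h3, h4]
  have := sinQuot_pos hp (n := j + 1) (by omega) hj
  have := mul_nonneg (sinQuot_nonneg hp (n := j) (by omega)) hx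
  linarith

lemma letter_num_pos (hp : 3 ≤ p) {j : ℕ} (hj : j + 1 < p) {x : ℝ} (hx : 0 < x) :
    0 < (letter p j 0 0 : ℝ) * x + letter p j 0 1 := by
  obtain ⟨h1, h2, -, -⟩ := letter_entries hp j
  rw [h1, h2]
  have := mul_pos (sinQuot_pos hp (n := j + 1) (by omega) hj) hx
  have := sinQuot_nonneg hp (n := j + 2) (by omega)
  linarith

/-- The value of a letter at a real point. -/
def letterMap (p j : ℕ) (x : ℝ) : ℝ :=
  ((letter p j 0 0 : ℝ) * x + letter p j 0 1) / ((letter p j 1 0 : ℝ) * x + letter p j 1 1)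

lemma maps_letterMap (hp : 3 ≤ p) {j : ℕ} (hj : j + 1 < p) {x : ℝ} (hx : 0 ≤ x) :
    Maps (letter p j) x (letterMap p j x) := by
  have h := letter_den_pos hp hj hx
  exact ⟨h.ne', by rw [letterMap, mul_div_cancel₀ _ h.ne']⟩

lemma letterMap_pos (hp : 3 ≤ p) {j : ℕ} (hj : j + 1 < p) {x : ℝ} (hx : 0 < x) :
    0 < letterMap p j x :=
  div_pos (letter_num_pos hp hj hx) (letter_den_pos hp hj hx.le)

lemma letterMap_nonneg (hp : 3 ≤ p) {j : ℕ} (hj : j + 1 < p) {x : ℝ} (hx : 0 ≤ x) :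
    0 ≤ letterMap p j x := by
  refine div_nonneg ?_ (letter_den_pos hp hj hx).le
  obtain ⟨h1, h2, -, -⟩ := letter_entries hp j
  rw [h1, h2]
  have := mul_nonneg (sinQuot_nonneg hp (n := j + 1) (by omega)) hx
  have := sinQuot_nonneg hp (n := j + 2) (by omega)
  linarith

lemma maps_next (hp : 3 ≤ p) {x : ℝ} (hx : 0 ≤ x) : Maps (letter p (digit p x)) (next p x) x := by
  refine ⟨(letter_den_pos hp (digit_spec hp hx).1 (next_nonneg hp hx)).ne', ?_⟩
  obtain ⟨-, h2, h3⟩ := digit_spec hp hx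
  obtain ⟨e1, e2, e3, e4⟩ := letter_entries hp (digit p x)
  have hd := sinQuot_sq hp (digit p x)
  rw [e1, e2, e3, e4, next]
  have : sinQuot p (digit p x + 1) - sinQuot p (digit p x) * x ≠ 0 := by linarith
  rw [mul_div_assoc', mul_div_assoc', div_add' _ _ _ this, div_add' _ _ _ this,
    div_mul_eq_mul_div]
  congr 1
  ring

/-- The images of `[0, ∞)` by the letters are disjoint. -/
lemma letter_index_unique (hp : 3 ≤ p) {i j : ℕ} (hi : i + 1 < p) (hj : j + 1 < p) {x y z : ℝ}
    (hx : 0 ≤ x) (hy : 0 ≤ y) (h : Maps (letter p i) x z) (h' : Maps (letter p j) y z) :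
    i = j := by
  wlog hij : i < j generalizing i j x y
  · rcases lt_trichotomy i j with h1 | h1 | h1
    · exact absurd h1 hij
    · exact h1
    · exact (this hj hi hy hx h' h h1).symm
  exfalso
  have low : sinQuot p (i + 2) ≤ z * sinQuot p (i + 1) := by
    obtain ⟨e1, e2, e3, e4⟩ := letter_entries hp i
    obtain ⟨h1, h2⟩ := h
    have h0 := letter_den_pos hp hi hx
    have hd := sinQuot_sq hp i
    rw [e3, e4] at h0 h1
    rw [e1, e2, e3, e4] at h2
    by_contra! hc
    have := mul_lt_mul_of_pos_left hc h0
    have : x < 0 := by linear_combination this + sinQuot p (i + 1) * h2 - x * hd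
    linarith
  have up : z * sinQuot p j < sinQuot p (j + 1) := by
    obtain ⟨e1, e2, e3, e4⟩ := letter_entries hp j
    obtain ⟨h1, h2⟩ := h'
    have h0 := letter_den_pos hp hj hy
    have hd := sinQuot_sq hp j
    rw [e3, e4] at h0 h1
    rw [e1, e2, e3, e4] at h2
    by_contra! hc
    have := mul_le_mul_of_nonneg_left hc h0.le
    have : (1 : ℝ) ≤ 0 := by linear_combination this - sinQuot p j * h2 - hd
    linarith
  have mono : ∀ n, i + 1 + n < p → sinQuot p (i + 1 + n + 1) ≤ z * sinQuot p (i + 1 + n) := by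
    intro n
    induction n with
    | zero => intro _; exact low
    | succ n ih =>
      intro hn
      have h1 := ih (by omega)
      have hd := sinQuot_sq hp (i + 1 + n)
      have p1 := sinQuot_pos hp (n := i + 1 + n) (by omega) (by omega)
      have p2 := sinQuot_nonneg hp (n := i + 1 + n + 1) (by omega)
      refine le_of_mul_le_mul_right ?_ p1
      have := mul_le_mul_of_nonneg_left h1 p2
      show sinQuot p (i + 1 + n + 2) * _ ≤ z * sinQuot p (i + 1 + n + 1) * _
      nlinarith
  have := mono (j - (i + 1)) (by omega)
  rw [show i + 1 + (j - (i + 1)) = j by omega] at this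
  linarith

lemma digit_eq_of_maps (hp : 3 ≤ p) {j : ℕ} (hj : j + 1 < p) {x y : ℝ} (hy : 0 ≤ y) (hx : 0 ≤ x)
    (h : Maps (letter p j) y x) : digit p x = j ∧ next p x = y := by
  have e := letter_index_unique hp (digit_spec hp hx).1 hj (next_nonneg hp hx) hy (maps_next hp hx) h
  refine ⟨e, ?_⟩
  have h2 := maps_next hp hx
  rw [e] at h2
  exact h2.injective h

end Letters

/-! ### Expansions of points and equivalence under the Hecke group -/

section Expansions

variable {p : ℕ}

/-- The product of the first `n` letters of the expansion of `x ≥ 0`. -/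
def prefixWord (p : ℕ) (x : ℝ) : ℕ → SL(2, Ring p)
  | 0 => 1
  | n + 1 => prefixWord p x n * letter p (digit p ((next p)^[n] x))

lemma prefixWord_succ (x : ℝ) (n : ℕ) :
    prefixWord p x (n + 1) = letter p (digit p x) * prefixWord p (next p x) n := by
  induction n with
  | zero => simp [prefixWord]
  | succ n ih =>
    rw [prefixWord, ih, prefixWord, mul_assoc, Function.iterate_succ_apply]

lemma iterate_next_nonneg (hp : 3 ≤ p) {x : ℝ} (hx : 0 ≤ x) (n : ℕ) : 0 ≤ (next p)^[n] x := by
  induction n with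
  | zero => exact hx
  | succ n ih => rw [Function.iterate_succ_apply']; exact next_nonneg hp ih

lemma maps_prefixWord (hp : 3 ≤ p) {x : ℝ} (hx : 0 ≤ x) (n : ℕ) :
    Maps (prefixWord p x n) ((next p)^[n] x) x := by
  induction n with
  | zero => exact Maps.one x
  | succ n ih =>
    rw [Function.iterate_succ_apply']
    exact ih.mul (maps_next hp (iterate_next_nonneg hp hx n))

lemma prefixWord_mem (x : ℝ) (n : ℕ) : prefixWord p x n ∈ group p := by
  induction n with
  | zero => exact one_mem _
  | succ n ih => exact mul_mem ih (letter_mem _)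

/-- A list of indices of letters. -/
def IsWord (p : ℕ) (L : List ℕ) : Prop := ∀ j ∈ L, j + 1 < p

/-- The product of the letters with given indices. -/
def wordProd (p : ℕ) (L : List ℕ) : SL(2, Ring p) := (L.map (letter p)).prod

lemma exists_maps_wordProd (hp : 3 ≤ p) {L : List ℕ} (hL : IsWord p L) {y : ℝ} (hy : 0 ≤ y) :
    ∃ z, 0 ≤ z ∧ Maps (wordProd p L) y z := by
  induction L with
  | nil => exact ⟨y, hy, Maps.one y⟩
  | cons i M ihM =>
    obtain ⟨z, hz, hz'⟩ := ihM fun i hi => hL i (by simp [hi])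
    have hi := hL i (by simp)
    refine ⟨_, letterMap_nonneg hp hi hz, ?_⟩
    simpa [wordProd] using (maps_letterMap hp hi hz).mul hz'

/-- A word that maps `y ≥ 0` to `x` is an initial part of the expansion of `x`. -/
lemma eq_prefixWord_of_maps (hp : 3 ≤ p) {L : List ℕ} (hL : IsWord p L) {x y : ℝ} (hy : 0 ≤ y)
    (h : Maps (wordProd p L) y x) :
    0 ≤ x ∧ (next p)^[L.length] x = y ∧ prefixWord p x L.length = wordProd p L := by
  induction L generalizing x with
  | nil =>
    have : y = x := (Maps.one y).unique h
    exact ⟨this ▸ hy, this.symm, rfl⟩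
  | cons j L ih =>
    have hj : j + 1 < p := hL j (by simp)
    have hL' : IsWord p L := fun i hi => hL i (by simp [hi])
    obtain ⟨z, -, hz⟩ := exists_maps_wordProd hp hL' hy
    obtain ⟨hz0, hz1, hz2⟩ := ih hL' hz
    have hx : Maps (letter p j) z x := by
      have := h.mul hz.inv
      simpa [wordProd] using this
    have hx0 : 0 ≤ x := by
      rw [hx.unique (maps_letterMap hp hj hz0)]
      exact letterMap_nonneg hp hj hz0
    obtain ⟨e1, e2⟩ := digit_eq_of_maps hp hj hz0 hx0 hx
    refine ⟨hx0, ?_, ?_⟩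
    · rw [List.length_cons, Function.iterate_succ_apply, e2, hz1]
    · rw [List.length_cons, prefixWord_succ, e1, e2, hz2]; simp [wordProd]

lemma wordProd_append (L L' : List ℕ) : wordProd p (L ++ L') = wordProd p L * wordProd p L' := by
  simp [wordProd]

/-- Every element of the Hecke group, multiplied by a sufficiently long initial part of the
expansion of `x`, is up to sign a word or `T` times a word. -/
lemma exists_mul_prefixWord (hp : 3 ≤ p) {x : ℝ} (hx : 0 ≤ x) {g : SL(2, Ring p)}
    (hg : g ∈ group p) :
    ∃ n L, IsWord p L ∧ (SignEq (g * prefixWord p x n) (wordProd p L) ∨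
      SignEq (g * prefixWord p x n) (T p * wordProd p L)) := by
  -- words may be assumed to be non-empty
  have ext : ∀ h : SL(2, Ring p),
      (∃ n L, IsWord p L ∧ (SignEq (h * prefixWord p x n) (wordProd p L) ∨
        SignEq (h * prefixWord p x n) (T p * wordProd p L))) →
      ∃ n j L, j + 1 < p ∧ IsWord p L ∧
        (SignEq (h * prefixWord p x n) (letter p j * wordProd p L) ∨
        SignEq (h * prefixWord p x n) (T p * (letter p j * wordProd p L))) := by
    rintro h ⟨n, L, hL, hh⟩
    obtain ⟨d, hd⟩ : ∃ d, d = digit p ((next p)^[n] x) := ⟨_, rfl⟩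
    have hdp : d + 1 < p := hd ▸ (digit_spec hp (iterate_next_nonneg hp hx n)).1
    have hpre : prefixWord p x (n + 1) = prefixWord p x n * letter p d := by rw [hd, prefixWord]
    have hh' : SignEq (h * prefixWord p x (n + 1)) (wordProd p (L ++ [d])) ∨
        SignEq (h * prefixWord p x (n + 1)) (T p * wordProd p (L ++ [d])) := by
      have e : wordProd p [d] = letter p d := by simp [wordProd]
      rw [hpre, ← mul_assoc, wordProd_append, ← mul_assoc, e]
      exact hh.imp (fun k => k.mul (.refl _)) (fun k => k.mul (.refl _))
    have hw : IsWord p (L ++ [d]) := by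
      intro i hi
      rcases List.mem_append.1 hi with hi | hi
      · exact hL i hi
      · rw [List.mem_singleton.1 hi]; exact hdp
    obtain ⟨j, M, hM⟩ : ∃ j M, L ++ [d] = j :: M := by
      cases L with
      | nil => exact ⟨d, [], rfl⟩
      | cons a L => exact ⟨a, L ++ [d], rfl⟩
    rw [hM] at hh' hw
    exact ⟨n + 1, j, M, hw j (by simp), fun i hi => hw i (by simp [hi]), by
      simpa [wordProd] using hh'⟩
  have hU : U p = S p * T p := rfl
  have hTT : T p * T p = -1 := T_mul_T
  have hS : S p = -(U p * T p) := by rw [hU, mul_assoc, hTT]; simp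
  have hSinv : (S p)⁻¹ = T p * (U p)⁻¹ := by rw [hU, mul_inv_rev]; simp
  have cons : ∀ {j L}, j + 1 < p → IsWord p L → IsWord p (j :: L) := by
    intro j L hj hL i hi
    rcases List.mem_cons.1 hi with rfl | hi
    · exact hj
    · exact hL i hi
  have wcons : ∀ j L, wordProd p (j :: L) = letter p j * wordProd p L := by simp [wordProd]
  have hT : ∀ h : SL(2, Ring p),
      (∃ n L, IsWord p L ∧ (SignEq (h * prefixWord p x n) (wordProd p L) ∨
        SignEq (h * prefixWord p x n) (T p * wordProd p L))) →
      ∃ n L, IsWord p L ∧ (SignEq (T p * h * prefixWord p x n) (wordProd p L) ∨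
        SignEq (T p * h * prefixWord p x n) (T p * wordProd p L)) := by
    rintro h ⟨n, L, hL, hh | hh⟩
    · refine ⟨n, L, hL, Or.inr ?_⟩
      rw [mul_assoc]; exact (SignEq.refl _).mul hh
    · refine ⟨n, L, hL, Or.inl ?_⟩
      rw [mul_assoc]
      refine ((SignEq.refl _).mul hh).trans ?_
      rw [← mul_assoc, hTT, neg_one_mul]; exact .of_neg _
  have hlast := letter_last hp
  have hlastU : SignEq (U p)⁻¹ (letter p (p - 2) * T p) := by
    have : U p * letter p (p - 2) = T p := by
      rw [U_mul_letter, ← hlast]; congr 1; omega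
    rw [eq_comm, ← inv_mul_eq_iff_eq_mul] at this
    rw [← this, mul_assoc, hTT]; exact Or.inr (by simp)
  refine Subgroup.closure_induction_left (p := fun g _ => ∃ n L, IsWord p L ∧
      (SignEq (g * prefixWord p x n) (wordProd p L) ∨
      SignEq (g * prefixWord p x n) (T p * wordProd p L))) ?_ ?_ ?_ hg
  · exact ⟨0, [], by simp [IsWord], Or.inl (by simpa [prefixWord, wordProd] using .refl 1)⟩
  · rintro s hs h - ih
    rcases hs with rfl | rfl
    · obtain ⟨n, j, L, hj, hL, hh | hh⟩ := ext h ih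
      · refine ⟨n, 0 :: j :: L, cons (by omega) (cons hj hL), Or.inl ?_⟩
        rw [mul_assoc, wcons, wcons, letter_zero]; exact (SignEq.refl _).mul hh
      · have : SignEq (S p * h * prefixWord p x n) (letter p (j + 1) * wordProd p L) := by
          rw [mul_assoc]
          refine ((SignEq.refl _).mul hh).trans ?_
          rw [← mul_assoc, ← hU, ← mul_assoc, U_mul_letter]; exact .refl _
        by_cases hj' : j + 2 < p
        · exact ⟨n, (j + 1) :: L, cons hj' hL, Or.inl (by rwa [wcons])⟩
        · refine ⟨n, L, hL, Or.inr ?_⟩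
          rwa [show j + 1 = p - 1 by omega, hlast] at this
    · exact hT h ih
  · rintro s hs h - ih
    rcases hs with rfl | rfl
    · obtain ⟨n, j, L, hj, hL, hh | hh⟩ := ext h ih
      · have h1 : SignEq ((S p)⁻¹ * h * prefixWord p x n)
            (T p * ((U p)⁻¹ * letter p j) * wordProd p L) := by
          rw [hSinv, mul_assoc]
          refine ((SignEq.refl _).mul hh).trans ?_
          simp only [mul_assoc]; exact .refl _
        cases j with
        | zero =>
          refine ⟨n, L, hL, Or.inl (h1.trans ?_)⟩
          rw [letter_zero, hS, mul_neg, ← mul_assoc (U p)⁻¹, inv_mul_cancel, one_mul, mul_neg, hTT]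
          simpa using SignEq.refl _
        | succ j =>
          refine ⟨n, j :: L, cons (by omega) hL, Or.inr (h1.trans ?_)⟩
          rw [← U_mul_letter, inv_mul_cancel_left, wcons, mul_assoc]; exact .refl _
      · refine ⟨n, (p - 2) :: j :: L, cons (by omega) (cons hj hL), Or.inr ?_⟩
        rw [hSinv, mul_assoc, wcons, wcons, mul_assoc]
        refine (SignEq.refl _).mul ((hlastU.mul hh).trans ?_)
        rw [mul_assoc, ← mul_assoc (T p), hTT]
        refine (SignEq.refl _).mul ?_
        rw [neg_one_mul]; exact .of_neg _
    · obtain ⟨n, L, hL, hh⟩ := hT h ih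
      refine ⟨n, L, hL, ?_⟩
      have : SignEq ((T p)⁻¹ * h * prefixWord p x n) (T p * h * prefixWord p x n) := by
        rw [T_inv, neg_mul, neg_mul]; exact .of_neg _
      exact hh.imp this.trans this.trans

/-- Equivalent points of `[0, ∞)` have expansions with a common tail, and the transformation that
maps one to the other exchanges the initial parts. -/
lemma exists_prefixWord_of_maps (hp : 3 ≤ p) {x y : ℝ} (hx : 0 ≤ x) (hy : 0 ≤ y)
    {g : SL(2, Ring p)} (hg : g ∈ group p) (h : Maps g x y) :
    ∃ m n, (next p)^[m] x = (next p)^[n] y ∧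
      SignEq g (prefixWord p y n * (prefixWord p x m)⁻¹) := by
  obtain ⟨m, L, hL, hh⟩ := exists_mul_prefixWord hp hx hg
  have ht := iterate_next_nonneg hp hx m
  have hm := h.mul (maps_prefixWord hp hx m)
  rcases hh with hh | hh
  · obtain ⟨-, h1, h2⟩ := eq_prefixWord_of_maps hp hL ht (hh.symm.maps hm)
    refine ⟨m, L.length, h1.symm, ?_⟩
    rw [h2]
    simpa using hh.mul (SignEq.refl (prefixWord p x m)⁻¹)
  · exfalso
    -- `T` maps `[0, ∞)` to its complement
    have hm' := hh.symm.maps hm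
    obtain ⟨z, hz, hz'⟩ := exists_maps_wordProd hp hL ht
    have := hm'.mul hz'.inv
    rw [mul_inv_cancel_right] at this
    obtain ⟨h1, h2⟩ := this
    simp [T] at h1 h2
    nlinarith [mul_nonneg hz hy]

end Expansions

/-! ### Stabilizers -/

section Stabilizers

variable {p : ℕ}

lemma den_mul {M N : SL(2, Ring p)} {x y : ℝ} (hN : Maps N x y) :
    ((M * N) 1 0 : ℝ) * x + ((M * N) 1 1 : ℝ)
      = ((M 1 0 : ℝ) * y + M 1 1) * ((N 1 0 : ℝ) * x + N 1 1) := by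
  simp only [coe_mul_apply]; linear_combination (M 1 0 : ℝ) * hN.2

lemma Maps.pow {M : SL(2, Ring p)} {x : ℝ} (h : Maps M x x) (n : ℕ) : Maps (M ^ n) x x := by
  induction n with
  | zero => simpa using Maps.one x
  | succ n ih => rw [pow_succ]; exact ih.mul h

lemma den_pow {M : SL(2, Ring p)} {x : ℝ} (h : Maps M x x) (n : ℕ) :
    ((M ^ n) 1 0 : ℝ) * x + ((M ^ n) 1 1 : ℝ) = ((M 1 0 : ℝ) * x + M 1 1) ^ n := by
  induction n with
  | zero => simp
  | succ n ih => rw [pow_succ, den_mul h, ih, pow_succ]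

lemma den_zpow {M : SL(2, Ring p)} {x : ℝ} (h : Maps M x x) (n : ℤ) :
    ((M ^ n) 1 0 : ℝ) * x + ((M ^ n) 1 1 : ℝ) = ((M 1 0 : ℝ) * x + M 1 1) ^ n := by
  cases n with
  | ofNat n => simpa using den_pow h n
  | negSucc n =>
    have h1 := den_mul (M := (M ^ (n + 1))⁻¹) (h.pow (n + 1))
    rw [inv_mul_cancel, den_pow h] at h1
    simp only [one_apply₁₀, one_apply₁₁, ZeroMemClass.coe_zero, OneMemClass.coe_one, zero_mul,
      zero_add] at h1
    rw [zpow_negSucc, zpow_negSucc]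
    exact eq_inv_of_mul_eq_one_left h1.symm

/-- The trace of a matrix in terms of its multiplier at a fixed point. -/
lemma trace_eq {M : SL(2, Ring p)} {x : ℝ} (h : Maps M x x) :
    (M 0 0 : ℝ) + M 1 1 = ((M 1 0 : ℝ) * x + M 1 1) + ((M 1 0 : ℝ) * x + M 1 1)⁻¹ := by
  obtain ⟨h1, h2⟩ := h
  have hd := coe_det M
  have : ((M 1 0 : ℝ) * x + M 1 1)⁻¹ = M 0 0 - M 1 0 * x := by
    rw [inv_eq_iff_eq_inv, eq_comm, inv_eq_of_mul_eq_one_left]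
    linear_combination (M 1 0 : ℝ) * h2 + hd
  rw [this]; ring

lemma two_lt_abs_trace_iff {M : SL(2, Ring p)} {x : ℝ} (h : Maps M x x) :
    2 < |(M 0 0 : ℝ) + M 1 1| ↔ |(M 1 0 : ℝ) * x + M 1 1| ≠ 1 := by
  rw [trace_eq h]
  obtain ⟨h1, -⟩ := h
  generalize (M 1 0 : ℝ) * x + M 1 1 = m at *
  have e : |m + m⁻¹| = |m| + |m|⁻¹ := by
    rcases lt_or_gt_of_ne h1 with h | h
    · have := inv_lt_zero.2 h
      rw [abs_of_neg h, abs_of_neg (by linarith), inv_neg]; ring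
    · have := inv_pos.2 h
      rw [abs_of_pos h, abs_of_pos (by linarith)]
  have hm : 0 < |m| := abs_pos.2 h1
  rw [e]
  generalize |m| = t at *
  have e2 : t + t⁻¹ - 2 = (t - 1) ^ 2 * t⁻¹ := by field_simp; ring
  rw [← sub_pos, e2]
  constructor
  · rintro h rfl; simp at h
  · intro h
    have := sub_ne_zero.2 h
    positivity

lemma IsHyperbolicPoint.maps {x : ℝ} (h : IsHyperbolicPoint p x) :
    ∃ M ∈ group p, Maps M x x ∧ |(M 1 0 : ℝ) * x + M 1 1| ≠ 1 := by
  obtain ⟨M, hM, h1, h2⟩ := h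
  have h2 := fixes_iff_maps.1 h2
  exact ⟨M, hM, h2, (two_lt_abs_trace_iff h2).1 h1⟩

lemma isHyperbolicPoint_of_maps {x : ℝ} {M : SL(2, Ring p)} (hM : M ∈ group p) (h : Maps M x x)
    (h' : |(M 1 0 : ℝ) * x + M 1 1| ≠ 1) : IsHyperbolicPoint p x :=
  ⟨M, hM, (two_lt_abs_trace_iff h).2 h', fixes_iff_maps.2 h⟩

lemma IsStabilizerGenerator.den_ne {x : ℝ} (hx : IsHyperbolicPoint p x) {M : SL(2, Ring p)}
    (hM : IsStabilizerGenerator p x M) : |(M 1 0 : ℝ) * x + M 1 1| ≠ 1 := by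
  obtain ⟨N, hN, h1, h2⟩ := hx.maps
  obtain ⟨n, hn⟩ := hM.2.2 N hN (fixes_iff_maps.2 h1)
  rw [SignEq.abs_den hn, den_zpow (fixes_iff_maps.1 hM.2.1), abs_zpow] at h2
  rintro h
  rw [h, one_zpow] at h2
  exact h2 rfl

lemma IsStabilizerGenerator.conj {x y : ℝ} {M V : SL(2, Ring p)}
    (hM : IsStabilizerGenerator p x M) (hV : V ∈ group p) (h : Maps V y x) :
    IsStabilizerGenerator p y (V⁻¹ * M * V) := by
  obtain ⟨h1, h2, h3⟩ := hM
  rw [fixes_iff_maps] at h2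
  refine ⟨mul_mem (mul_mem (inv_mem hV) h1) hV, fixes_iff_maps.2 ((h.inv.mul h2).mul h), ?_⟩
  intro N hN hf
  rw [fixes_iff_maps] at hf
  obtain ⟨n, hn⟩ := h3 (V * N * V⁻¹) (mul_mem (mul_mem hV hN) (inv_mem hV))
    (fixes_iff_maps.2 ((h.mul hf).mul h.inv))
  refine ⟨n, ?_⟩
  have := ((SignEq.refl V⁻¹).mul hn).mul (SignEq.refl V)
  have e : (V⁻¹ * M * V) ^ n = V⁻¹ * M ^ n * V := by
    have := conj_zpow (a := V⁻¹) (b := M) (i := n)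
    simpa using this
  rw [e]
  show SignEq N (V⁻¹ * M ^ n * V)
  simpa [mul_assoc] using this

lemma IsHyperbolicPoint.of_maps {x y : ℝ} {V : SL(2, Ring p)} (hx : IsHyperbolicPoint p x)
    (hV : V ∈ group p) (h : Maps V y x) : IsHyperbolicPoint p y := by
  obtain ⟨M, hM, h1, h2⟩ := hx.maps
  refine isHyperbolicPoint_of_maps (M := V⁻¹ * M * V) (mul_mem (mul_mem (inv_mem hV) hM) hV)
    ((h.inv.mul h1).mul h) ?_
  have e := den_mul (M := V) (h.inv)
  rw [mul_inv_cancel] at e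
  simp only [one_apply₁₀, one_apply₁₁, ZeroMemClass.coe_zero, OneMemClass.coe_one, zero_mul,
      zero_add] at e
  rw [den_mul h, den_mul h1, mul_right_comm, mul_comm (_ * _) (_ + _), mul_comm _ (_ + _), ← e,
    mul_one]
  exact h2

/-- The stabilizer of the cusp `0` is parabolic. -/
lemma abs_trace_of_apply₀₁_eq_zero (hp : 3 ≤ p) {g : SL(2, Ring p)} (hg : g ∈ group p)
    (h : (g 0 1 : ℝ) = 0) : |(g 0 0 : ℝ) + g 1 1| = 2 := by
  have hfix : Maps g 0 0 := fixes_iff_maps.1 (by simp [Fixes, h])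
  obtain ⟨m, n, -, hmn⟩ := exists_prefixWord_of_maps hp le_rfl le_rfl hg hfix
  have hj : p - 2 + 1 < p := by omega
  obtain ⟨e1, e2, e3, e4⟩ := letter_entries hp (p - 2)
  rw [show p - 2 + 2 = p by omega, sinQuot_self hp] at e2
  have hN : Maps (letter p (p - 2)) 0 0 := by
    have := maps_letterMap hp hj le_rfl
    rwa [letterMap, e2, mul_zero, zero_add, zero_div] at this
  obtain ⟨d1, d2⟩ := digit_eq_of_maps hp hj le_rfl le_rfl hN
  have hpre : ∀ n, prefixWord p 0 n = letter p (p - 2) ^ n := by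
    intro n
    induction n with
    | zero => rfl
    | succ n ih => rw [prefixWord_succ, d1, d2, ih, pow_succ']
  have hpow : ∀ n : ℕ, ((letter p (p - 2) ^ n) 0 0 : ℝ) = 1 ∧
      ((letter p (p - 2) ^ n) 0 1 : ℝ) = 0 ∧ ((letter p (p - 2) ^ n) 1 1 : ℝ) = 1 := by
    intro n
    induction n with
    | zero => simp
    | succ n ih =>
      obtain ⟨i1, i2, i3⟩ := ih
      simp only [pow_succ, coe_mul_apply, i1, i2, i3, e1, e2, e4, sinQuot_pred hp]
      simp
  rw [hmn.abs_trace, hpre, hpre, coe_mul_apply, coe_mul_apply]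
  obtain ⟨a1, a2, a3⟩ := hpow m
  obtain ⟨b1, b2, b3⟩ := hpow n
  rw [inv_apply₀₀, inv_apply₀₁, inv_apply₁₀, inv_apply₁₁, NegMemClass.coe_neg, NegMemClass.coe_neg,
    a1, a2, a3, b1, b2, b3]
  norm_num

/-- The stabilizer of the cusp `∞` is parabolic. -/
lemma abs_trace_of_apply₁₀_eq_zero (hp : 3 ≤ p) {g : SL(2, Ring p)} (hg : g ∈ group p)
    (h : (g 1 0 : ℝ) = 0) : |(g 0 0 : ℝ) + g 1 1| = 2 := by
  have e : ∀ i j, ((T p * g * (T p)⁻¹) i j : ℝ) = ![![(g 1 1 : ℝ), -g 1 0], ![-g 0 1, g 0 0]] i j := by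
    intro i j
    rw [T_inv, coe_mul_apply, coe_mul_apply, coe_mul_apply, coe_neg_apply, coe_neg_apply]
    fin_cases i <;> fin_cases j <;> simp [T]
  have := abs_trace_of_apply₀₁_eq_zero hp (g := T p * g * (T p)⁻¹)
    (mul_mem (mul_mem T_mem hg) (inv_mem T_mem)) (by rw [e]; simp [h])
  rw [e, e] at this
  simpa [add_comm] using this

lemma prefixWord_mul_inv_pow {x : ℝ} {i r : ℕ}
    (h : (next p)^[i + r] x = (next p)^[i] x) (m s : ℕ) :
    (prefixWord p x (i + r) * (prefixWord p x i)⁻¹) ^ m * prefixWord p x (i + s) =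
      prefixWord p x (i + s + m * r) := by
  have step : ∀ s, prefixWord p x (i + r) * (prefixWord p x i)⁻¹ * prefixWord p x (i + s) =
      prefixWord p x (i + s + r) := by
    intro s
    induction s with
    | zero => simp
    | succ s ih =>
      have e : (next p)^[i + s + r] x = (next p)^[i + s] x := by
        rw [show i + s + r = s + (i + r) by omega, Function.iterate_add_apply, h,
          ← Function.iterate_add_apply, add_comm s]
      rw [← add_assoc, prefixWord, ← mul_assoc, ih, show i + s + 1 + r = i + s + r + 1 by omega,
        prefixWord, e]
  induction m generalizing s with
  | zero => simp
  | succ m ih =>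
    rw [pow_succ, mul_assoc, step, add_assoc, ih]
    congr 1; ring

/-- If the expansion of `x ≥ 0` is eventually periodic, then the stabilizer of `x` is generated by
the transformation that corresponds to the shortest period. -/
lemma exists_isStabilizerGenerator_of_periodic (hp : 3 ≤ p) {x : ℝ} (hx : 0 ≤ x)
    (h : ∃ i r, 0 < r ∧ (next p)^[i + r] x = (next p)^[i] x) :
    ∃ i r, 0 < r ∧ (next p)^[i + r] x = (next p)^[i] x ∧
      IsStabilizerGenerator p x (prefixWord p x (i + r) * (prefixWord p x i)⁻¹) := by
  classical
  obtain ⟨i, r, hr, hir⟩ := h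
  have hper : ((next p)^[i] x) ∈ Function.periodicPts (next p) := by
    refine ⟨r, hr, ?_⟩
    rw [Function.IsPeriodicPt, Function.IsFixedPt, ← Function.iterate_add_apply, add_comm, hir]
  set y := (next p)^[i] x with hy
  set t := Function.minimalPeriod (next p) y with ht
  have ht0 : 0 < t := Function.minimalPeriod_pos_of_mem_periodicPts hper
  have hit : (next p)^[i + t] x = (next p)^[i] x := by
    rw [add_comm, Function.iterate_add_apply, ← hy]
    exact Function.isPeriodicPt_minimalPeriod (next p) y
  refine ⟨i, t, ht0, hit, mul_mem (prefixWord_mem _ _) (inv_mem (prefixWord_mem _ _)), ?_, ?_⟩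
  · rw [fixes_iff_maps]
    have := (maps_prefixWord hp hx (i + t))
    rw [hit] at this
    exact this.mul (maps_prefixWord hp hx i).inv
  set G := prefixWord p x (i + t) * (prefixWord p x i)⁻¹ with hG
  intro N hN hf
  obtain ⟨m, n, hmn, hs⟩ := exists_prefixWord_of_maps hp hx hx hN (fixes_iff_maps.1 hf)
  have main : ∀ m n, m ≤ n → (next p)^[m] x = (next p)^[n] x →
      ∃ k : ℕ, prefixWord p x n * (prefixWord p x m)⁻¹ = G ^ k := by
    intro m n hle heq
    -- move both indices past the preperiod
    have hpush : ∀ s, (next p)^[m + s] x = (next p)^[n + s] x ∧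
        prefixWord p x (n + s) * (prefixWord p x (m + s))⁻¹ =
          prefixWord p x n * (prefixWord p x m)⁻¹ := by
      intro s
      induction s with
      | zero => exact ⟨heq, rfl⟩
      | succ s ih =>
        refine ⟨?_, ?_⟩
        · rw [← add_assoc, ← add_assoc, Function.iterate_succ_apply', ih.1,
            Function.iterate_succ_apply']
        · rw [← add_assoc, ← add_assoc, prefixWord, prefixWord, ih.1, mul_inv_rev, ← ih.2]
          group
    obtain ⟨h1, h2⟩ := hpush i
    have hdvd : t ∣ n - m := by
      have : Function.IsPeriodicPt (next p) (n - m) ((next p)^[m] y) := by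
        rw [Function.IsPeriodicPt, Function.IsFixedPt, ← Function.iterate_add_apply,
          Nat.sub_add_cancel hle, hy, ← Function.iterate_add_apply, ← Function.iterate_add_apply]
        exact h1.symm
      have h3 := this.minimalPeriod_dvd
      rwa [Function.minimalPeriod_apply_iterate hper] at h3
    obtain ⟨k, hk⟩ := hdvd
    refine ⟨k, ?_⟩
    have := prefixWord_mul_inv_pow hit k m
    rw [← h2, ← hG] at *
    rw [add_comm m i, eq_comm, eq_mul_inv_iff_mul_eq, this]
    congr 1
    rw [mul_comm k t, ← hk]; omega
  rcases le_total m n with hle | hle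
  · obtain ⟨k, hk⟩ := main m n hle hmn
    exact ⟨k, by rw [zpow_natCast, ← hk]; exact hs⟩
  · obtain ⟨k, hk⟩ := main n m hle hmn.symm
    refine ⟨-k, ?_⟩
    rw [zpow_neg, zpow_natCast, ← hk, mul_inv_rev, inv_inv]
    exact hs

/-- Hyperbolic points have eventually periodic expansions. -/
lemma IsHyperbolicPoint.eventually_periodic (hp : 3 ≤ p) {x : ℝ} (h : IsHyperbolicPoint p x)
    (hx : 0 ≤ x) : ∃ i r, 0 < r ∧ (next p)^[i + r] x = (next p)^[i] x := by
  obtain ⟨M, hM, h1, h2⟩ := h.maps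
  obtain ⟨m, n, hmn, hs⟩ := exists_prefixWord_of_maps hp hx hx hM h1
  rcases lt_trichotomy m n with hlt | rfl | hlt
  · exact ⟨m, n - m, by omega, by rw [Nat.add_sub_cancel' hlt.le, hmn]⟩
  · rw [hs.abs_den] at h2
    simp at h2
  · exact ⟨n, m - n, by omega, by rw [Nat.add_sub_cancel' hlt.le, hmn]⟩

lemma IsHyperbolicPoint.exists_generator (hp : 3 ≤ p) {x : ℝ} (h : IsHyperbolicPoint p x) :
    ∃ M, IsStabilizerGenerator p x M := by
  have nonneg : ∀ y, IsHyperbolicPoint p y → 0 ≤ y → ∃ M, IsStabilizerGenerator p y M := by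
    intro y hy h0
    obtain ⟨i, r, -, -, hG⟩ :=
      exists_isStabilizerGenerator_of_periodic hp h0 (hy.eventually_periodic hp h0)
    exact ⟨_, hG⟩
  rcases le_or_gt 0 x with h0 | h0
  · exact nonneg x h h0
  · have hT : Maps (T p) x (-1 / x) := maps_T h0.ne
    have := div_pos_of_neg_of_neg (by norm_num : (-1 : ℝ) < 0) h0
    obtain ⟨M, hM⟩ := nonneg (-1 / x) (h.of_maps (inv_mem T_mem) hT.inv) this.le
    exact ⟨_, hM.conj T_mem hT⟩

end Stabilizers

/-! ### Forms of hyperbolic points -/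

section Forms

variable {p : ℕ}

lemma mul_apply_fin_two (M N : SL(2, Ring p)) (i j : Fin 2) :
    (M * N) i j = M i 0 * N 0 j + M i 1 * N 1 j := by
  simp [Matrix.SpecialLinearGroup.coe_mul, Matrix.mul_apply, Fin.sum_univ_two]

lemma ring_det (M : SL(2, Ring p)) : M 0 0 * M 1 1 - M 0 1 * M 1 0 = 1 := by
  have h := M.det_coe
  rwa [Matrix.det_fin_two] at h

lemma exists_pos_generator (h : IsPrincipalIdealRing (Ring p)) {I : Ideal (Ring p)} (hI : I ≠ ⊥) :
    ∃ g : Ring p, 0 < (g : ℝ) ∧ Ideal.span {g} = I := by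
  obtain ⟨a, ha⟩ := (h.principal I).principal
  have ha' : Ideal.span {a} = I := ha.symm
  have ha0 : (a : ℝ) ≠ 0 := by
    intro h0
    apply hI
    rw [← ha', Ideal.span_singleton_eq_bot]
    exact_mod_cast h0
  rcases lt_or_gt_of_ne ha0 with h1 | h1
  · exact ⟨-a, by simpa using h1, by rw [Ideal.span_singleton_neg, ha']⟩
  · exact ⟨a, h1, ha'⟩

lemma idealGen_pos {I : Ideal (Ring p)} (hI : I ≠ ⊥) : 0 < (idealGen p I : ℝ) := by
  unfold idealGen
  split_ifs with h
  · exact (Classical.epsilon_spec (exists_pos_generator h hI)).1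
  · simp

lemma span_idealGen (h : IsPrincipalIdealRing (Ring p)) {I : Ideal (Ring p)} (hI : I ≠ ⊥) :
    Ideal.span {idealGen p I} = I := by
  unfold idealGen
  rw [if_pos h]
  exact (Classical.epsilon_spec (exists_pos_generator h hI)).2

lemma idealGen_dvd {I : Ideal (Ring p)} (hI : I ≠ ⊥) {x : Ring p} (hx : x ∈ I) :
    idealGen p I ∣ x := by
  by_cases h : IsPrincipalIdealRing (Ring p)
  · rwa [← span_idealGen h hI, Ideal.mem_span_singleton] at hx
  · simp [idealGen, h]

/-- The ideal attached to the fixed points of `M`. -/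
def fixIdeal (M : SL(2, Ring p)) : Ideal (Ring p) :=
  Ideal.span {M 1 0, M 1 1 - M 0 0, -M 0 1}

lemma mem_fixIdeal {M : SL(2, Ring p)} {x : Ring p} :
    x ∈ fixIdeal M ↔ ∃ u v w, u * M 1 0 + v * (M 1 1 - M 0 0) + w * (-M 0 1) = x := by
  rw [fixIdeal]
  exact Submodule.mem_span_triple

lemma conj_entries (M V : SL(2, Ring p)) :
    (V⁻¹ * M * V) 1 0 = M 1 0 * V 0 0 ^ 2 + (M 1 1 - M 0 0) * (V 0 0 * V 1 0)
      + (-M 0 1) * V 1 0 ^ 2 ∧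
    (V⁻¹ * M * V) 1 1 - (V⁻¹ * M * V) 0 0 = 2 * M 1 0 * V 0 0 * V 0 1
      + (M 1 1 - M 0 0) * (V 0 0 * V 1 1 + V 0 1 * V 1 0) + 2 * (-M 0 1) * V 1 0 * V 1 1 ∧
    -(V⁻¹ * M * V) 0 1 = M 1 0 * V 0 1 ^ 2 + (M 1 1 - M 0 0) * (V 0 1 * V 1 1)
      + (-M 0 1) * V 1 1 ^ 2 := by
  simp only [mul_apply_fin_two, inv_apply₀₀, inv_apply₀₁, inv_apply₁₀, inv_apply₁₁]
  refine ⟨by ring, by ring, by ring⟩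

lemma fixIdeal_conj (M V : SL(2, Ring p)) : fixIdeal (V⁻¹ * M * V) = fixIdeal M := by
  have le : ∀ M V : SL(2, Ring p), fixIdeal (V⁻¹ * M * V) ≤ fixIdeal M := by
    intro M V
    obtain ⟨e1, e2, e3⟩ := conj_entries M V
    rw [fixIdeal, Ideal.span_le]
    rintro x (rfl | rfl | rfl)
    · exact mem_fixIdeal.2 ⟨V 0 0 ^ 2, V 0 0 * V 1 0, V 1 0 ^ 2, by rw [e1]; ring⟩
    · exact mem_fixIdeal.2 ⟨2 * V 0 0 * V 0 1, V 0 0 * V 1 1 + V 0 1 * V 1 0,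
        2 * V 1 0 * V 1 1, by rw [e2]; ring⟩
    · exact mem_fixIdeal.2 ⟨V 0 1 ^ 2, V 0 1 * V 1 1, V 1 1 ^ 2, by rw [e3]; ring⟩
  refine le_antisymm (le M V) ?_
  have := le (V⁻¹ * M * V) V⁻¹
  simpa [mul_assoc] using this

lemma fixIdeal_inv (M : SL(2, Ring p)) : fixIdeal M⁻¹ = fixIdeal M := by
  have le : ∀ M : SL(2, Ring p), fixIdeal M⁻¹ ≤ fixIdeal M := by
    intro M
    rw [fixIdeal, Ideal.span_le]
    simp only [inv_apply₀₀, inv_apply₀₁, inv_apply₁₀, inv_apply₁₁]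
    rintro x (rfl | rfl | rfl)
    · exact mem_fixIdeal.2 ⟨-1, 0, 0, by ring⟩
    · exact mem_fixIdeal.2 ⟨0, -1, 0, by ring⟩
    · exact mem_fixIdeal.2 ⟨0, 0, -1, by ring⟩
  exact le_antisymm (le M) (by simpa using le M⁻¹)

lemma fixIdeal_neg (M : SL(2, Ring p)) : fixIdeal (-M) = fixIdeal M := by
  have le : ∀ M : SL(2, Ring p), fixIdeal (-M) ≤ fixIdeal M := by
    intro M
    rw [fixIdeal, Ideal.span_le]
    have hn : ∀ i j, (-M) i j = -(M i j) := fun i j => by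
      simp [Matrix.SpecialLinearGroup.coe_neg]
    simp only [hn]
    rintro x (rfl | rfl | rfl)
    · exact mem_fixIdeal.2 ⟨-1, 0, 0, by ring⟩
    · exact mem_fixIdeal.2 ⟨0, -1, 0, by ring⟩
    · exact mem_fixIdeal.2 ⟨0, 0, -1, by ring⟩
  exact le_antisymm (le M) (by simpa using le (-M))

/-- The negative of a form. -/
def BQF.neg (Q : BQF p) : BQF p where
  A := -Q.A
  B := -Q.B
  C := -Q.C
  indefinite := by simpa using Q.indefinite
  primitive h := by simpa only [Ideal.span_singleton_neg] using Q.primitive h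

lemma BQF.disc_neg (Q : BQF p) : Q.neg.disc = Q.disc := by simp [BQF.neg, BQF.disc]

lemma BQF.sqrt_disc_pos (Q : BQF p) : 0 < √Q.disc := Real.sqrt_pos.2 Q.indefinite

lemma BQF.sq_sqrt_disc (Q : BQF p) : √Q.disc ^ 2 = (Q.B : ℝ) ^ 2 - 4 * Q.A * Q.C :=
  Real.sq_sqrt Q.indefinite.le

lemma BQF.root_eq_iff {Q : BQF p} (hA : (Q.A : ℝ) ≠ 0) {x : ℝ} :
    Q.root = x ↔ 2 * Q.A * x + Q.B = √Q.disc := by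
  rw [BQF.root, div_eq_iff (by simpa using hA)]
  constructor <;> intro h <;> linarith

lemma BQF.conjRoot_eq_iff {Q : BQF p} (hA : (Q.A : ℝ) ≠ 0) {x : ℝ} :
    Q.conjRoot = x ↔ 2 * Q.A * x + Q.B = -√Q.disc := by
  rw [BQF.conjRoot, div_eq_iff (by simpa using hA)]
  constructor <;> intro h <;> linarith

lemma BQF.eq_zero_of_sq {Q : BQF p} (hA : (Q.A : ℝ) ≠ 0) {x : ℝ}
    (h : (2 * Q.A * x + Q.B) ^ 2 = √Q.disc ^ 2) : (Q.A : ℝ) * x ^ 2 + Q.B * x + Q.C = 0 := by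
  rw [Q.sq_sqrt_disc] at h
  have : 4 * (Q.A : ℝ) * (Q.A * x ^ 2 + Q.B * x + Q.C) = 0 := by linear_combination h
  rcases mul_eq_zero.1 this with h | h
  · exact absurd h (by simpa using hA)
  · exact h

lemma BQF.root_isRoot {Q : BQF p} (hA : (Q.A : ℝ) ≠ 0) :
    (Q.A : ℝ) * Q.root ^ 2 + Q.B * Q.root + Q.C = 0 :=
  BQF.eq_zero_of_sq hA (by rw [(BQF.root_eq_iff hA).1 rfl])

lemma BQF.conjRoot_isRoot {Q : BQF p} (hA : (Q.A : ℝ) ≠ 0) :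
    (Q.A : ℝ) * Q.conjRoot ^ 2 + Q.B * Q.conjRoot + Q.C = 0 :=
  BQF.eq_zero_of_sq hA (by rw [(BQF.conjRoot_eq_iff hA).1 rfl, neg_sq])

lemma BQF.root_ne_conjRoot {Q : BQF p} (hA : (Q.A : ℝ) ≠ 0) : Q.root ≠ Q.conjRoot := by
  intro h
  have h1 := (BQF.root_eq_iff hA).1 h
  have h2 := (BQF.conjRoot_eq_iff hA).1 rfl
  have := Q.sqrt_disc_pos
  linarith

/-- Proportionality, with factor `±g`, of a form to the form `[c, d - a, -b]` of a matrix. -/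
def IsMultiple (g : Ring p) (Q : BQF p) (M : SL(2, Ring p)) : Prop :=
  (g * Q.A = M 1 0 ∧ g * Q.B = M 1 1 - M 0 0 ∧ g * Q.C = -M 0 1) ∨
  (g * Q.A = -M 1 0 ∧ g * Q.B = -(M 1 1 - M 0 0) ∧ g * Q.C = M 0 1)

lemma isFormOf_iff {x : ℝ} {Q : BQF p} : IsFormOf p x Q ↔
    IsHyperbolicPoint p x ∧ Q.root = x ∧ ∃ M, IsStabilizerGenerator p x M ∧
      IsMultiple (idealGen p (fixIdeal M)) Q M := by
  simp [IsFormOf, fixIdeal, IsMultiple]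

lemma IsMultiple.A_ne_zero {g : Ring p} {Q : BQF p} {M : SL(2, Ring p)} (h : IsMultiple g Q M)
    (hM : (M 1 0 : ℝ) ≠ 0) : (Q.A : ℝ) ≠ 0 := by
  intro h0
  have h0' : Q.A = 0 := by exact_mod_cast h0
  rcases h with ⟨h1, -, -⟩ | ⟨h1, -, -⟩ <;> rw [h0', mul_zero] at h1 <;> apply hM
  · rw [← h1]; simp
  · rw [zero_eq_neg] at h1; rw [h1]; simp

lemma IsMultiple.g_ne_zero {g : Ring p} {Q : BQF p} {M : SL(2, Ring p)} (h : IsMultiple g Q M)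
    (hM : (M 1 0 : ℝ) ≠ 0) : g ≠ 0 := by
  rintro rfl
  rcases h with ⟨h1, -, -⟩ | ⟨h1, -, -⟩ <;> rw [zero_mul] at h1 <;> apply hM
  · rw [← h1]; simp
  · rw [zero_eq_neg] at h1; rw [h1]; simp

lemma IsMultiple.neg {g : Ring p} {Q : BQF p} {M : SL(2, Ring p)} (h : IsMultiple g Q M) :
    IsMultiple g Q.neg M := by
  rcases h with ⟨h1, h2, h3⟩ | ⟨h1, h2, h3⟩
  · right
    refine ⟨?_, ?_, ?_⟩ <;> simp only [BQF.neg, mul_neg, h1, h2, h3, neg_neg]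
  · left
    refine ⟨?_, ?_, ?_⟩ <;> simp only [BQF.neg, mul_neg, h1, h2, h3, neg_neg]

lemma IsMultiple.inv {g : Ring p} {Q : BQF p} {M : SL(2, Ring p)} (h : IsMultiple g Q M) :
    IsMultiple g Q M⁻¹ := by
  simp only [IsMultiple, inv_apply₀₀, inv_apply₀₁, inv_apply₁₀, inv_apply₁₁]
  rcases h with ⟨h1, h2, h3⟩ | ⟨h1, h2, h3⟩
  · right; rw [h1, h2, h3]; refine ⟨by ring, by ring, by ring⟩
  · left; rw [h1, h2, h3]; refine ⟨by ring, by ring, by ring⟩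

lemma IsMultiple.neg_matrix {g : Ring p} {Q : BQF p} {M : SL(2, Ring p)} (h : IsMultiple g Q M) :
    IsMultiple g Q (-M) := by
  have hn : ∀ i j, (-M) i j = -(M i j) := fun i j => by
    simp [Matrix.SpecialLinearGroup.coe_neg]
  simp only [IsMultiple, hn]
  rcases h with ⟨h1, h2, h3⟩ | ⟨h1, h2, h3⟩
  · right; rw [h1, h2, h3]; refine ⟨by ring, by ring, by ring⟩
  · left; rw [h1, h2, h3]; refine ⟨by ring, by ring, by ring⟩

lemma IsMultiple.eq_or_eq_neg {g : Ring p} (hg : g ≠ 0) {Q Q' : BQF p} {M : SL(2, Ring p)}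
    (h : IsMultiple g Q M) (h' : IsMultiple g Q' M) : Q' = Q ∨ Q' = Q.neg := by
  rcases h with ⟨h1, h2, h3⟩ | ⟨h1, h2, h3⟩ <;> rcases h' with ⟨h1', h2', h3'⟩ | ⟨h1', h2', h3'⟩
  · left
    ext1 <;> apply mul_left_cancel₀ hg
    exacts [h1'.trans h1.symm, h2'.trans h2.symm, h3'.trans h3.symm]
  · right
    ext1 <;> apply mul_left_cancel₀ hg <;> simp only [BQF.neg, mul_neg, *, neg_neg]
  · right
    ext1 <;> apply mul_left_cancel₀ hg <;> simp only [BQF.neg, mul_neg, *, neg_neg]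
  · left
    ext1 <;> apply mul_left_cancel₀ hg
    exacts [h1'.trans h1.symm, h2'.trans h2.symm, h3'.trans h3.symm]

lemma IsStabilizerGenerator.apply₁₀_ne_zero (hp : 3 ≤ p) {x : ℝ} (hx : IsHyperbolicPoint p x)
    {M : SL(2, Ring p)} (hM : IsStabilizerGenerator p x M) : (M 1 0 : ℝ) ≠ 0 := by
  intro h0
  have h1 := abs_trace_of_apply₁₀_eq_zero hp hM.1 h0
  have h2 := (two_lt_abs_trace_iff (fixes_iff_maps.1 hM.2.1)).2 (hM.den_ne hx)
  linarith

lemma fixIdeal_ne_bot {M : SL(2, Ring p)} (h : (M 1 0 : ℝ) ≠ 0) : fixIdeal M ≠ ⊥ := by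
  intro h0
  have : M 1 0 ∈ fixIdeal M := Ideal.subset_span (by simp)
  rw [h0, Ideal.mem_bot] at this
  exact h (by simp [this])

lemma neg_root {Q : BQF p} : Q.neg.root = Q.conjRoot := by
  rw [BQF.root, BQF.conjRoot, BQF.disc_neg]
  simp only [BQF.neg, NegMemClass.coe_neg, mul_neg, div_neg, ← neg_div]
  congr 1; ring

lemma root_or_conjRoot {Q : BQF p} (hA : (Q.A : ℝ) ≠ 0) {x : ℝ}
    (hx : (Q.A : ℝ) * x ^ 2 + Q.B * x + Q.C = 0) : Q.root = x ∨ Q.conjRoot = x := by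
  have : (2 * Q.A * x + Q.B) ^ 2 = √Q.disc ^ 2 := by
    rw [Q.sq_sqrt_disc]; linear_combination 4 * (Q.A : ℝ) * hx
  rcases sq_eq_sq_iff_eq_or_eq_neg.1 this with h | h
  · exact Or.inl ((BQF.root_eq_iff hA).2 h)
  · exact Or.inr ((BQF.conjRoot_eq_iff hA).2 h)

/-- Division of `[c, d - a, -b]` by the normalizing factor of the ideal of its coefficients gives a
form; its discriminant is positive since the trace of the generator exceeds `2`. -/
lemma exists_isFormOf (hp : 3 ≤ p) {x : ℝ} (hx : IsHyperbolicPoint p x) :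
    ∃ Q, IsFormOf p x Q := by
  obtain ⟨M, hM⟩ := hx.exists_generator hp
  have hc := hM.apply₁₀_ne_zero hp hx
  have hI := fixIdeal_ne_bot hc
  have hg := idealGen_pos hI
  have htr := (two_lt_abs_trace_iff (fixes_iff_maps.1 hM.2.1)).2 (hM.den_ne hx)
  have hfix := hM.2.1
  set g := idealGen p (fixIdeal M) with hgdef
  have hg0 : g ≠ 0 := by rintro h; simp [h] at hg
  obtain ⟨A, hA⟩ := idealGen_dvd hI (Ideal.subset_span (by simp) : M 1 0 ∈ fixIdeal M)
  obtain ⟨B, hB⟩ := idealGen_dvd hI (Ideal.subset_span (by simp) : M 1 1 - M 0 0 ∈ fixIdeal M)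
  obtain ⟨C, hC⟩ := idealGen_dvd hI (Ideal.subset_span (by simp) : -M 0 1 ∈ fixIdeal M)
  rw [← hgdef] at hA hB hC
  have hA' := congrArg (fun y : Ring p => (y : ℝ)) hA
  have hB' := congrArg (fun y : Ring p => (y : ℝ)) hB
  have hC' := congrArg (fun y : Ring p => (y : ℝ)) hC
  push_cast at hA' hB' hC'
  have hdet := coe_det M
  have hD : 0 < (B : ℝ) ^ 2 - 4 * A * C := by
    have h1 : (g : ℝ) ^ 2 * ((B : ℝ) ^ 2 - 4 * A * C) = ((M 0 0 : ℝ) + M 1 1) ^ 2 - 4 := by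
      have : (g : ℝ) ^ 2 * ((B : ℝ) ^ 2 - 4 * A * C) = (g * B) ^ 2 - 4 * (g * A) * (g * C) := by
        ring
      rw [this, ← hA', ← hB', ← hC']
      linear_combination -4 * hdet
    have h2 : 0 < ((M 0 0 : ℝ) + M 1 1) ^ 2 - 4 := by
      rw [← sq_abs]; nlinarith
    rw [← h1] at h2
    exact pos_of_mul_pos_right h2 (sq_nonneg _)
  have hprim : IsPrincipalIdealRing (Ring p) →
      Ideal.span {A} ⊔ Ideal.span {B} ⊔ Ideal.span {C} = ⊤ := by
    intro hpid
    have h1 : g ∈ fixIdeal M := by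
      rw [← span_idealGen hpid hI, ← hgdef]; exact Ideal.mem_span_singleton_self g
    obtain ⟨u, v, w, h⟩ := mem_fixIdeal.1 h1
    rw [hA, hB, hC] at h
    have h' : u * A + v * B + w * C = 1 := by
      apply mul_left_cancel₀ hg0
      linear_combination h
    rw [Ideal.eq_top_iff_one, ← h']
    refine add_mem (Ideal.mem_sup_left (add_mem (Ideal.mem_sup_left ?_) (Ideal.mem_sup_right ?_)))
      (Ideal.mem_sup_right ?_) <;>
    exact Ideal.mul_mem_left _ _ (Ideal.mem_span_singleton_self _)
  set Q : BQF p := ⟨A, B, C, hD, hprim⟩ with hQ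
  have hmul : IsMultiple g Q M := Or.inl ⟨hA.symm, hB.symm, hC.symm⟩
  have hQA := hmul.A_ne_zero hc
  have hroot : (Q.A : ℝ) * x ^ 2 + Q.B * x + Q.C = 0 := by
    have : (g : ℝ) * ((Q.A : ℝ) * x ^ 2 + Q.B * x + Q.C) = 0 := by
      unfold Fixes at hfix
      have e : (g : ℝ) * ((Q.A : ℝ) * x ^ 2 + Q.B * x + Q.C) =
        (g * A) * x ^ 2 + (g * B) * x + g * C := by simp only [hQ]; ring
      rw [e, ← hA', ← hB', ← hC']
      linear_combination -hfix
    exact (mul_eq_zero.1 this).resolve_left hg.ne'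
  rcases root_or_conjRoot hQA hroot with h | h
  · exact ⟨Q, isFormOf_iff.2 ⟨hx, h, M, hM, hmul⟩⟩
  · exact ⟨Q.neg, isFormOf_iff.2 ⟨hx, by rw [neg_root, h], M, hM, hmul.neg⟩⟩

lemma IsStabilizerGenerator.unique {x : ℝ} (hx : IsHyperbolicPoint p x) {M N : SL(2, Ring p)}
    (hM : IsStabilizerGenerator p x M) (hN : IsStabilizerGenerator p x N) :
    SignEq N M ∨ SignEq N M⁻¹ := by
  obtain ⟨n, hn⟩ := hM.2.2 N hN.1 hN.2.1
  obtain ⟨m, hm⟩ := hN.2.2 M hM.1 hM.2.1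
  have e1 := SignEq.abs_den hn x
  have e2 := SignEq.abs_den hm x
  rw [den_zpow (fixes_iff_maps.1 hM.2.1), abs_zpow] at e1
  rw [den_zpow (fixes_iff_maps.1 hN.2.1), abs_zpow] at e2
  have h1 := hM.den_ne hx
  have h0 : 0 < |(M 1 0 : ℝ) * x + M 1 1| := abs_pos.2 (fixes_iff_maps.1 hM.2.1).1
  rw [e1, ← zpow_mul] at e2
  have : n * m = 1 := by
    have := zpow_right_injective₀ h0 h1 (a₁ := 1) (a₂ := n * m) (by simpa using e2)
    exact this.symm
  rcases Int.mul_eq_one_iff_eq_one_or_neg_one.1 this with ⟨rfl, -⟩ | ⟨rfl, -⟩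
  · left; rwa [zpow_one] at hn
  · right; rwa [zpow_neg_one] at hn

/-- The form of a hyperbolic point does not depend on the generator of the stabilizer. -/
lemma IsFormOf.unique (hp : 3 ≤ p) {x : ℝ} {Q Q' : BQF p} (h : IsFormOf p x Q)
    (h' : IsFormOf p x Q') : Q' = Q := by
  obtain ⟨hx, hr, M, hM, hm⟩ := isFormOf_iff.1 h
  obtain ⟨-, hr', N, hN, hn⟩ := isFormOf_iff.1 h'
  have hc := hM.apply₁₀_ne_zero hp hx
  have key : IsMultiple (idealGen p (fixIdeal M)) Q' M := by
    rcases hM.unique hx hN with (rfl | rfl) | (rfl | rfl)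
    · exact hn
    · rw [fixIdeal_neg] at hn; simpa using hn.neg_matrix
    · rw [fixIdeal_inv] at hn; simpa using hn.inv
    · rw [fixIdeal_neg, fixIdeal_inv] at hn; simpa using hn.neg_matrix.inv
  rcases hm.eq_or_eq_neg (hm.g_ne_zero hc) key with h1 | h1
  · exact h1
  · rw [h1, neg_root] at hr'
    exact absurd (hr.trans hr'.symm) (BQF.root_ne_conjRoot (hm.A_ne_zero hc))

lemma formOf_spec (hp : 3 ≤ p) {x : ℝ} (hx : IsHyperbolicPoint p x) :
    IsFormOf p x (formOf p x) := Classical.epsilon_spec (exists_isFormOf hp hx)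

lemma IsFormOf.eq_formOf (hp : 3 ≤ p) {x : ℝ} {Q : BQF p} (h : IsFormOf p x Q) :
    formOf p x = Q := h.unique hp (formOf_spec hp h.1)

lemma IsFormOf.A_ne_zero (hp : 3 ≤ p) {x : ℝ} {Q : BQF p} (h : IsFormOf p x Q) :
    (Q.A : ℝ) ≠ 0 := by
  obtain ⟨hx, hr, M, hM, hm⟩ := isFormOf_iff.1 h
  exact hm.A_ne_zero (hM.apply₁₀_ne_zero hp hx)

lemma eval_comp_coeffs {Q Q' : BQF p} {V : SL(2, Ring p)}
    (h : ∀ v : Fin 2 → Ring p, Q'.eval v = Q.eval (Matrix.mulVec (V : Matrix _ _ (Ring p)) v)) :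
    Q'.A = Q.A * V 0 0 ^ 2 + Q.B * (V 0 0 * V 1 0) + Q.C * V 1 0 ^ 2 ∧
    Q'.B = 2 * Q.A * V 0 0 * V 0 1 + Q.B * (V 0 0 * V 1 1 + V 0 1 * V 1 0)
      + 2 * Q.C * V 1 0 * V 1 1 ∧
    Q'.C = Q.A * V 0 1 ^ 2 + Q.B * (V 0 1 * V 1 1) + Q.C * V 1 1 ^ 2 := by
  have h1 := h ![1, 0]
  have h2 := h ![0, 1]
  have h3 := h ![1, 1]
  simp [BQF.eval, Matrix.mulVec, dotProduct, Fin.sum_univ_two] at h1 h2 h3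
  refine ⟨?_, ?_, ?_⟩
  · linear_combination h1
  · linear_combination h3 - h1 - h2
  · linear_combination h2

lemma eval_comp_of_coeffs {Q Q' : BQF p} {V : SL(2, Ring p)}
    (h1 : Q'.A = Q.A * V 0 0 ^ 2 + Q.B * (V 0 0 * V 1 0) + Q.C * V 1 0 ^ 2)
    (h2 : Q'.B = 2 * Q.A * V 0 0 * V 0 1 + Q.B * (V 0 0 * V 1 1 + V 0 1 * V 1 0)
      + 2 * Q.C * V 1 0 * V 1 1)
    (h3 : Q'.C = Q.A * V 0 1 ^ 2 + Q.B * (V 0 1 * V 1 1) + Q.C * V 1 1 ^ 2)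
    (v : Fin 2 → Ring p) :
    Q'.eval v = Q.eval (Matrix.mulVec (V : Matrix _ _ (Ring p)) v) := by
  simp [BQF.eval, Matrix.mulVec, dotProduct, Fin.sum_univ_two, h1, h2, h3]
  ring

/-- The form `Q ∘ V`. -/
lemma exists_comp (Q : BQF p) (V : SL(2, Ring p)) : ∃ Q' : BQF p,
    ∀ v : Fin 2 → Ring p, Q'.eval v = Q.eval (Matrix.mulVec (V : Matrix _ _ (Ring p)) v) := by
  have hd := ring_det V
  have hd' := coe_det V
  obtain ⟨A, hA⟩ : ∃ A, A = Q.A * V 0 0 ^ 2 + Q.B * (V 0 0 * V 1 0) + Q.C * V 1 0 ^ 2 := ⟨_, rfl⟩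
  obtain ⟨B, hB⟩ : ∃ B, B = 2 * Q.A * V 0 0 * V 0 1 + Q.B * (V 0 0 * V 1 1 + V 0 1 * V 1 0)
      + 2 * Q.C * V 1 0 * V 1 1 := ⟨_, rfl⟩
  obtain ⟨C, hC⟩ : ∃ C, C = Q.A * V 0 1 ^ 2 + Q.B * (V 0 1 * V 1 1) + Q.C * V 1 1 ^ 2 := ⟨_, rfl⟩
  have hdisc : (B : ℝ) ^ 2 - 4 * A * C = (Q.B : ℝ) ^ 2 - 4 * Q.A * Q.C := by
    have : B ^ 2 - 4 * A * C = Q.B ^ 2 - 4 * Q.A * Q.C := by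
      rw [hA, hB, hC]
      linear_combination (Q.B ^ 2 - 4 * Q.A * Q.C) *
        (V 0 0 * V 1 1 - V 0 1 * V 1 0 + 1) * hd
    have := congrArg (fun y : Ring p => (y : ℝ)) this
    push_cast at this
    exact this
  have hprim : IsPrincipalIdealRing (Ring p) →
      Ideal.span {A} ⊔ Ideal.span {B} ⊔ Ideal.span {C} = ⊤ := by
    intro h
    have hQ := Q.primitive h
    rw [eq_top_iff, ← hQ]
    have mem : ∀ u v w, u * A + v * B + w * C ∈
        Ideal.span {A} ⊔ Ideal.span {B} ⊔ Ideal.span {C} := by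
      intro u v w
      refine add_mem (Ideal.mem_sup_left (add_mem (Ideal.mem_sup_left ?_) (Ideal.mem_sup_right ?_)))
        (Ideal.mem_sup_right ?_) <;>
      exact Ideal.mul_mem_left _ _ (Ideal.mem_span_singleton_self _)
    refine sup_le (sup_le ?_ ?_) ?_ <;> rw [Ideal.span_singleton_le_iff_mem]
    · convert mem (V 1 1 ^ 2) (-V 1 1 * V 1 0) (V 1 0 ^ 2) using 1
      rw [hA, hB, hC]
      linear_combination -Q.A * (V 0 0 * V 1 1 - V 0 1 * V 1 0 + 1) * hd
    · convert mem (-2 * V 1 1 * V 0 1) (V 0 0 * V 1 1 + V 0 1 * V 1 0) (-2 * V 0 0 * V 1 0) using 1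
      rw [hA, hB, hC]
      linear_combination -Q.B * (V 0 0 * V 1 1 - V 0 1 * V 1 0 + 1) * hd
    · convert mem (V 0 1 ^ 2) (-V 0 0 * V 0 1) (V 0 0 ^ 2) using 1
      rw [hA, hB, hC]
      linear_combination -Q.C * (V 0 0 * V 1 1 - V 0 1 * V 1 0 + 1) * hd
  exact ⟨⟨A, B, C, by rw [hdisc]; exact Q.indefinite, hprim⟩,
    eval_comp_of_coeffs hA hB hC⟩

/-- The roots of `Q ∘ V` are the preimages by `V` of those of `Q`, in the same order. -/
lemma maps_root_of_comp {Q Q' : BQF p} {V : SL(2, Ring p)}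
    (h : ∀ v : Fin 2 → Ring p, Q'.eval v = Q.eval (Matrix.mulVec (V : Matrix _ _ (Ring p)) v))
    (hA : (Q.A : ℝ) ≠ 0) (hA' : (Q'.A : ℝ) ≠ 0) :
    Maps V Q'.root Q.root ∧ Maps V Q'.conjRoot Q.conjRoot := by
  obtain ⟨h1, h2, h3⟩ := eval_comp_coeffs h
  have hd := coe_det V
  replace h1 := congrArg (fun y : Ring p => (y : ℝ)) h1
  replace h2 := congrArg (fun y : Ring p => (y : ℝ)) h2
  replace h3 := congrArg (fun y : Ring p => (y : ℝ)) h3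
  push_cast at h1 h2 h3
  have two : ((2 : Ring p) : ℝ) = 2 := rfl
  rw [two] at h2
  have hdisc : Q'.disc = Q.disc := by
    unfold BQF.disc
    rw [h1, h2, h3]
    linear_combination ((Q.B : ℝ) ^ 2 - 4 * Q.A * Q.C) *
        ((V 0 0 : ℝ) * V 1 1 - V 0 1 * V 1 0 + 1) * hd
  have key : ∀ y s : ℝ, (Q'.A : ℝ) * y ^ 2 + Q'.B * y + Q'.C = 0 → 2 * Q'.A * y + Q'.B = s →
      (V 1 0 : ℝ) * y + V 1 1 ≠ 0 ∧
      2 * Q.A * (((V 0 0 : ℝ) * y + V 0 1) / ((V 1 0 : ℝ) * y + V 1 1)) + Q.B = s := by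
    intro y s hy hs
    obtain ⟨u, hu⟩ : ∃ u, u = (V 0 0 : ℝ) * y + V 0 1 := ⟨_, rfl⟩
    obtain ⟨w, hw⟩ : ∃ w, w = (V 1 0 : ℝ) * y + V 1 1 := ⟨_, rfl⟩
    have huw : (V 0 0 : ℝ) * w - V 1 0 * u = 1 := by rw [hu, hw]; linear_combination hd
    have hq : (Q.A : ℝ) * u ^ 2 + Q.B * u * w + Q.C * w ^ 2 = 0 := by
      rw [hu, hw, ← hy, h1, h2, h3]; ring
    rw [← hu, ← hw]
    have hw0 : w ≠ 0 := by
      intro h0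
      rw [h0] at hq huw
      have : u = 0 := by
        have : (Q.A : ℝ) * u ^ 2 = 0 := by linear_combination hq
        simpa [hA] using this
      rw [this] at huw
      norm_num at huw
    refine ⟨hw0, ?_⟩
    have e : w * s = 2 * Q.A * u + Q.B * w := by
      rw [← hs, h1, h2]
      have hy1 : (V 0 0 : ℝ) * y = u - V 0 1 := by rw [hu]; ring
      have hy2 : (V 1 0 : ℝ) * y = w - V 1 1 := by rw [hw]; ring
      linear_combination (2 * Q.A * V 0 0 * w + Q.B * V 1 0 * w) * hy1
        + (Q.B * V 0 0 * w + 2 * Q.C * V 1 0 * w) * hy2 + (2 * Q.A * u + Q.B * w) * huw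
        + 2 * (V 1 0 : ℝ) * hq
    field_simp
    linear_combination -e
  constructor
  · obtain ⟨k1, k2⟩ := key Q'.root _ (BQF.root_isRoot hA') ((BQF.root_eq_iff hA').1 rfl)
    rw [hdisc] at k2
    refine ⟨k1, ?_⟩
    rw [(BQF.root_eq_iff hA).2 k2, mul_div_cancel₀ _ k1]
  · obtain ⟨k1, k2⟩ := key Q'.conjRoot _ (BQF.conjRoot_isRoot hA') ((BQF.conjRoot_eq_iff hA').1 rfl)
    rw [hdisc] at k2
    refine ⟨k1, ?_⟩
    rw [(BQF.conjRoot_eq_iff hA).2 k2, mul_div_cancel₀ _ k1]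

/-- Forms equivalent to the form of a hyperbolic point are forms of hyperbolic points. -/
lemma IsFormOf.comp (hp : 3 ≤ p) {x : ℝ} {Q Q' : BQF p} {V : SL(2, Ring p)} (hV : V ∈ group p)
    (hQ : IsFormOf p x Q)
    (h : ∀ v : Fin 2 → Ring p, Q'.eval v = Q.eval (Matrix.mulVec (V : Matrix _ _ (Ring p)) v)) :
    IsFormOf p Q'.root Q' ∧ Maps V Q'.root x ∧ Maps V Q'.conjRoot Q.conjRoot := by
  have hA := hQ.A_ne_zero hp
  obtain ⟨hx, hr, M, hM, hm⟩ := isFormOf_iff.1 hQ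
  obtain ⟨c1, c2, c3⟩ := eval_comp_coeffs h
  obtain ⟨e1, e2, e3⟩ := conj_entries M V
  have hm' : IsMultiple (idealGen p (fixIdeal (V⁻¹ * M * V))) Q' (V⁻¹ * M * V) := by
    rw [fixIdeal_conj]
    rcases hm with ⟨h1, h2, h3⟩ | ⟨h1, h2, h3⟩
    · left
      rw [e1, e2, ← neg_neg ((V⁻¹ * M * V) 0 1), e3, neg_neg, c1, c2, c3]
      refine ⟨?_, ?_, ?_⟩
      · linear_combination V 0 0 ^ 2 * h1 + (V 0 0 * V 1 0) * h2 + V 1 0 ^ 2 * h3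
      · linear_combination 2 * V 0 0 * V 0 1 * h1 + (V 0 0 * V 1 1 + V 0 1 * V 1 0) * h2
          + 2 * V 1 0 * V 1 1 * h3
      · linear_combination V 0 1 ^ 2 * h1 + (V 0 1 * V 1 1) * h2 + V 1 1 ^ 2 * h3
    · right
      rw [e1, e2, ← neg_neg ((V⁻¹ * M * V) 0 1), e3, c1, c2, c3]
      refine ⟨?_, ?_, ?_⟩
      · linear_combination V 0 0 ^ 2 * h1 + (V 0 0 * V 1 0) * h2 + V 1 0 ^ 2 * h3
      · linear_combination 2 * V 0 0 * V 0 1 * h1 + (V 0 0 * V 1 1 + V 0 1 * V 1 0) * h2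
          + 2 * V 1 0 * V 1 1 * h3
      · linear_combination V 0 1 ^ 2 * h1 + (V 0 1 * V 1 1) * h2 + V 1 1 ^ 2 * h3
  have hc' : ((V⁻¹ * M * V) 1 0 : ℝ) ≠ 0 := by
    intro h0
    have h1 := abs_trace_of_apply₁₀_eq_zero hp
      (mul_mem (mul_mem (inv_mem hV) hM.1) hV) h0
    have h2 := (two_lt_abs_trace_iff (fixes_iff_maps.1 hM.2.1)).2 (hM.den_ne hx)
    have h3 : ((V⁻¹ * M * V) 0 0 : ℝ) + (V⁻¹ * M * V) 1 1 = (M 0 0 : ℝ) + M 1 1 := by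
      simp only [coe_mul_apply, inv_apply₀₀, inv_apply₀₁, inv_apply₁₀, inv_apply₁₁,
        NegMemClass.coe_neg]
      linear_combination ((M 0 0 : ℝ) + M 1 1) * coe_det V
    rw [h3] at h1
    linarith
  have hA' := hm'.A_ne_zero hc'
  obtain ⟨m1, m2⟩ := maps_root_of_comp h hA hA'
  rw [hr] at m1
  exact ⟨isFormOf_iff.2 ⟨hx.of_maps hV m1, rfl, _, hM.conj hV m1, hm'⟩, m1, m2⟩

/-- The forms of equivalent hyperbolic points are equivalent, and their conjugates correspond to
each other. -/
lemma formOf_of_maps (hp : 3 ≤ p) {x y : ℝ} (hx : IsHyperbolicPoint p x) {V : SL(2, Ring p)}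
    (hV : V ∈ group p) (h : Maps V y x) :
    (⟦formOf p y⟧ : FormClass p) = ⟦formOf p x⟧ ∧ Maps V (conj p y) (conj p x) := by
  obtain ⟨Q', hQ'⟩ := exists_comp (formOf p x) V
  obtain ⟨h1, h2, h3⟩ := (formOf_spec hp hx).comp hp hV hQ'
  rw [h2.injective h] at h1
  have e := h1.eq_formOf hp
  refine ⟨?_, by rw [conj, e]; exact h3⟩
  rw [e]
  exact (Quotient.sound ⟨V, hV, hQ'⟩ : (⟦formOf p x⟧ : FormClass p) = ⟦Q'⟧).symm

lemma exists_maps_of_formClass_eq (hp : 3 ≤ p) {x y : ℝ} (hx : IsHyperbolicPoint p x)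
    (hy : IsHyperbolicPoint p y) (h : (⟦formOf p x⟧ : FormClass p) = ⟦formOf p y⟧) :
    ∃ V ∈ group p, Maps V y x := by
  obtain ⟨V, hV, hv⟩ := Quotient.exact h
  obtain ⟨-, h2, -⟩ := (formOf_spec hp hx).comp hp hV hv
  rw [(formOf_spec hp hy).2.1] at h2
  exact ⟨V, hV, h2⟩

lemma isHyperbolicClass_formOf (hp : 3 ≤ p) {x : ℝ} (hx : IsHyperbolicPoint p x) :
    IsHyperbolicClass (⟦formOf p x⟧ : FormClass p) := by
  intro Q hQ
  obtain ⟨V, hV, hv⟩ := Quotient.exact hQ.symm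
  exact ⟨_, ((formOf_spec hp hx).comp hp hV hv).1⟩

lemma conj_ne (hp : 3 ≤ p) {x : ℝ} (hx : IsHyperbolicPoint p x) : x ≠ conj p x := by
  have h := formOf_spec hp hx
  have := BQF.root_ne_conjRoot (h.A_ne_zero hp)
  rwa [h.2.1] at this

/-- The elements of the stabilizer of a hyperbolic point fix its conjugate. -/
lemma maps_conj (hp : 3 ≤ p) {x : ℝ} (hx : IsHyperbolicPoint p x) {N : SL(2, Ring p)}
    (hN : N ∈ group p) (h : Maps N x x) : Maps N (conj p x) (conj p x) :=
  (formOf_of_maps hp hx hN h).2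

end Forms

/-! ### Simple forms and periodic expansions -/

section Simple

variable {p : ℕ}

/-- Positive diagonal entries, and non-negative off-diagonal entries that do not both vanish. -/
def PosMatrix (M : SL(2, Ring p)) : Prop :=
  0 < (M 0 0 : ℝ) ∧ 0 < (M 1 1 : ℝ) ∧ 0 ≤ (M 0 1 : ℝ) ∧ 0 ≤ (M 1 0 : ℝ) ∧
    0 < (M 0 1 : ℝ) + (M 1 0 : ℝ)

lemma PosMatrix.mul {M N : SL(2, Ring p)} (hM : PosMatrix M) (hN : PosMatrix N) :
    PosMatrix (M * N) := by
  obtain ⟨a1, a2, a3, a4, a5⟩ := hM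
  obtain ⟨b1, b2, b3, b4, b5⟩ := hN
  simp only [PosMatrix, coe_mul_apply]
  refine ⟨by positivity, by positivity, by positivity, by positivity, ?_⟩
  have h1 : 0 ≤ (M 0 1 : ℝ) * N 1 1 := by positivity
  have h2 : 0 ≤ (M 1 0 : ℝ) * N 0 0 := by positivity
  rcases b3.eq_or_lt with h | h
  · have : 0 < (M 1 1 : ℝ) * N 1 0 := mul_pos a2 (by linarith)
    have : 0 ≤ (M 0 0 : ℝ) * N 0 1 := by positivity
    linarith
  · have : 0 < (M 0 0 : ℝ) * N 0 1 := mul_pos a1 h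
    have : 0 ≤ (M 1 1 : ℝ) * N 1 0 := by positivity
    linarith

lemma posMatrix_letter (hp : 3 ≤ p) {j : ℕ} (hj : j + 1 < p) : PosMatrix (letter p j) := by
  obtain ⟨e1, e2, e3, e4⟩ := letter_entries hp j
  rw [PosMatrix, e1, e2, e3, e4]
  have h1 := sinQuot_pos hp (n := j + 1) (by omega) hj
  have h2 := sinQuot_nonneg hp (n := j + 2) (by omega)
  have h3 := sinQuot_nonneg hp (n := j) (by omega)
  refine ⟨h1, h1, h2, h3, ?_⟩
  rcases Nat.eq_zero_or_pos j with rfl | h0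
  · have := sinQuot_pos hp (n := 0 + 2) (by omega) (by omega)
    linarith
  · have := sinQuot_pos hp h0 (by omega)
    linarith

lemma posMatrix_prefixWord (hp : 3 ≤ p) {x : ℝ} (hx : 0 ≤ x) {n : ℕ} (hn : 0 < n) :
    PosMatrix (prefixWord p x n) := by
  induction n, hn using Nat.le_induction with
  | base => simpa [prefixWord] using posMatrix_letter hp (digit_spec hp hx).1
  | succ n hn ih =>
    exact ih.mul (posMatrix_letter hp (digit_spec hp (iterate_next_nonneg hp hx n)).1)

/-- Products of letters are hyperbolic if they fix a positive point. (Parabolic products exist: they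
are powers of the letters that fix `0` and `∞`.) -/
lemma PosMatrix.two_lt_trace {M : SL(2, Ring p)} (h : PosMatrix M) {x : ℝ} (hx : 0 < x)
    (hM : Maps M x x) : 2 < |(M 0 0 : ℝ) + M 1 1| := by
  obtain ⟨a1, a2, a3, a4, a5⟩ := h
  have hd := coe_det M
  obtain ⟨-, hf⟩ := hM
  have h0 := mul_nonneg a3 a4
  rw [abs_of_pos (by linarith)]
  by_contra! hle
  have e : ((M 0 0 : ℝ) + M 1 1) ^ 2 = ((M 0 0 : ℝ) - M 1 1) ^ 2 + 4 * (M 0 1 * M 1 0) + 4 := by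
    linear_combination 4 * hd
  have h4 : ((M 0 0 : ℝ) + M 1 1) ^ 2 ≤ 4 := by nlinarith
  have h1 := sq_nonneg ((M 0 0 : ℝ) - M 1 1)
  have hbc : (M 0 1 : ℝ) * M 1 0 = 0 := by linarith
  have had : (M 0 0 : ℝ) - M 1 1 = 0 := by
    have : ((M 0 0 : ℝ) - M 1 1) ^ 2 = 0 := by linarith
    simpa using this
  have hb : (M 0 1 : ℝ) = M 1 0 * x ^ 2 := by linear_combination hf - x * had
  rcases mul_eq_zero.1 hbc with h | h
  · rw [h] at hb a5
    have : 0 < (M 1 0 : ℝ) * x ^ 2 := mul_pos (by linarith) (by positivity)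
    linarith
  · rw [h] at hb a5
    linarith

lemma isSimple_formOf_iff (hp : 3 ≤ p) {x : ℝ} (hx : IsHyperbolicPoint p x) :
    (formOf p x).IsSimple ↔ 0 < x ∧ conj p x < 0 := by
  have h := formOf_spec hp hx
  have hA := h.A_ne_zero hp
  have h1 := (BQF.root_eq_iff hA).1 h.2.1
  have h2 := (BQF.conjRoot_eq_iff hA).1 (rfl : _ = conj p x)
  have h3 := BQF.conjRoot_isRoot hA
  rw [show (formOf p x).conjRoot = conj p x from rfl] at h3
  have hs := (formOf p x).sqrt_disc_pos
  have hne := conj_ne hp hx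
  generalize formOf p x = Q at *
  have d : (Q.A : ℝ) * (x - conj p x) = √Q.disc := by linarith
  have e : (Q.C : ℝ) = Q.A * (x * conj p x) := by
    have : (Q.B : ℝ) = -Q.A * (x + conj p x) := by linarith
    rw [this] at h3; linear_combination h3
  have hd : 0 < (Q.A : ℝ) * (x - conj p x) := d ▸ hs
  rw [BQF.IsSimple, e]
  constructor
  · rintro ⟨k1, k2⟩
    have k3 := (pos_iff_pos_of_mul_pos hd).1 k1
    have k4 : x * conj p x < 0 := by
      by_contra! hc
      have := mul_nonneg k1.le hc
      linarith
    rcases mul_neg_iff.1 k4 with h | h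
    · exact h
    · linarith [h.1, h.2]
  · rintro ⟨k1, k2⟩
    have k3 : 0 < (Q.A : ℝ) := (pos_iff_pos_of_mul_pos hd).2 (by linarith)
    exact ⟨k3, mul_neg_of_pos_of_neg k3 (mul_neg_of_pos_of_neg k1 k2)⟩

/-- Points with purely periodic expansions are hyperbolic, and their forms are simple. -/
lemma isHyperbolicPoint_of_periodic (hp : 3 ≤ p) {x : ℝ} (hx : 0 < x) {r : ℕ} (hr : 0 < r)
    (h : (next p)^[r] x = x) : IsHyperbolicPoint p x ∧ (formOf p x).IsSimple := by
  have hV := posMatrix_prefixWord hp hx.le hr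
  have hmem := prefixWord_mem (p := p) x r
  have hmap := maps_prefixWord hp hx.le r
  rw [h] at hmap
  generalize prefixWord p x r = V at *
  have htr := hV.two_lt_trace hx hmap
  have hyp : IsHyperbolicPoint p x := ⟨V, hmem, htr, fixes_iff_maps.2 hmap⟩
  refine ⟨hyp, (isSimple_formOf_iff hp hyp).2 ⟨hx, ?_⟩⟩
  have hc : (V 1 0 : ℝ) ≠ 0 := fun h0 => by
    have := abs_trace_of_apply₁₀_eq_zero hp hmem h0; linarith
  have hb : (V 0 1 : ℝ) ≠ 0 := fun h0 => by
    have := abs_trace_of_apply₀₁_eq_zero hp hmem h0; linarith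
  obtain ⟨a1, a2, a3, a4, -⟩ := hV
  have hc' := lt_of_le_of_ne a4 hc.symm
  have hb' := lt_of_le_of_ne a3 hb.symm
  have f1 := hmap.2
  have f2 := (maps_conj hp hyp hmem hmap).2
  have hne := sub_ne_zero.2 (conj_ne hp hyp)
  have e : (V 1 0 : ℝ) * (x * conj p x) = -V 0 1 := by
    apply mul_left_cancel₀ hne
    linear_combination -(conj p x) * f1 + x * f2
  by_contra! hcc
  have := mul_nonneg hc'.le (mul_nonneg hx.le hcc)
  linarith

lemma IsHyperbolicPoint.next (hp : 3 ≤ p) {x : ℝ} (h : IsHyperbolicPoint p x) (hx : 0 ≤ x) :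
    IsHyperbolicPoint p (next p x) := h.of_maps (letter_mem _) (maps_next hp hx)

/-- The inverse of a letter is conjugate to the letter by `x ↦ -x`. -/
lemma maps_letter_neg (hp : 3 ≤ p) {j : ℕ} {x y : ℝ} (h : Maps (letter p j) x y) :
    Maps (letter p j) (-y) (-x) := by
  obtain ⟨h1, h2⟩ := h.inv
  obtain ⟨e1, e2, e3, e4⟩ := letter_entries hp j
  simp only [inv_apply₀₀, inv_apply₀₁, inv_apply₁₀, inv_apply₁₁, NegMemClass.coe_neg, e1, e2, e3,
    e4] at h1 h2
  rw [Maps, e1, e2, e3, e4]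
  exact ⟨by contrapose! h1; linarith, by linarith⟩

lemma maps_neg_conj_next (hp : 3 ≤ p) {x : ℝ} (h : IsHyperbolicPoint p x) (hx : 0 ≤ x) :
    Maps (letter p (digit p x)) (-conj p x) (-conj p (next p x)) :=
  maps_letter_neg hp (formOf_of_maps hp h (letter_mem _) (maps_next hp hx)).2

/-- The shift of expansions is invertible on the hyperbolic points `x > 0 > x'`: the expansion of
`-x'` records the letters that precede that of `x`. -/
lemma next_injOn_simple (hp : 3 ≤ p) {x y : ℝ} (hx : IsHyperbolicPoint p x) (hx0 : 0 ≤ x)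
    (hx' : conj p x < 0) (hy : IsHyperbolicPoint p y) (hy0 : 0 ≤ y) (hy' : conj p y < 0)
    (h : next p x = next p y) : x = y := by
  have h1 := maps_neg_conj_next hp hx hx0
  have h2 := maps_neg_conj_next hp hy hy0
  rw [h] at h1
  have e := letter_index_unique hp (digit_spec hp hx0).1 (digit_spec hp hy0).1 (by linarith)
    (by linarith) h1 h2
  have k1 := maps_next hp hx0
  have k2 := maps_next hp hy0
  rw [e, h] at k1
  exact k1.unique k2

lemma conj_next_neg (hp : 3 ≤ p) {x : ℝ} (hx : IsHyperbolicPoint p x) (hx0 : 0 ≤ x)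
    (hx' : conj p x < 0) : conj p (next p x) < 0 := by
  have h1 := maps_neg_conj_next hp hx hx0
  have hd := (digit_spec hp hx0).1
  have := letterMap_pos hp hd (x := -conj p x) (by linarith)
  rw [(maps_letterMap hp hd (by linarith)).unique h1] at this
  linarith

/-- A hyperbolic point with a simple form has a purely periodic expansion. -/
lemma exists_periodic_of_isSimple (hp : 3 ≤ p) {x : ℝ} (hx : IsHyperbolicPoint p x)
    (h : (formOf p x).IsSimple) : ∃ r, 0 < r ∧ (next p)^[r] x = x := by
  obtain ⟨hx0, hx'⟩ := (isSimple_formOf_iff hp hx).1 h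
  obtain ⟨i, r, hr, hir⟩ := hx.eventually_periodic hp hx0.le
  refine ⟨r, hr, ?_⟩
  have inv : ∀ n, IsHyperbolicPoint p ((next p)^[n] x) ∧ 0 ≤ (next p)^[n] x ∧
      conj p ((next p)^[n] x) < 0 := by
    intro n
    induction n with
    | zero => exact ⟨hx, hx0.le, hx'⟩
    | succ n ih =>
      obtain ⟨h1, h2, h3⟩ := ih
      rw [Function.iterate_succ_apply']
      exact ⟨h1.next hp h2, next_nonneg hp h2, conj_next_neg hp h1 h2 h3⟩
  induction i with
  | zero => simpa using hir
  | succ i ih =>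
    apply ih
    rw [add_right_comm, Function.iterate_succ_apply', Function.iterate_succ_apply'] at hir
    obtain ⟨a1, a2, a3⟩ := inv (i + r)
    obtain ⟨b1, b2, b3⟩ := inv i
    exact next_injOn_simple hp a1 a2 a3 b1 b2 b3 hir

end Simple

/-! ### Values and principal parts of rational functions -/

section Values

open Polynomial

variable {K : Type*} [Field K]

/-- The rational function `f` is regular at `a`, with value `v`. -/
def HasVal (f : RatFunc K) (a v : K) : Prop :=
  ∃ n d : K[X], d.eval a ≠ 0 ∧ f = algebraMap K[X] (RatFunc K) n / algebraMap K[X] (RatFunc K) d ∧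
    n.eval a = v * d.eval a

/-- The rational function `f` is regular at `a`. -/
def Regular (f : RatFunc K) (a : K) : Prop := ∃ v, HasVal f a v

lemma algebraMap_ne_zero_of_eval {d : K[X]} {a : K} (h : d.eval a ≠ 0) :
    algebraMap K[X] (RatFunc K) d ≠ 0 :=
  RatFunc.algebraMap_ne_zero (by rintro rfl; simp at h)

namespace HasVal

variable {f g : RatFunc K} {a v w : K}

lemma unique (h : HasVal f a v) (h' : HasVal f a w) : v = w := by
  obtain ⟨n, d, hd, rfl, hv⟩ := h
  obtain ⟨n', d', hd', e, hw⟩ := h'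
  rw [div_eq_div_iff (algebraMap_ne_zero_of_eval hd) (algebraMap_ne_zero_of_eval hd'), ← map_mul,
    ← map_mul] at e
  have e' := congrArg (Polynomial.eval a) (RatFunc.algebraMap_injective K e)
  rw [eval_mul, eval_mul, hv, hw] at e'
  apply mul_right_cancel₀ (mul_ne_zero hd hd')
  linear_combination e'

lemma poly (P : K[X]) (a : K) : HasVal (algebraMap K[X] (RatFunc K) P) a (P.eval a) :=
  ⟨P, 1, by simp, by simp, by simp⟩

lemma const (c a : K) : HasVal (RatFunc.C c) a c := by
  simpa using poly (Polynomial.C c) a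

lemma X (a : K) : HasVal (RatFunc.X : RatFunc K) a a := by
  simpa using poly (Polynomial.X) a

lemma one (a : K) : HasVal (1 : RatFunc K) a 1 := by simpa using const (1 : K) a
lemma zero (a : K) : HasVal (0 : RatFunc K) a 0 := by simpa using const (0 : K) a

lemma add (h : HasVal f a v) (h' : HasVal g a w) : HasVal (f + g) a (v + w) := by
  obtain ⟨n, d, hd, rfl, hv⟩ := h
  obtain ⟨n', d', hd', rfl, hw⟩ := h'
  refine ⟨n * d' + d * n', d * d', by simpa using ⟨hd, hd'⟩, ?_, ?_⟩
  · rw [div_add_div _ _ (algebraMap_ne_zero_of_eval hd) (algebraMap_ne_zero_of_eval hd')]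
    simp
  · simp only [eval_add, eval_mul, hv, hw]; ring

lemma mul (h : HasVal f a v) (h' : HasVal g a w) : HasVal (f * g) a (v * w) := by
  obtain ⟨n, d, hd, rfl, hv⟩ := h
  obtain ⟨n', d', hd', rfl, hw⟩ := h'
  refine ⟨n * n', d * d', by simpa using ⟨hd, hd'⟩, ?_, ?_⟩
  · rw [div_mul_div_comm]; simp
  · simp only [eval_mul, hv, hw]; ring

lemma neg (h : HasVal f a v) : HasVal (-f) a (-v) := by
  simpa using (const (-1) a).mul h

lemma sub (h : HasVal f a v) (h' : HasVal g a w) : HasVal (f - g) a (v - w) := by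
  rw [sub_eq_add_neg, sub_eq_add_neg]; exact h.add h'.neg

lemma pow (h : HasVal f a v) (n : ℕ) : HasVal (f ^ n) a (v ^ n) := by
  induction n with
  | zero => simpa using one a
  | succ n ih => rw [pow_succ, pow_succ]; exact ih.mul h

lemma inv (h : HasVal f a v) (hv : v ≠ 0) : HasVal f⁻¹ a v⁻¹ := by
  obtain ⟨n, d, hd, rfl, hn⟩ := h
  exact ⟨d, n, by rw [hn]; exact mul_ne_zero hv hd, by rw [inv_div], by rw [hn]; field_simp⟩

lemma div (h : HasVal f a v) (h' : HasVal g a w) (hw : w ≠ 0) : HasVal (f / g) a (v / w) := by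
  rw [div_eq_mul_inv, div_eq_mul_inv]; exact h.mul (h'.inv hw)

lemma sum {ι : Type*} (s : Finset ι) {F : ι → RatFunc K} {V : ι → K}
    (h : ∀ i ∈ s, HasVal (F i) a (V i)) : HasVal (∑ i ∈ s, F i) a (∑ i ∈ s, V i) := by
  classical
  induction s using Finset.induction_on with
  | empty => simpa using zero a
  | insert i s hi ih =>
    rw [Finset.sum_insert hi, Finset.sum_insert hi]
    exact (h i (by simp)).add (ih fun j hj => h j (by simp [hj]))

lemma aeval {b : K} (h : HasVal f a b) (P : K[X]) : HasVal (Polynomial.aeval f P) a (P.eval b) := by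
  induction P using Polynomial.induction_on' with
  | add P Q hP hQ => rw [map_add, eval_add]; exact hP.add hQ
  | monomial n c =>
    rw [aeval_monomial, eval_monomial]
    exact (const c a).mul (h.pow n)

lemma div_X_sub_C (h : HasVal f a 0) : Regular (f / (RatFunc.X - RatFunc.C a)) a := by
  obtain ⟨n, d, hd, rfl, hn⟩ := h
  rw [zero_mul] at hn
  obtain ⟨m, rfl⟩ := dvd_iff_isRoot.2 hn
  refine ⟨m.eval a / d.eval a, m, d, hd, ?_, by field_simp⟩
  have : (RatFunc.X - RatFunc.C a : RatFunc K) ≠ 0 := by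
    have := RatFunc.algebraMap_ne_zero (X_sub_C_ne_zero a)
    simpa using this
  rw [map_mul, map_sub, RatFunc.algebraMap_X, RatFunc.algebraMap_C]
  field_simp

lemma X_sub_C_mul (h : Regular f a) : HasVal ((RatFunc.X - RatFunc.C a) * f) a 0 := by
  obtain ⟨v, h⟩ := h
  simpa using ((X a).sub (const a a)).mul h

end HasVal

namespace Regular

variable {f g : RatFunc K} {a : K}

lemma add (h : Regular f a) (h' : Regular g a) : Regular (f + g) a :=
  let ⟨_, h⟩ := h; let ⟨_, h'⟩ := h'; ⟨_, h.add h'⟩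
lemma sub (h : Regular f a) (h' : Regular g a) : Regular (f - g) a :=
  let ⟨_, h⟩ := h; let ⟨_, h'⟩ := h'; ⟨_, h.sub h'⟩
lemma mul (h : Regular f a) (h' : Regular g a) : Regular (f * g) a :=
  let ⟨_, h⟩ := h; let ⟨_, h'⟩ := h'; ⟨_, h.mul h'⟩
lemma neg (h : Regular f a) : Regular (-f) a :=
  let ⟨_, h⟩ := h; ⟨_, h.neg⟩
lemma const (c a : K) : Regular (RatFunc.C c) a := ⟨_, HasVal.const c a⟩
lemma sum {ι : Type*} (s : Finset ι) {F : ι → RatFunc K}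
    (h : ∀ i ∈ s, Regular (F i) a) : Regular (∑ i ∈ s, F i) a := by
  classical
  induction s using Finset.induction_on with
  | empty => simpa using const 0 a
  | insert i s hi ih =>
    rw [Finset.sum_insert hi]
    exact (h i (by simp)).add (ih fun j hj => h j (by simp [hj]))

end Regular

lemma regular_iff_not_isPole {f : RatFunc K} {a : K} : Regular f a ↔ ¬ IsPole f a := by
  constructor
  · rintro ⟨v, n, d, hd, hf, -⟩ hp
    have hd0 : d ≠ 0 := by rintro rfl; simp at hd
    exact hd (hp.dvd ((RatFunc.denom_dvd hd0).2 ⟨n, hf⟩))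
  · intro h
    refine ⟨f.num.eval a / f.denom.eval a, f.num, f.denom, h, (RatFunc.num_div_denom f).symm, ?_⟩
    rw [div_mul_cancel₀ _ h]

lemma X_sub_C_ne_zero' (a : K) : (RatFunc.X - RatFunc.C a : RatFunc K) ≠ 0 := by
  have := RatFunc.algebraMap_ne_zero (X_sub_C_ne_zero a)
  simpa using this

/-- The order and the leading coefficient at a pole. -/
lemma exists_order {f : RatFunc K} {a : K} (h : ¬ Regular f a) :
    f.denom.rootMultiplicity a ≠ 0 ∧
    ∃ u, u ≠ 0 ∧ HasVal ((RatFunc.X - RatFunc.C a) ^ f.denom.rootMultiplicity a * f) a u := by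
  rw [regular_iff_not_isPole, not_not] at h
  have hd0 := RatFunc.denom_ne_zero f
  obtain ⟨d, hd, hdvd⟩ := exists_eq_pow_rootMultiplicity_mul_and_not_dvd f.denom hd0 a
  rw [dvd_iff_isRoot] at hdvd
  have hn : f.num.eval a ≠ 0 := by
    intro h0
    obtain ⟨u, w, huw⟩ := RatFunc.isCoprime_num_denom f
    have := congrArg (Polynomial.eval a) huw
    rw [eval_add, eval_mul, eval_mul, h0, (h : f.denom.eval a = 0)] at this
    simp at this
  refine ⟨((rootMultiplicity_pos hd0).2 h).ne', f.num.eval a / d.eval a,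
    div_ne_zero hn hdvd, f.num, d, hdvd, ?_, by rw [div_mul_cancel₀ _ hdvd]⟩
  set N := f.denom.rootMultiplicity a
  have hf := RatFunc.num_div_denom f
  rw [hd, map_mul, map_pow, map_sub, RatFunc.algebraMap_X, RatFunc.algebraMap_C] at hf
  have h1 := algebraMap_ne_zero_of_eval hdvd
  have h2 := pow_ne_zero N (X_sub_C_ne_zero' a)
  rw [eq_div_iff h1]
  rw [div_eq_iff (mul_ne_zero h2 h1)] at hf
  rw [hf]; ring

lemma regular_pow_mul (f : RatFunc K) (a : K) :
    Regular ((RatFunc.X - RatFunc.C a) ^ f.denom.rootMultiplicity a * f) a := by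
  by_cases h : Regular f a
  · exact Regular.mul ⟨_, ((HasVal.X a).sub (HasVal.const a a)).pow _⟩ h
  · obtain ⟨-, u, -, hu⟩ := exists_order h
    exact ⟨u, hu⟩

lemma exists_polar_part {a : K} (N : ℕ) : ∀ f : RatFunc K,
    Regular ((RatFunc.X - RatFunc.C a) ^ N * f) a →
    ∃ β : ℕ → K, Regular (f - ∑ n ∈ Finset.Icc 1 N,
      RatFunc.C (β n) / (RatFunc.X - RatFunc.C a) ^ n) a := by
  induction N with
  | zero => intro f hf; exact ⟨0, by simpa using hf⟩
  | succ N ih =>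
    rintro f ⟨v, hf⟩
    have h0 := X_sub_C_ne_zero' a
    have h1 : HasVal ((RatFunc.X - RatFunc.C a) ^ (N + 1) *
        (f - RatFunc.C v / (RatFunc.X - RatFunc.C a) ^ (N + 1))) a 0 := by
      have := hf.sub (HasVal.const v a)
      rw [sub_self] at this
      convert this using 1
      field_simp
    have h2 := h1.div_X_sub_C
    rw [pow_succ', mul_assoc, mul_div_cancel_left₀ _ h0] at h2
    obtain ⟨β, hβ⟩ := ih _ h2
    refine ⟨Function.update β (N + 1) v, ?_⟩
    rw [Finset.sum_Icc_succ_top (by omega), Function.update_self]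
    have e : ∑ n ∈ Finset.Icc 1 N, RatFunc.C (Function.update β (N + 1) v n) /
        (RatFunc.X - RatFunc.C a) ^ n = ∑ n ∈ Finset.Icc 1 N, RatFunc.C (β n) /
        (RatFunc.X - RatFunc.C a) ^ n := by
      refine Finset.sum_congr rfl fun n hn => ?_
      rw [Function.update_of_ne]
      have := (Finset.mem_Icc.1 hn).2
      omega
    rw [e]
    convert hβ using 1
    ring

open scoped RatFunc in
lemma coeff_laurentSeries_of_regular {f : RatFunc K} (h : Regular f 0) {n : ℕ} (hn : 0 < n) :
    ((f : RatFunc K) : LaurentSeries K).coeff (-(n : ℤ)) = 0 := by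
  obtain ⟨v, p, d, hd, rfl, -⟩ := h
  have hd' : PowerSeries.constantCoeff (d : PowerSeries K) ≠ 0 := by
    rwa [Polynomial.constantCoeff_coe, Polynomial.coeff_zero_eq_eval_zero]
  have coe : ∀ P : K[X], algebraMap K[X] (LaurentSeries K) P =
      ((P : PowerSeries K) : LaurentSeries K) := by
    intro P
    rw [RatFunc.coe_coe, RatFunc.coePolynomial_eq_algebraMap,
      ← IsScalarTower.algebraMap_apply K[X] (RatFunc K) (LaurentSeries K)]
  have hne : ((d : PowerSeries K) : LaurentSeries K) ≠ 0 := by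
    rw [← coe]
    exact (map_ne_zero_iff _ (FaithfulSMul.algebraMap_injective K[X] (LaurentSeries K))).2
      (by rintro rfl; simp at hd)
  have e : algebraMap (RatFunc K) (LaurentSeries K)
      (algebraMap K[X] (RatFunc K) p / algebraMap K[X] (RatFunc K) d) =
      (((p : PowerSeries K) * (d : PowerSeries K)⁻¹ : PowerSeries K) : LaurentSeries K) := by
    rw [RatFunc.algebraMap_apply_div, coe, coe, div_eq_iff hne, ← PowerSeries.coe_mul, mul_assoc,
      PowerSeries.inv_mul_cancel _ hd', mul_one]
  rw [e, PowerSeries.coeff_coe, if_pos (by omega)]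

open scoped RatFunc in
/-- The Laurent coefficients in the definition of `principalPart` are those of the polar part. -/
lemma regular_sub_principalPart (f : RatFunc K) (a : K) : Regular (f - principalPart a f) a := by
  obtain ⟨β, hβ⟩ := exists_polar_part _ f (regular_pow_mul f a)
  convert hβ using 2
  refine Finset.sum_congr rfl fun m hm => ?_
  congr 2
  obtain ⟨R, hR⟩ : ∃ R, R = f - ∑ n ∈ Finset.Icc 1 (f.denom.rootMultiplicity a),
      RatFunc.C (β n) / (RatFunc.X - RatFunc.C a) ^ n := ⟨_, rfl⟩
  rw [← hR] at hβ
  have hR0 : Regular (RatFunc.laurent a R) 0 := by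
    obtain ⟨v, n, d, hd, rfl, hv⟩ := hβ
    refine ⟨v, taylor a n, taylor a d, by simpa [taylor_eval] using hd, RatFunc.laurent_div _ _ _,
      by simpa [taylor_eval] using hv⟩
  have hf : RatFunc.laurent a f = RatFunc.laurent a R + ∑ n ∈ Finset.Icc 1
      (f.denom.rootMultiplicity a), RatFunc.C (β n) / RatFunc.X ^ n := by
    rw [eq_sub_iff_add_eq] at hR
    conv_lhs => rw [← hR]
    simp [map_sum]
  have hm1 := (Finset.mem_Icc.1 hm).1
  have hterm : ∀ n : ℕ, algebraMap (RatFunc K) (LaurentSeries K)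
      (RatFunc.C (β n) / RatFunc.X ^ n) = HahnSeries.single (-(n : ℤ)) (β n) := by
    intro n
    have hX : (HahnSeries.single (n : ℤ) (1 : K)) ≠ 0 := by simp
    have hC : algebraMap (RatFunc K) (LaurentSeries K) (RatFunc.C (β n)) =
        HahnSeries.single 0 (β n) := by
      rw [← RatFunc.algebraMap_C, ← IsScalarTower.algebraMap_apply K[X] (RatFunc K) (LaurentSeries K)]
      simp
    rw [map_div₀, map_pow, RatFunc.coe_X, hC, ← RatFunc.single_one_eq_pow, div_eq_iff hX,
      HahnSeries.single_mul_single]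
    simp
  rw [hf, map_add, map_sum, HahnSeries.coeff_add, coeff_laurentSeries_of_regular hR0 hm1, zero_add,
    HahnSeries.coeff_sum, Finset.sum_eq_single_of_mem m hm]
  · rw [hterm, HahnSeries.coeff_single_same]
  · intro n _ hnm
    rw [hterm, HahnSeries.coeff_single_of_ne]
    omega

end Values

/-! ### The slash operator -/

section Slash

variable {p : ℕ}

/-- The entries of a matrix, as complex numbers. -/
def entry (M : SL(2, Ring p)) (i j : Fin 2) : ℂ := ((M i j : ℝ) : ℂ)

lemma entry_det (M : SL(2, Ring p)) :
    entry M 0 0 * entry M 1 1 - entry M 0 1 * entry M 1 0 = 1 := by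
  have := coe_det M
  unfold entry
  exact_mod_cast this

lemma entry_mul (M N : SL(2, Ring p)) (i j : Fin 2) :
    entry (M * N) i j = entry M i 0 * entry N 0 j + entry M i 1 * entry N 1 j := by
  unfold entry
  rw [coe_mul_apply]; push_cast; rfl

lemma entry_neg (M : SL(2, Ring p)) (i j : Fin 2) : entry (-M) i j = -entry M i j := by
  unfold entry
  rw [coe_neg_apply]; push_cast; rfl

/-- The denominator `c z + d`. -/
def denX (M : SL(2, Ring p)) : RatFunc ℂ :=
  RatFunc.C (entry M 1 0) * RatFunc.X + RatFunc.C (entry M 1 1)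

/-- The numerator `a z + b`. -/
def numX (M : SL(2, Ring p)) : RatFunc ℂ :=
  RatFunc.C (entry M 0 0) * RatFunc.X + RatFunc.C (entry M 0 1)

lemma C_add_C_mul_X_ne_zero {a b : ℂ} (h : a ≠ 0 ∨ b ≠ 0) :
    RatFunc.C a * RatFunc.X + RatFunc.C b ≠ 0 := by
  have : Polynomial.C a * Polynomial.X + Polynomial.C b ≠ 0 := by
    intro h0
    have h1 := congrArg (fun P => Polynomial.coeff P 0) h0
    have h2 := congrArg (fun P => Polynomial.coeff P 1) h0
    simp at h1 h2
    rcases h with h | h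
    · exact h h2
    · exact h h1
  simpa using RatFunc.algebraMap_ne_zero this

lemma denX_ne_zero (M : SL(2, Ring p)) : denX M ≠ 0 := by
  apply C_add_C_mul_X_ne_zero
  by_contra! h
  have := entry_det M
  rw [h.1, h.2] at this
  simp at this

/-- The rational function `(a z + b) / (c z + d)`. -/
def mobius (M : SL(2, Ring p)) : RatFunc ℂ := numX M / denX M

lemma mobius_ne_C (M : SL(2, Ring p)) : ¬ ∃ c, mobius M = RatFunc.C c := by
  rintro ⟨c, h⟩
  rw [mobius, div_eq_iff (denX_ne_zero M)] at h
  have h1 : RatFunc.C (entry M 0 0 - c * entry M 1 0) * RatFunc.X +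
      RatFunc.C (entry M 0 1 - c * entry M 1 1) = 0 := by
    simp only [map_sub, map_mul]
    linear_combination (norm := (simp only [numX, denX]; ring)) h
  by_contra
  refine C_add_C_mul_X_ne_zero ?_ h1
  by_contra! h2
  have := entry_det M
  rw [sub_eq_zero, sub_eq_zero] at h2
  rw [h2.1, h2.2] at this
  apply one_ne_zero (α := ℂ)
  rw [← this]; ring

/-- The substitution `f ↦ f ((a z + b) / (c z + d))`. -/
def substM (M : SL(2, Ring p)) : RatFunc ℂ →ₐ[ℂ] RatFunc ℂ :=
  RatFunc.liftAlgHom (Polynomial.aeval (mobius M))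
    (nonZeroDivisors_le_comap_nonZeroDivisors_of_injective _
      (transcendental_iff_injective.1 (RatFunc.transcendental_of_ne_C _ (mobius_ne_C M))))

lemma substM_div (M : SL(2, Ring p)) (P Q : Polynomial ℂ) :
    substM M (algebraMap _ _ P / algebraMap _ _ Q) =
      Polynomial.aeval (mobius M) P / Polynomial.aeval (mobius M) Q :=
  RatFunc.liftAlgHom_apply_div _ _ _ _

lemma substM_algebraMap (M : SL(2, Ring p)) (P : Polynomial ℂ) :
    substM M (algebraMap _ _ P) = Polynomial.aeval (mobius M) P := by
  have := substM_div M P 1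
  simpa using this

@[simp] lemma substM_X (M : SL(2, Ring p)) : substM M RatFunc.X = mobius M := by
  rw [← RatFunc.algebraMap_X, substM_algebraMap, Polynomial.aeval_X]

@[simp] lemma substM_C (M : SL(2, Ring p)) (c : ℂ) : substM M (RatFunc.C c) = RatFunc.C c := by
  rw [← RatFunc.algebraMap_C, substM_algebraMap, Polynomial.aeval_C, RatFunc.algebraMap_eq_C,
    RatFunc.algebraMap_C]

lemma slash_eq (k : ℕ) (f : RatFunc ℂ) (M : SL(2, Ring p)) :
    slash k f M = (denX M ^ (2 * k))⁻¹ * substM M f := by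
  have : substM M f = f.eval RatFunc.C (mobius M) := by
    conv_lhs => rw [← RatFunc.num_div_denom f, substM_div]
    rw [RatFunc.eval, Polynomial.aeval_def, Polynomial.aeval_def, RatFunc.algebraMap_eq_C]
  rw [this]
  rfl

lemma denX_mul_mobius (M : SL(2, Ring p)) : denX M * mobius M = numX M := by
  rw [mobius, mul_div_cancel₀ _ (denX_ne_zero M)]

lemma denX_mul (M N : SL(2, Ring p)) : denX (M * N) = denX N * substM N (denX M) := by
  have h := denX_mul_mobius N
  rw [denX, denX.eq_def M, map_add, map_mul, substM_C, substM_C, substM_X, entry_mul, entry_mul]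
  simp only [map_add, map_mul]
  rw [mul_add, mul_left_comm, h, denX, numX]; ring

lemma numX_mul (M N : SL(2, Ring p)) : numX (M * N) = denX N * substM N (numX M) := by
  have h := denX_mul_mobius N
  rw [numX, numX.eq_def M, map_add, map_mul, substM_C, substM_C, substM_X, entry_mul, entry_mul]
  simp only [map_add, map_mul]
  rw [mul_add, mul_left_comm, h, denX, numX]; ring

lemma substM_mobius (M N : SL(2, Ring p)) : substM N (mobius M) = mobius (M * N) := by
  rw [mobius, map_div₀, mobius, denX_mul, numX_mul, mul_div_mul_left _ _ (denX_ne_zero N)]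

lemma substM_substM (M N : SL(2, Ring p)) (f : RatFunc ℂ) :
    substM N (substM M f) = substM (M * N) f := by
  conv_lhs => rw [← RatFunc.num_div_denom f, substM_div, map_div₀, ← Polynomial.aeval_algHom_apply,
    ← Polynomial.aeval_algHom_apply, substM_mobius, ← substM_div, RatFunc.num_div_denom]

lemma slash_slash (k : ℕ) (f : RatFunc ℂ) (M N : SL(2, Ring p)) :
    slash k (slash k f M) N = slash k f (M * N) := by
  simp only [slash_eq]
  rw [map_mul, map_inv₀, map_pow, substM_substM, denX_mul, mul_pow, mul_inv]
  ring

lemma slash_neg (k : ℕ) (f : RatFunc ℂ) (M : SL(2, Ring p)) : slash k f (-M) = slash k f M := by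
  have h1 : denX (-M) = -denX M := by
    simp only [denX, entry_neg, map_neg]; ring
  have h2 : mobius (-M) = mobius M := by
    have hd := denX_ne_zero M
    have h3 : numX (-M) = -numX M := by simp only [numX, entry_neg, map_neg]; ring
    rw [mobius, mobius, h1, h3, div_eq_div_iff (neg_ne_zero.2 hd) hd]
    ring
  rw [slash_eq, slash_eq, h1, Even.neg_pow (even_two_mul k)]
  congr 1
  conv_lhs => rw [← RatFunc.num_div_denom f, substM_div, h2, ← substM_div, RatFunc.num_div_denom]

lemma slash_one (k : ℕ) (f : RatFunc ℂ) : slash k f (1 : SL(2, Ring p)) = f := by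
  have h1 : denX (1 : SL(2, Ring p)) = 1 := by simp [denX, entry]
  have h2 : mobius (1 : SL(2, Ring p)) = RatFunc.X := by simp [mobius, h1, numX, entry]
  rw [slash_eq, h1, one_pow, inv_one, one_mul]
  conv_lhs => rw [← RatFunc.num_div_denom f, substM_div, h2, RatFunc.aeval_X_left_eq_algebraMap,
    RatFunc.aeval_X_left_eq_algebraMap, RatFunc.num_div_denom]

lemma slash_sub (k : ℕ) (f g : RatFunc ℂ) (M : SL(2, Ring p)) :
    slash k (f - g) M = slash k f M - slash k g M := by
  simp only [slash_eq, map_sub, mul_sub]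

lemma slash_C_mul (k : ℕ) (c : ℂ) (f : RatFunc ℂ) (M : SL(2, Ring p)) :
    slash k (RatFunc.C c * f) M = RatFunc.C c * slash k f M := by
  simp only [slash_eq, map_mul, substM_C]; ring

lemma slash_sum {ι : Type*} (k : ℕ) (s : Finset ι) (F : ι → RatFunc ℂ) (M : SL(2, Ring p)) :
    slash k (∑ i ∈ s, F i) M = ∑ i ∈ s, slash k (F i) M := by
  simp only [slash_eq, map_sum, Finset.mul_sum]

/-! ### Values under the slash operator -/

lemma hasVal_denX (M : SL(2, Ring p)) (z : ℂ) :
    HasVal (denX M) z (entry M 1 0 * z + entry M 1 1) :=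
  ((HasVal.const _ _).mul (HasVal.X z)).add (HasVal.const _ _)

lemma hasVal_mobius (M : SL(2, Ring p)) {z w : ℂ} (h : entry M 1 0 * z + entry M 1 1 ≠ 0)
    (hw : entry M 0 0 * z + entry M 0 1 = (entry M 1 0 * z + entry M 1 1) * w) :
    HasVal (mobius M) z w := by
  have : HasVal (numX M) z (entry M 0 0 * z + entry M 0 1) :=
    ((HasVal.const _ _).mul (HasVal.X z)).add (HasVal.const _ _)
  have := this.div (hasVal_denX M z) h
  rwa [hw, mul_div_cancel_left₀ _ h] at this

lemma HasVal.substM {M : SL(2, Ring p)} {z w v : ℂ} {f : RatFunc ℂ} (hf : HasVal f w v)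
    (h : HasVal (mobius M) z w) : HasVal (substM M f) z v := by
  obtain ⟨n, d, hd, rfl, hv⟩ := hf
  rw [substM_div]
  have := (h.aeval n).div (h.aeval d) hd
  rwa [hv, mul_div_cancel_right₀ _ hd] at this

lemma Maps.hasVal_mobius {M : SL(2, Ring p)} {x y : ℝ} (h : Maps M x y) :
    HasVal (mobius M) (x : ℂ) (y : ℂ) := by
  obtain ⟨h1, h2⟩ := h
  refine Hecke.hasVal_mobius M ?_ ?_ <;> unfold entry
  · exact_mod_cast h1
  · exact_mod_cast h2

lemma Maps.entry_den_ne_zero {M : SL(2, Ring p)} {x y : ℝ} (h : Maps M x y) :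
    entry M 1 0 * (x : ℂ) + entry M 1 1 ≠ 0 := by
  have := h.1
  unfold entry
  exact_mod_cast this

lemma Regular.slash {M : SL(2, Ring p)} {z w : ℂ} {f : RatFunc ℂ} (k : ℕ)
    (h : entry M 1 0 * z + entry M 1 1 ≠ 0)
    (hw : entry M 0 0 * z + entry M 0 1 = (entry M 1 0 * z + entry M 1 1) * w)
    (hf : Regular f w) : Regular (slash k f M) z := by
  obtain ⟨v, hf⟩ := hf
  rw [slash_eq]
  exact ⟨_, (((hasVal_denX M z).pow _).inv (pow_ne_zero _ h)).mul
    (hf.substM (Hecke.hasVal_mobius M h hw))⟩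

lemma Regular.slash_of_maps {M : SL(2, Ring p)} {x y : ℝ} {f : RatFunc ℂ} (k : ℕ)
    (h : Maps M x y) (hf : Regular f (y : ℂ)) : Regular (Hecke.slash k f M) (x : ℂ) := by
  obtain ⟨v, hf⟩ := hf
  rw [slash_eq]
  exact ⟨_, (((hasVal_denX M x).pow _).inv (pow_ne_zero _ h.entry_den_ne_zero)).mul
    (hf.substM h.hasVal_mobius)⟩

lemma substM_X_sub_C {M : SL(2, Ring p)} {x y : ℝ} (h : Maps M x y) :
    substM M (RatFunc.X - RatFunc.C (y : ℂ)) = (RatFunc.X - RatFunc.C (x : ℂ)) /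
      (denX M * RatFunc.C (entry M 1 0 * (x : ℂ) + entry M 1 1)) := by
  have hm := h.entry_den_ne_zero
  have hd := denX_ne_zero M
  have hC : RatFunc.C (entry M 1 0 * (x : ℂ) + entry M 1 1) ≠ 0 :=
    (map_ne_zero _).2 hm
  have h2 : entry M 0 0 * (x : ℂ) + entry M 0 1 = (entry M 1 0 * (x : ℂ) + entry M 1 1) * y := by
    unfold entry; exact_mod_cast h.2
  have hdet := entry_det M
  rw [map_sub, substM_X, substM_C, mobius, eq_div_iff (mul_ne_zero hd hC), sub_mul, ← mul_assoc,
    div_mul_cancel₀ _ hd]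
  have e1 : RatFunc.C (entry M 0 0) * RatFunc.C (x : ℂ) + RatFunc.C (entry M 0 1) =
      (RatFunc.C (entry M 1 0) * RatFunc.C (x : ℂ) + RatFunc.C (entry M 1 1)) *
        RatFunc.C (y : ℂ) := by
    simp only [← map_mul, ← map_add]; rw [h2]
  have e2 : RatFunc.C (entry M 0 0) * RatFunc.C (entry M 1 1) -
      RatFunc.C (entry M 0 1) * RatFunc.C (entry M 1 0) = 1 := by
    simp only [← map_mul, ← map_sub]; rw [hdet, map_one]
  simp only [map_add, map_mul, numX, denX]
  linear_combination (RatFunc.X - RatFunc.C (x : ℂ)) * e2 +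
    (RatFunc.C (entry M 1 0) * RatFunc.X + RatFunc.C (entry M 1 1)) * e1

lemma slash_twoPoles (k : ℕ) {M : SL(2, Ring p)} {x y x' y' : ℝ} (h : Maps M x y)
    (h' : Maps M x' y') :
    slash k (twoPoles k (y : ℂ) (y' : ℂ)) M = twoPoles k (x : ℂ) (x' : ℂ) := by
  have hm := h.entry_den_ne_zero
  have hm' := h'.entry_den_ne_zero
  have hd := denX_ne_zero M
  have hC : RatFunc.C (entry M 1 0 * (x : ℂ) + entry M 1 1) ≠ 0 :=
    (map_ne_zero _).2 hm
  have hC' : RatFunc.C (entry M 1 0 * (x' : ℂ) + entry M 1 1) ≠ 0 :=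
    (map_ne_zero _).2 hm'
  have e : ((x : ℂ) - x') = (y - y') * (entry M 1 0 * (x : ℂ) + entry M 1 1) *
      (entry M 1 0 * (x' : ℂ) + entry M 1 1) := by
    have h2 : entry M 0 0 * (x : ℂ) + entry M 0 1 = (entry M 1 0 * (x : ℂ) + entry M 1 1) * y := by
      unfold entry; exact_mod_cast h.2
    have h2' : entry M 0 0 * (x' : ℂ) + entry M 0 1 =
        (entry M 1 0 * (x' : ℂ) + entry M 1 1) * y' := by
      unfold entry; exact_mod_cast h'.2
    linear_combination (entry M 1 0 * (x' : ℂ) + entry M 1 1) * h2 -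
      (entry M 1 0 * (x : ℂ) + entry M 1 1) * h2' - (x - x') * entry_det M
  have hx := X_sub_C_ne_zero' (x : ℂ)
  have hx' := X_sub_C_ne_zero' (x' : ℂ)
  rw [slash_eq, twoPoles, twoPoles, e]
  simp only [map_div₀, map_mul, map_pow, substM_X_sub_C h, substM_X_sub_C h', substM_C, mul_pow,
    div_pow]
  generalize RatFunc.C (entry M 1 0 * (x : ℂ) + entry M 1 1) = m at *
  generalize RatFunc.C (entry M 1 0 * (x' : ℂ) + entry M 1 1) = m' at *
  generalize denX M = D at *
  field_simp
  ring

end Slash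

/-! ### Poles at fixed points -/

section FixedPoints

variable {p : ℕ}

/-- If `h` has a pole of order `N` at a hyperbolic fixed point of `V` and `h - h | V` is regular
there, then `N = k`: the leading coefficients of `h | V` and `h` differ by the factor
`(c x + d) ^ (2 N - 2 k)`. -/
lemma order_eq_of_regular_sub_slash {k N : ℕ} {V : SL(2, Ring p)} {x : ℝ} (hV : Maps V x x)
    (hV1 : |(V 1 0 : ℝ) * x + V 1 1| ≠ 1) {h : RatFunc ℂ}
    (hreg : Regular (h - slash k h V) (x : ℂ)) (hN : N ≠ 0) {u : ℂ} (hu : u ≠ 0)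
    (hval : HasVal ((RatFunc.X - RatFunc.C (x : ℂ)) ^ N * h) (x : ℂ) u) : N = k := by
  have hm := hV.entry_den_ne_zero
  obtain ⟨m, hmdef⟩ : ∃ m, m = entry V 1 0 * (x : ℂ) + entry V 1 1 := ⟨_, rfl⟩
  have hd := denX_ne_zero V
  have hden := hasVal_denX V (x : ℂ)
  have hsub := substM_X_sub_C hV
  rw [← hmdef] at hm hden hsub
  have hC : RatFunc.C m ≠ 0 := (map_ne_zero _).2 hm
  have hX := X_sub_C_ne_zero' (x : ℂ)
  have h1 := hval.substM hV.hasVal_mobius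
  have h2 := ((((hden.mul (HasVal.const m _)).pow N).mul h1).mul
    ((hden.pow (2 * k)).inv (pow_ne_zero _ hm)))
  have e : (denX V * RatFunc.C m) ^ N * substM V ((RatFunc.X - RatFunc.C (x : ℂ)) ^ N * h) *
      (denX V ^ (2 * k))⁻¹ = (RatFunc.X - RatFunc.C (x : ℂ)) ^ N * slash k h V := by
    rw [map_mul, map_pow, hsub, slash_eq, div_pow]
    have := pow_ne_zero N (mul_ne_zero hd hC)
    field_simp
  rw [e] at h2
  have h3 := hval.sub h2
  rw [← mul_sub] at h3
  have h4 : HasVal ((RatFunc.X - RatFunc.C (x : ℂ)) ^ N * (h - slash k h V)) (x : ℂ) 0 := by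
    obtain ⟨N, rfl⟩ := Nat.exists_eq_succ_of_ne_zero hN
    rw [pow_succ', mul_assoc]
    refine HasVal.X_sub_C_mul (Regular.mul ⟨_, ((HasVal.X _).sub (HasVal.const _ _)).pow N⟩ hreg)
  have h5 := h3.unique h4
  have h6 : m ^ (2 * N) = m ^ (2 * k) := by
    have h7 : u * (m ^ (2 * k) - m ^ (2 * N)) = 0 := by
      have := pow_ne_zero (2 * k) hm
      field_simp at h5
      have e2 : m ^ (2 * N) = m ^ N * m ^ N := by ring
      linear_combination (norm := (ring_nf)) h5
    rcases mul_eq_zero.1 h7 with h8 | h8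
    · exact absurd h8 hu
    · exact (sub_eq_zero.1 h8).symm
  have h7 : |(V 1 0 : ℝ) * x + V 1 1| ^ (2 * N) = |(V 1 0 : ℝ) * x + V 1 1| ^ (2 * k) := by
    have hm' : m = (((V 1 0 : ℝ) * x + V 1 1 : ℝ) : ℂ) := by
      rw [hmdef]; unfold entry; push_cast; rfl
    rw [hm'] at h6
    rw [← abs_pow, ← abs_pow]
    congr 1
    exact_mod_cast h6
  have := pow_right_injective₀ (abs_pos.2 hV.1) hV1 h7
  omega

lemma hasVal_twoPoles (k : ℕ) {x x' : ℂ} (hne : x ≠ x') :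
    HasVal ((RatFunc.X - RatFunc.C x) ^ k * twoPoles k x x') x 1 := by
  have h := sub_ne_zero.2 hne
  have hX := X_sub_C_ne_zero' x
  have hX' := X_sub_C_ne_zero' x'
  have h1 := (HasVal.const ((x - x') ^ k) x).div
    (((HasVal.X x).sub (HasVal.const x' x)).pow k) (pow_ne_zero k h)
  rw [div_self (pow_ne_zero k h)] at h1
  convert h1 using 1
  rw [twoPoles]
  field_simp

/-- A rational function whose polar part at a hyperbolic fixed point `x` of `V` is invariant under
`V` has there the polar part of a multiple of `((x - x') / ((z - x) (z - x'))) ^ k`. -/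
lemma exists_regular_sub_twoPoles {k : ℕ} {V : SL(2, Ring p)} {x x' : ℝ}
    (hV : Maps V x x) (hV' : Maps V x' x') (hne : x ≠ x')
    (hV1 : |(V 1 0 : ℝ) * x + V 1 1| ≠ 1) {h : RatFunc ℂ}
    (hreg : Regular (h - slash k h V) (x : ℂ)) :
    ∃ c, Regular (h - RatFunc.C c * twoPoles k (x : ℂ) (x' : ℂ)) (x : ℂ) := by
  by_cases h0 : Regular h (x : ℂ)
  · exact ⟨0, by simpa using h0⟩
  obtain ⟨hN, u, hu, hval⟩ := exists_order h0
  rw [order_eq_of_regular_sub_slash hV hV1 hreg hN hu hval] at hval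
  refine ⟨u, ?_⟩
  by_contra h1
  obtain ⟨hN', w, hw, hval'⟩ := exists_order h1
  have hne' : (x : ℂ) ≠ x' := by exact_mod_cast hne
  have hreg' : Regular ((h - RatFunc.C u * twoPoles k (x : ℂ) (x' : ℂ)) -
      slash k (h - RatFunc.C u * twoPoles k (x : ℂ) (x' : ℂ)) V) (x : ℂ) := by
    rw [slash_sub, slash_C_mul, slash_twoPoles k hV hV']
    convert hreg using 1; ring
  rw [order_eq_of_regular_sub_slash hV hV1 hreg' hN' hw hval'] at hval'
  have h2 := hval.sub ((HasVal.const u _).mul (hasVal_twoPoles k hne'))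
  rw [mul_one, sub_self] at h2
  refine hw (hval'.unique ?_)
  convert h2 using 1; ring

end FixedPoints

/-! ### The poles of a rational period function -/

section Poles

variable {p k : ℕ} {q : RatFunc ℂ}

lemma IsRPF.slash_T (h : IsRPF p k q) : slash k q (T p) = -q :=
  eq_neg_of_add_eq_zero_right h.1

/-- The two relations combined: applying `T` to the second one gives the eigenfunction equation of
a transfer operator whose branches are the letters. -/
lemma IsRPF.eq_sum_letters (hp : 3 ≤ p) (h : IsRPF p k q) :
    q = ∑ j ∈ Finset.range (p - 1), slash k q (letter p j) := by
  have h2 := congrArg (fun f => slash k f (T p)) h.2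
  simp only [slash_sum, slash_slash] at h2
  obtain ⟨n, rfl⟩ : ∃ n, p = n + 1 := ⟨p - 1, by omega⟩
  rw [Finset.sum_range_succ', pow_zero, one_mul, h.slash_T] at h2
  have h0 : slash k (0 : RatFunc ℂ) (T (n + 1)) = 0 := by rw [slash_eq, map_zero, mul_zero]
  rw [h0, ← sub_eq_add_neg, sub_eq_zero] at h2
  refine h2.symm.trans (Finset.sum_congr rfl fun j _ => ?_)
  rw [letter, slash_neg]

lemma IsRPF.regular_neg_inv (h : IsRPF p k q) {z : ℂ} (hz : z ≠ 0) (hq : Regular q z) :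
    Regular q (-1 / z) := by
  have e : q = -slash k q (T p) := by rw [h.slash_T, neg_neg]
  rw [e]
  have hT : entry (T p) 0 0 = 0 ∧ entry (T p) 0 1 = -1 ∧ entry (T p) 1 0 = 1 ∧
      entry (T p) 1 1 = 0 := by simp [entry, T]
  obtain ⟨t1, t2, t3, t4⟩ := hT
  refine Regular.neg (Regular.slash k (w := z) ?_ ?_ hq)
  · rw [t3, t4]; simpa using hz
  · rw [t1, t2, t3, t4]; field_simp; ring

/-- `M z = w` for complex numbers `z`, `w`. -/
def MapsC (M : SL(2, Ring p)) (z w : ℂ) : Prop :=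
  entry M 1 0 * z + entry M 1 1 ≠ 0 ∧
    entry M 0 0 * z + entry M 0 1 = (entry M 1 0 * z + entry M 1 1) * w

lemma MapsC.mul {M N : SL(2, Ring p)} {x y z : ℂ} (hM : MapsC M y z) (hN : MapsC N x y) :
    MapsC (M * N) x z := by
  obtain ⟨h1, h2⟩ := hM
  obtain ⟨h3, h4⟩ := hN
  have key : entry (M * N) 1 0 * x + entry (M * N) 1 1
      = (entry M 1 0 * y + entry M 1 1) * (entry N 1 0 * x + entry N 1 1) := by
    simp only [entry_mul]; linear_combination entry M 1 0 * h4
  refine ⟨by rw [key]; exact mul_ne_zero h1 h3, ?_⟩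
  rw [key]; simp only [entry_mul]
  linear_combination entry M 0 0 * h4 + (entry N 1 0 * x + entry N 1 1) * h2

lemma exists_mapsC_of_im_ne_zero (M : SL(2, Ring p)) {z : ℂ} (hz : z.im ≠ 0) :
    ∃ w, w.im ≠ 0 ∧ MapsC M z w := by
  have hd := coe_det M
  have hden : entry M 1 0 * z + entry M 1 1 ≠ 0 := by
    intro h0
    have h1 := congrArg Complex.im h0
    have h2 := congrArg Complex.re h0
    simp [entry, hz] at h1 h2
    rw [h1] at h2 hd
    simp at h2
    rw [h2] at hd
    simp at hd
  refine ⟨(entry M 0 0 * z + entry M 0 1) / (entry M 1 0 * z + entry M 1 1), ?_, hden,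
    by rw [mul_div_cancel₀ _ hden]⟩
  intro h0
  obtain ⟨t, ht⟩ : ∃ t : ℝ, (t : ℂ) =
      (entry M 0 0 * z + entry M 0 1) / (entry M 1 0 * z + entry M 1 1) :=
    ⟨_, Complex.conj_eq_iff_re.1 (Complex.conj_eq_iff_im.2 h0)⟩
  rw [eq_div_iff hden] at ht
  have h1 := congrArg Complex.im ht
  have h2 := congrArg Complex.re ht
  simp [entry] at h1 h2
  have h3 : t * (M 1 0 : ℝ) = M 0 0 := mul_right_cancel₀ hz (by linarith)
  have h4 : t * (M 1 1 : ℝ) = M 0 1 := by rw [← h3] at h2; linarith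
  rw [← h3, ← h4] at hd
  have : (0 : ℝ) = 1 := by linear_combination hd
  norm_num at this

lemma PosMatrix.not_mapsC {M : SL(2, Ring p)} (h : PosMatrix M) {z : ℂ} (hz : z.im ≠ 0) :
    ¬ MapsC M z z := by
  rintro ⟨-, h2⟩
  obtain ⟨-, -, a3, a4, a5⟩ := h
  have h3 := congrArg Complex.im h2
  have h4 := congrArg Complex.re h2
  simp [entry] at h3 h4
  have h5 : (M 0 0 : ℝ) - M 1 1 = 2 * M 1 0 * z.re := mul_right_cancel₀ hz (by linarith)
  have h6 : (M 1 0 : ℝ) * (z.re ^ 2 + z.im ^ 2) + M 0 1 = 0 := by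
    linear_combination h4 - z.re * h5
  have h7 : 0 < z.re ^ 2 + z.im ^ 2 := by positivity
  rcases a4.eq_or_lt with h8 | h8
  · rw [← h8] at h6 a5; linarith
  · have := mul_pos h8 h7; linarith

/-- A pole is carried to a pole by some letter. -/
lemma IsRPF.exists_step (hp : 3 ≤ p) (h : IsRPF p k q) {z : ℂ} {w : ℕ → ℂ}
    (hw : ∀ j, j + 1 < p → MapsC (letter p j) z (w j)) (hz : ¬ Regular q z) :
    ∃ j, j + 1 < p ∧ ¬ Regular q (w j) := by
  by_contra! hc
  apply hz
  rw [h.eq_sum_letters hp]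
  refine Regular.sum _ fun j hj => ?_
  have hj' : j + 1 < p := by have := Finset.mem_range.1 hj; omega
  exact (hc j hj').slash k (hw j hj').1 (hw j hj').2

/-- The poles of a rational period function are real: a non-real pole would be carried along
non-real poles by letters, until a product of letters fixes one of them. -/
lemma IsRPF.regular_of_im_ne_zero (hp : 3 ≤ p) (h : IsRPF p k q) {z : ℂ} (hz : z.im ≠ 0) :
    Regular q z := by
  by_contra hcon
  let F := {z : ℂ // z.im ≠ 0 ∧ ¬ Regular q z}
  have hfin : Finite F := by
    refine Set.Finite.subset (q.denom.roots.toFinset.finite_toSet) ?_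
    rintro z ⟨-, hz⟩
    rw [regular_iff_not_isPole, not_not] at hz
    simpa using ⟨RatFunc.denom_ne_zero q, hz⟩
  have step : ∀ z : F, ∃ w : F, ∃ j, j + 1 < p ∧ MapsC (letter p j) z.1 w.1 := by
    rintro ⟨z, hz, hz'⟩
    choose w hw hw' using fun j => exists_mapsC_of_im_ne_zero (letter p j) hz
    obtain ⟨j, hj, hj'⟩ := h.exists_step hp (fun j _ => hw' j) hz'
    exact ⟨⟨w j, hw j, hj'⟩, j, hj, hw' j⟩
  choose θ hθ using step
  have iter : ∀ n : ℕ, 0 < n → ∀ z : F, ∃ M : SL(2, Ring p), PosMatrix M ∧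
      MapsC M z.1 (θ^[n] z).1 := by
    intro n hn
    induction n, hn using Nat.le_induction with
    | base =>
      intro z
      obtain ⟨j, hj, hj'⟩ := hθ z
      exact ⟨_, posMatrix_letter hp hj, hj'⟩
    | succ n hn ih =>
      intro z
      obtain ⟨M, hM, hM'⟩ := ih z
      obtain ⟨j, hj, hj'⟩ := hθ (θ^[n] z)
      refine ⟨_, (posMatrix_letter hp hj).mul hM, ?_⟩
      rw [Function.iterate_succ_apply']
      exact hj'.mul hM'
  obtain ⟨i, j, hij, heq⟩ := Finite.exists_ne_map_eq_of_infinite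
    (fun n : ℕ => θ^[n] ⟨z, hz, hcon⟩)
  wlog hlt : i < j generalizing i j
  · exact this j i hij.symm heq.symm (by omega)
  obtain ⟨M, hM, hM'⟩ := iter (j - i) (by omega) (θ^[i] ⟨z, hz, hcon⟩)
  rw [← Function.iterate_add_apply, Nat.sub_add_cancel hlt.le, ← heq] at hM'
  exact hM.not_mapsC (θ^[i] ⟨z, hz, hcon⟩).2.1 hM'

lemma Maps.mapsC {M : SL(2, Ring p)} {x y : ℝ} (h : Maps M x y) : MapsC M (x : ℂ) (y : ℂ) := by
  obtain ⟨h1, h2⟩ := h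
  unfold MapsC entry
  constructor
  · exact_mod_cast h1
  · exact_mod_cast h2

/-- The set of positive poles. -/
def posPoles (q : RatFunc ℂ) : Set ℝ := {x | 0 < x ∧ IsPole q (x : ℂ)}

lemma finite_posPoles (q : RatFunc ℂ) : (posPoles q).Finite := by
  have : (((↑) : ℝ → ℂ) ⁻¹' (q.denom.roots.toFinset : Set ℂ)).Finite :=
    (q.denom.roots.toFinset.finite_toSet).preimage Complex.ofReal_injective.injOn
  refine this.subset ?_
  rintro x ⟨-, hx⟩
  simpa using ⟨RatFunc.denom_ne_zero q, hx⟩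

/-- Every positive pole is carried to a positive pole by some letter. The images of different
letters are disjoint, so this is an injection, hence a bijection, of the finite set of positive
poles. Its inverse is the shift of expansions. -/
lemma IsRPF.next_posPoles (hp : 3 ≤ p) (h : IsRPF p k q) :
    Set.MapsTo (next p) (posPoles q) (posPoles q) ∧ Set.InjOn (next p) (posPoles q) := by
  have step : ∀ x : posPoles q, ∃ y : posPoles q, ∃ j, j + 1 < p ∧ Maps (letter p j) x.1 y.1 := by
    rintro ⟨x, hx, hx'⟩
    obtain ⟨j, hj, hj'⟩ := h.exists_step hp (z := (x : ℂ)) (w := fun j => (letterMap p j x : ℂ))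
      (fun j hj => (maps_letterMap hp hj hx.le).mapsC) (by rwa [regular_iff_not_isPole, not_not])
    rw [regular_iff_not_isPole, not_not] at hj'
    exact ⟨⟨letterMap p j x, letterMap_pos hp hj hx, hj'⟩, j, hj, maps_letterMap hp hj hx.le⟩
  choose θ hθ using step
  have hnext : ∀ x, next p (θ x).1 = x.1 := by
    intro x
    obtain ⟨j, hj, hj'⟩ := hθ x
    exact (digit_eq_of_maps hp hj x.2.1.le (θ x).2.1.le hj').2
  have hinj : Function.Injective θ := by
    intro x y hxy
    apply Subtype.ext
    rw [← hnext x, ← hnext y, hxy]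
  have := (finite_posPoles q).to_subtype
  have hsurj := Finite.surjective_of_injective hinj
  constructor
  · intro y hy
    obtain ⟨x, hx⟩ := hsurj ⟨y, hy⟩
    have := hnext x
    rw [hx] at this
    exact this ▸ x.2
  · intro y hy z hz hyz
    obtain ⟨x, hx⟩ := hsurj ⟨y, hy⟩
    obtain ⟨x', hx'⟩ := hsurj ⟨z, hz⟩
    have h1 := hnext x
    have h2 := hnext x'
    rw [hx] at h1
    rw [hx'] at h2
    have : x = x' := Subtype.ext (by rw [← h1, ← h2]; exact hyz)
    rw [this, hx'] at hx
    exact (congrArg Subtype.val hx).symm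

lemma IsRPF.exists_periodic (hp : 3 ≤ p) (h : IsRPF p k q) {x : ℝ} (hx : x ∈ posPoles q) :
    ∃ r, 0 < r ∧ (next p)^[r] x = x := by
  obtain ⟨hm, hi⟩ := h.next_posPoles hp
  have := (finite_posPoles q).to_subtype
  obtain ⟨i, j, hij, heq⟩ := Finite.exists_ne_map_eq_of_infinite
    (fun n : ℕ => (⟨(next p)^[n] x, hm.iterate n hx⟩ : posPoles q))
  replace heq := congrArg Subtype.val heq
  simp only at heq
  wlog hlt : i < j generalizing i j
  · exact this j i hij.symm heq.symm (by omega)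
  refine ⟨j - i, by omega, ?_⟩
  have hj : j = i + (j - i) := by omega
  rw [hj, Function.iterate_add_apply] at heq
  exact (hi.iterate hm i hx (hm.iterate (j - i) hx) heq).symm

lemma IsRPF.isHyperbolicPoint (hp : 3 ≤ p) (h : IsRPF p k q) {x : ℝ} (hx : x ∈ posPoles q) :
    IsHyperbolicPoint p x ∧ (formOf p x).IsSimple := by
  obtain ⟨r, hr, hr'⟩ := h.exists_periodic hp hx
  exact isHyperbolicPoint_of_periodic hp hx.1 hr hr'

/-- Only one of the terms `q | letter` has a pole at `next y`, for `y` a positive pole. -/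
lemma IsRPF.regular_sub_slash_letter (hp : 3 ≤ p) (h : IsRPF p k q) {y : ℝ}
    (hy : y ∈ posPoles q) :
    Regular (q - slash k q (letter p (digit p y))) (next p y : ℂ) := by
  obtain ⟨hm, hi⟩ := h.next_posPoles hp
  have hd := (digit_spec hp hy.1.le).1
  have hx := hm hy
  have hmem : digit p y ∈ Finset.range (p - 1) := Finset.mem_range.2 (by omega)
  have e : q - slash k q (letter p (digit p y)) =
      ∑ j ∈ (Finset.range (p - 1)).erase (digit p y), slash k q (letter p j) := by
    rw [Finset.sum_erase_eq_sub hmem, ← h.eq_sum_letters hp]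
  rw [e]
  refine Regular.sum _ fun j hj => ?_
  obtain ⟨hj1, hj2⟩ := Finset.mem_erase.1 hj
  have hj' : j + 1 < p := by have := Finset.mem_range.1 hj2; omega
  have hmap := maps_letterMap hp hj' hx.1.le
  refine Regular.slash_of_maps k hmap ?_
  rw [regular_iff_not_isPole]
  intro hpole
  have hpos := letterMap_pos hp hj' hx.1
  obtain ⟨d1, d2⟩ := digit_eq_of_maps hp hj' hx.1.le hpos.le hmap
  have := hi ⟨hpos, hpole⟩ hy d2
  rw [this] at d1
  exact hj1 d1.symm

/-- Only one of the terms `q | letter` has a pole at `0`. -/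
lemma IsRPF.regular_sub_slash_letter_zero (hp : 3 ≤ p) (h : IsRPF p k q) :
    Regular (q - slash k q (letter p (p - 2))) 0 := by
  obtain ⟨hm, hi⟩ := h.next_posPoles hp
  have hmem : p - 2 ∈ Finset.range (p - 1) := Finset.mem_range.2 (by omega)
  have e : q - slash k q (letter p (p - 2)) =
      ∑ j ∈ (Finset.range (p - 1)).erase (p - 2), slash k q (letter p j) := by
    rw [Finset.sum_erase_eq_sub hmem, ← h.eq_sum_letters hp]
  rw [e]
  refine Regular.sum _ fun j hj => ?_
  obtain ⟨hj1, hj2⟩ := Finset.mem_erase.1 hj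
  have hj' : j + 1 < p := by have := Finset.mem_range.1 hj2; omega
  have hmap := maps_letterMap hp hj' (le_refl (0 : ℝ))
  have := Regular.slash_of_maps (f := q) k hmap
  rw [Complex.ofReal_zero] at this
  refine this ?_
  rw [regular_iff_not_isPole]
  intro hpole
  have hpos : 0 < letterMap p j 0 := by
    obtain ⟨-, e2, -, e4⟩ := letter_entries hp j
    rw [letterMap, mul_zero, mul_zero, zero_add, zero_add, e2, e4]
    exact div_pos (sinQuot_pos hp (by omega) (by omega)) (sinQuot_pos hp (by omega) hj')
  obtain ⟨-, d2⟩ := digit_eq_of_maps hp hj' le_rfl hpos.le hmap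
  have := (hm ⟨hpos, hpole⟩).1
  rw [d2] at this
  exact lt_irrefl _ this

lemma IsRPF.regular_sub_slash_prefixWord (hp : 3 ≤ p) (h : IsRPF p k q) {y : ℝ}
    (hy : y ∈ posPoles q) (n : ℕ) :
    Regular (q - slash k q (prefixWord p y n)) ((next p)^[n] y : ℝ) := by
  obtain ⟨hm, -⟩ := h.next_posPoles hp
  induction n with
  | zero => simpa [prefixWord, slash_one] using Regular.const 0 (y : ℂ)
  | succ n ih =>
    have hyn : (next p)^[n] y ∈ posPoles q := hm.iterate n hy
    have h1 := h.regular_sub_slash_letter hp hyn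
    have h2 := ih.slash_of_maps k (maps_next hp hyn.1.le)
    rw [Function.iterate_succ_apply', prefixWord]
    convert h1.add h2 using 1
    rw [slash_sub, slash_slash]; ring

/-- At every positive pole `x`, the polar part is that of a multiple of
`((x - x') / ((z - x) (z - x'))) ^ k`. -/
lemma IsRPF.exists_const (hp : 3 ≤ p) (h : IsRPF p k q) {x : ℝ}
    (hx : x ∈ posPoles q) :
    ∃ c, Regular (q - RatFunc.C c * twoPoles k (x : ℂ) (conj p x : ℂ)) (x : ℂ) := by
  obtain ⟨r, hr, hr'⟩ := h.exists_periodic hp hx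
  have hyp := (h.isHyperbolicPoint hp hx).1
  have hmap := maps_prefixWord hp hx.1.le r
  have hreg := h.regular_sub_slash_prefixWord hp hx r
  rw [hr'] at hmap hreg
  have htr := (posMatrix_prefixWord hp hx.1.le hr).two_lt_trace hx.1 hmap
  exact exists_regular_sub_twoPoles hmap (maps_conj hp hyp (prefixWord_mem _ _) hmap)
    (conj_ne hp hyp) ((two_lt_abs_trace_iff hmap).1 htr) hreg

/-- The constant in the polar part is the same along the expansion. -/
lemma IsRPF.const_iterate (hp : 3 ≤ p) (h : IsRPF p k q) {x : ℝ}
    (hx : x ∈ posPoles q) {c : ℂ}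
    (hc : Regular (q - RatFunc.C c * twoPoles k (x : ℂ) (conj p x : ℂ)) (x : ℂ)) (n : ℕ) :
    Regular (q - RatFunc.C c * twoPoles k (((next p)^[n] x : ℝ) : ℂ)
      (conj p ((next p)^[n] x) : ℂ)) (((next p)^[n] x : ℝ) : ℂ) := by
  have hyp := (h.isHyperbolicPoint hp hx).1
  have hmap := maps_prefixWord hp hx.1.le n
  have hconj := (formOf_of_maps hp hyp (prefixWord_mem _ _) hmap).2
  have h1 := h.regular_sub_slash_prefixWord hp hx n
  have h2 := hc.slash_of_maps k hmap
  convert h1.add h2 using 1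
  rw [slash_sub, slash_C_mul, slash_twoPoles k hmap hconj]; ring

/-- The constant in the polar part depends only on the class: two positive poles of the same class
have expansions with a common tail, and both are purely periodic, so that one is an iterate of the
other under the shift. -/
lemma IsRPF.const_of_formClass_eq (hp : 3 ≤ p) (h : IsRPF p k q) {x y : ℝ}
    (hx : x ∈ posPoles q) (hy : y ∈ posPoles q)
    (hxy : (⟦formOf p x⟧ : FormClass p) = ⟦formOf p y⟧) {c : ℂ}
    (hc : Regular (q - RatFunc.C c * twoPoles k (x : ℂ) (conj p x : ℂ)) (x : ℂ)) :
    Regular (q - RatFunc.C c * twoPoles k (y : ℂ) (conj p y : ℂ)) (y : ℂ) := by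
  obtain ⟨V, hV, hmap⟩ := exists_maps_of_formClass_eq hp (h.isHyperbolicPoint hp hy).1
    (h.isHyperbolicPoint hp hx).1 hxy.symm
  obtain ⟨m, n, hmn, -⟩ := exists_prefixWord_of_maps hp hx.1.le hy.1.le hV hmap
  obtain ⟨r, hr, hr'⟩ := h.exists_periodic hp hy
  have h1 := h.const_iterate hp hx hc (r * n - n + m)
  have e : (next p)^[r * n - n + m] x = y := by
    rw [Function.iterate_add_apply, hmn, ← Function.iterate_add_apply,
      Nat.sub_add_cancel (Nat.le_mul_of_pos_left n hr)]
    exact (Function.IsPeriodicPt.mul_const (f := next p) hr' n)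
  rwa [e] at h1

/-- The points of `Z_𝒜` are poles as soon as one of them is. -/
lemma IsRPF.simplePoints_subset (hp : 3 ≤ p) (h : IsRPF p k q) {x : ℝ}
    (hx : x ∈ posPoles q) : simplePoints (⟦formOf p x⟧ : FormClass p) ⊆ posPoles q := by
  rintro y ⟨hy, hxy, hsimple⟩
  have hy0 := ((isSimple_formOf_iff hp hy).1 hsimple).1
  obtain ⟨V, hV, hmap⟩ := exists_maps_of_formClass_eq hp hy
    (h.isHyperbolicPoint hp hx).1 hxy
  obtain ⟨m, n, hmn, -⟩ := exists_prefixWord_of_maps hp hx.1.le hy0.le hV hmap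
  obtain ⟨r, hr, hr'⟩ := exists_periodic_of_isSimple hp hy hsimple
  have e : (next p)^[r * n - n + m] x = y := by
    rw [Function.iterate_add_apply, hmn, ← Function.iterate_add_apply,
      Nat.sub_add_cancel (Nat.le_mul_of_pos_left n hr)]
    exact (Function.IsPeriodicPt.mul_const (f := next p) hr' n)
  rw [← e]
  exact (h.next_posPoles hp).1.iterate _ hx

end Poles

/-! ### The pole at zero and the behaviour at infinity -/

section Zero

variable {p k : ℕ} {q : RatFunc ℂ}

/-- The order of the pole at `0` is at most `2 k`. The letter that fixes `0` is parabolic, so the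
leading terms of `q` and `q | letter` cancel, and the next terms are compared. -/
lemma IsRPF.order_zero_le (hp : 3 ≤ p) (hk : 1 ≤ k) (h : IsRPF p k q) {N : ℕ} {u : ℂ} (hu : u ≠ 0)
    (hval : HasVal (RatFunc.X ^ N * q) 0 u) : N ≤ 2 * k := by
  by_contra! hlt
  obtain ⟨M, rfl⟩ : ∃ M, N = 2 * k + (M + 1) := ⟨N - 2 * k - 1, by omega⟩
  obtain ⟨R, hR⟩ := h.regular_sub_slash_letter_zero hp
  obtain ⟨L, hL⟩ : ∃ L, L = letter p (p - 2) := ⟨_, rfl⟩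
  rw [← hL] at hR
  obtain ⟨e1, e2, e3, e4⟩ := letter_entries hp (p - 2)
  rw [show p - 2 + 2 = p by omega, sinQuot_self hp] at e2
  have hl := sinQuot_pos hp (n := p - 2) (by omega) (by omega)
  rw [sinQuot_pred hp] at e1 e4
  obtain ⟨l, hldef⟩ : ∃ l : ℂ, l = (sinQuot p (p - 2) : ℝ) := ⟨_, rfl⟩
  have hl0 : l ≠ 0 := by rw [hldef]; exact_mod_cast hl.ne'
  have hmaps : Maps L 0 0 := by
    rw [hL]; simp [Maps, e2, e4]
  have hD : denX L = RatFunc.C l * RatFunc.X + 1 := by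
    rw [hL, denX, entry, entry, e3, e4, hldef]; simp
  have hmob : mobius L * denX L = RatFunc.X := by
    rw [mul_comm, denX_mul_mobius, hL, numX, entry, entry, e1, e2]; simp
  have hD0 := denX_ne_zero L
  have hDval : HasVal (denX L) 0 1 := by
    have := hasVal_denX L 0
    rw [hL, entry, entry, e3, e4] at this
    rw [hL]; simpa using this
  have hmval := hmaps.hasVal_mobius
  rw [Complex.ofReal_zero] at hmval
  have hX : (RatFunc.X : RatFunc ℂ) ≠ 0 := RatFunc.X_ne_zero
  -- the expansion of `q` to the second order
  obtain ⟨f, hf⟩ : ∃ f, f = RatFunc.X ^ (2 * k + (M + 1)) * q := ⟨_, rfl⟩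
  rw [← hf] at hval
  obtain ⟨g, hg⟩ : ∃ g, g = (f - RatFunc.C u) / RatFunc.X := ⟨_, rfl⟩
  have hfg : f = RatFunc.C u + RatFunc.X * g := by rw [hg]; field_simp; ring
  have hgreg : Regular g 0 := by
    have := hval.sub (HasVal.const u 0)
    rw [sub_self] at this
    have := this.div_X_sub_C
    rwa [map_zero, sub_zero, ← hg] at this
  obtain ⟨v, hgv⟩ := hgreg
  have hσf : RatFunc.X ^ (2 * k + (M + 1)) * substM L q =
      denX L ^ (2 * k + (M + 1)) * substM L f := by
    rw [hf, map_mul, map_pow, substM_X, ← mul_assoc, ← mul_pow, mul_comm (denX L), hmob]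
  have hσg : denX L * substM L f = RatFunc.C u * denX L + RatFunc.X * substM L g := by
    rw [hfg, map_add, map_mul, substM_C, substM_X, mul_add, ← mul_assoc, mul_comm (denX L) (mobius L),
      hmob]; ring
  have hgeom : denX L ^ (M + 1) - 1 =
      RatFunc.C l * RatFunc.X * ∑ i ∈ Finset.range (M + 1), denX L ^ i := by
    rw [← geom_sum_mul, hD]; ring
  have hW : RatFunc.X ^ (2 * k + (M + 1)) * (q - slash k q L) = RatFunc.X *
      (g - denX L ^ M * substM L g -
        RatFunc.C u * RatFunc.C l * ∑ i ∈ Finset.range (M + 1), denX L ^ i) := by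
    have h1 : RatFunc.X ^ (2 * k + (M + 1)) * slash k q L = denX L ^ (M + 1) * substM L f := by
      rw [slash_eq, mul_left_comm, hσf, pow_add, mul_assoc,
        inv_mul_cancel_left₀ (pow_ne_zero _ hD0)]
    rw [mul_sub, h1, ← hf, pow_succ, mul_assoc, hσg]
    rw [pow_succ] at hgeom
    linear_combination hfg - RatFunc.C u * hgeom
  have h1 : HasVal (g - denX L ^ M * substM L g -
        RatFunc.C u * RatFunc.C l * ∑ i ∈ Finset.range (M + 1), denX L ^ i) 0
      (v - 1 ^ M * v - u * l * ∑ i ∈ Finset.range (M + 1), 1 ^ i) :=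
    (hgv.sub ((hDval.pow M).mul (hgv.substM hmval))).sub
      (((HasVal.const u 0).mul (HasVal.const l 0)).mul (HasVal.sum _ fun i _ => hDval.pow i))
  have h2 : HasVal (g - denX L ^ M * substM L g -
        RatFunc.C u * RatFunc.C l * ∑ i ∈ Finset.range (M + 1), denX L ^ i) 0 0 := by
    rw [show 2 * k + (M + 1) = (2 * k + M) + 1 by ring, pow_succ', mul_assoc] at hW
    rw [← mul_left_cancel₀ hX hW]
    have h3 := ((HasVal.X (0 : ℂ)).pow (2 * k + M)).mul hR
    rwa [zero_pow (by omega), zero_mul] at h3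
  have h3 := h1.unique h2
  simp at h3
  rcases h3 with (h3 | h3) | h3
  · exact hu h3
  · exact hl0 h3
  · have : ((M : ℂ) + 1) ≠ 0 := by exact_mod_cast M.succ_ne_zero
    exact this h3

lemma IsRPF.exists_hasVal_zero (hp : 3 ≤ p) (hk : 1 ≤ k) (h : IsRPF p k q) :
    ∃ e, HasVal (RatFunc.X ^ (2 * k) * q) 0 e := by
  by_cases h0 : Regular q 0
  · obtain ⟨v, hv⟩ := h0
    exact ⟨_, ((HasVal.X 0).pow _).mul hv⟩
  · obtain ⟨-, u, hu, hval⟩ := exists_order h0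
    rw [map_zero, sub_zero] at hval
    have hle := h.order_zero_le hp hk hu hval
    obtain ⟨n, hn⟩ := Nat.exists_eq_add_of_le' hle
    rw [hn, pow_add, mul_assoc]
    exact ⟨_, ((HasVal.X 0).pow _).mul hval⟩

lemma denX_T : denX (T p) = RatFunc.X := by simp [denX, entry, T]

lemma numX_T : numX (T p) = -1 := by simp [numX, entry, T]

lemma IsRPF.substM_T (h : IsRPF p k q) :
    substM (T p) q = -(RatFunc.X ^ (2 * k) * q) := by
  have h1 := h.slash_T
  rw [slash_eq, denX_T, inv_mul_eq_iff_eq_mul₀ (pow_ne_zero _ RatFunc.X_ne_zero)] at h1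
  rw [h1, mul_neg]

/-- The value at infinity of a polynomial divided by `z ^ N`, up to sign. The transformation `T`
carries `0` to infinity. -/
lemma hasVal_substM_T_polynomial (P : Polynomial ℂ) {N : ℕ} (hN : P.natDegree ≤ N) :
    HasVal (RatFunc.X ^ N * substM (T p) (algebraMap _ _ P)) 0 ((-1) ^ N * P.coeff N) := by
  have hX : (RatFunc.X : RatFunc ℂ) ≠ 0 := RatFunc.X_ne_zero
  have e : RatFunc.X ^ N * substM (T p) (algebraMap _ _ P) =
      ∑ i ∈ Finset.range (N + 1), RatFunc.C ((-1) ^ i * P.coeff i) * RatFunc.X ^ (N - i) := by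
    rw [substM_algebraMap, Polynomial.aeval_eq_sum_range' (Nat.lt_succ_of_le hN), Finset.mul_sum]
    refine Finset.sum_congr rfl fun i hi => ?_
    have hi' : i ≤ N := Nat.lt_succ_iff.1 (Finset.mem_range.1 hi)
    rw [mobius, denX_T, numX_T, RatFunc.smul_eq_C_mul, div_pow, map_mul, map_pow, map_neg, map_one]
    obtain ⟨m, rfl⟩ := Nat.exists_eq_add_of_le' hi'
    rw [Nat.add_sub_cancel, pow_add]
    field_simp
  rw [e]
  have h1 := HasVal.sum (Finset.range (N + 1)) (a := (0 : ℂ)) fun i _ =>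
    (HasVal.const ((-1) ^ i * P.coeff i) 0).mul ((HasVal.X (0 : ℂ)).pow (N - i))
  have h2 : ∑ i ∈ Finset.range (N + 1), (-1) ^ i * P.coeff i * (0 : ℂ) ^ (N - i) =
      (-1) ^ N * P.coeff N := by
    rw [Finset.sum_eq_single_of_mem N (by simp)]
    · simp
    · intro i hi hne
      have := Finset.mem_range.1 hi
      rw [zero_pow (by omega), mul_zero]
  rwa [h2] at h1

lemma natDegree_le_of_hasVal {P : Polynomial ℂ} {m : ℕ} {v : ℂ}
    (h : HasVal (RatFunc.X ^ m * substM (T p) (algebraMap _ _ P)) 0 v) : P.natDegree ≤ m := by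
  by_contra! hlt
  have h1 := hasVal_substM_T_polynomial (p := p) P le_rfl
  have h2 := ((HasVal.X (0 : ℂ)).pow (P.natDegree - m)).mul h
  rw [← mul_assoc, ← pow_add, Nat.sub_add_cancel hlt.le, zero_pow (by omega), zero_mul] at h2
  have h3 := h1.unique h2
  rw [Polynomial.coeff_natDegree] at h3
  have : P = 0 := by simpa using h3
  rw [this] at hlt
  simp at hlt

lemma regular_principalPart (f : RatFunc ℂ) {a z : ℂ} (h : z ≠ a) :
    Regular (principalPart a f) z :=
  Regular.sum _ fun n _ => ⟨_, (HasVal.const _ z).div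
    (((HasVal.X z).sub (HasVal.const a z)).pow n) (pow_ne_zero n (sub_ne_zero.2 h))⟩

/-- Principal parts vanish at infinity, the image of `0` by `T`. -/
lemma hasVal_substM_T_principalPart (f : RatFunc ℂ) (a : ℂ) :
    HasVal (substM (T p) (principalPart a f)) 0 0 := by
  have hX : (RatFunc.X : RatFunc ℂ) ≠ 0 := RatFunc.X_ne_zero
  rw [principalPart, map_sum]
  have h1 : HasVal (-1 - RatFunc.C a * RatFunc.X) 0 (-1 - a * 0) :=
    (HasVal.one _).neg.sub ((HasVal.const a 0).mul (HasVal.X 0))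
  have h2 : HasVal (RatFunc.X / (-1 - RatFunc.C a * RatFunc.X)) 0 (0 / (-1 - a * 0)) :=
    (HasVal.X (0 : ℂ)).div h1 (by simp)
  rw [zero_div] at h2
  have h3 : ∀ n ∈ Finset.Icc 1 (f.denom.rootMultiplicity a), ∀ b : ℂ,
      HasVal (substM (T p) (RatFunc.C b / (RatFunc.X - RatFunc.C a) ^ n)) 0 0 := by
    intro n hn b
    have hn' := (Finset.mem_Icc.1 hn).1
    have h4 := (HasVal.const b 0).mul (h2.pow n)
    rw [zero_pow (by omega), mul_zero] at h4
    convert h4 using 1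
    rw [map_div₀, map_pow, map_sub, substM_C, substM_C, substM_X, mobius, denX_T, numX_T,
      div_eq_mul_inv, ← inv_pow]
    congr 2
    rw [inv_eq_iff_eq_inv, inv_div]
    field_simp
  have h5 := HasVal.sum (Finset.Icc 1 (f.denom.rootMultiplicity a)) fun n hn => h3 n hn
    (((RatFunc.laurent a f : RatFunc ℂ) : LaurentSeries ℂ).coeff (-(n : ℤ)))
  simpa using h5

end Zero

/-! ### Removal of the poles and the remaining polynomial -/

section Remainder

variable {p k : ℕ} {q : RatFunc ℂ}

lemma eq_algebraMap_of_forall_regular {f : RatFunc ℂ} (h : ∀ z, Regular f z) :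
    ∃ P : Polynomial ℂ, f = algebraMap _ _ P := by
  have h0 : f.denom.natDegree = 0 := by
    by_contra hne
    obtain ⟨z, hz⟩ := IsAlgClosed.exists_root f.denom
      (fun h' => hne (Polynomial.natDegree_eq_of_degree_eq_some h'))
    exact regular_iff_not_isPole.1 (h z) hz
  have h1 := Polynomial.eq_one_of_monic_natDegree_zero (RatFunc.monic_denom f) h0
  refine ⟨f.num, ?_⟩
  conv_lhs => rw [← RatFunc.num_div_denom f, h1, map_one, div_one]

lemma regular_qPart {α : ℝ} {z : ℂ} (h : z ≠ α) : Regular (qPart p k α) z :=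
  regular_principalPart _ h

/-- The pole at `-1 / α` is the image under `T` of the pole at `α`, with opposite constant. -/
lemma IsRPF.regular_add_twoPoles_neg_inv (hp : 3 ≤ p) (h : IsRPF p k q) {α : ℝ} {c : ℂ}
    (hα : α ∈ posPoles q)
    (hc : Regular (q - RatFunc.C c * twoPoles k (α : ℂ) (conj p α : ℂ)) (α : ℂ)) :
    Regular (q + RatFunc.C c * twoPoles k ((-1 / α : ℝ) : ℂ) (conj p (-1 / α) : ℂ))
      ((-1 / α : ℝ) : ℂ) := by
  have hne : -1 / α ≠ 0 := div_ne_zero (by norm_num) hα.1.ne'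
  have hmap : Maps (T p) (-1 / α) α := by
    have := maps_T (p := p) hne
    rwa [show -1 / (-1 / α) = α by have := hα.1.ne'; field_simp] at this
  have h1 := (hc.slash_of_maps k hmap).neg
  rw [slash_sub, slash_C_mul, h.slash_T, slash_twoPoles k hmap
    (formOf_of_maps hp (h.isHyperbolicPoint hp hα).1 T_mem hmap).2] at h1
  convert h1 using 1
  ring

/-- Subtraction of the principal parts leaves no pole outside `0`. -/
lemma IsRPF.regular_sub_sum_qPart (hp : 3 ≤ p) (h : IsRPF p k q) {Pf : Finset ℝ}
    (hPf : ∀ x, x ∈ Pf ↔ x ∈ posPoles q) {c : ℝ → ℂ}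
    (hc : ∀ x ∈ Pf, Regular (q - RatFunc.C (c x) * twoPoles k (x : ℂ) (conj p x : ℂ)) (x : ℂ))
    {z : ℂ} (hz : z ≠ 0) :
    Regular (q - ∑ α ∈ Pf, RatFunc.C (c α) * (qPart p k α - qPart p k (-1 / α))) z := by
  have hpos : ∀ β ∈ Pf, 0 < β := fun β hβ => ((hPf β).1 hβ).1
  have hterm : ∀ β : ℝ, z ≠ β → z ≠ (-1 / β : ℝ) →
      Regular (RatFunc.C (c β) * (qPart p k β - qPart p k (-1 / β))) z := fun β h1 h2 =>
    (Regular.const _ _).mul ((regular_qPart h1).sub (regular_qPart h2))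
  -- it suffices to treat the terms one by one
  have split : ∀ α ∈ Pf, (z = α ∨ z = (-1 / α : ℝ)) →
      Regular (q - RatFunc.C (c α) * (qPart p k α - qPart p k (-1 / α))) z →
      Regular (q - ∑ α ∈ Pf, RatFunc.C (c α) * (qPart p k α - qPart p k (-1 / α))) z := by
    intro α hα hzα hreg
    rw [← Finset.add_sum_erase _ _ hα, ← sub_sub]
    refine hreg.sub (Regular.sum _ fun β hβ => ?_)
    obtain ⟨hne, hβ⟩ := Finset.mem_erase.1 hβ
    have h1 := hpos α hα
    have h2 := hpos β hβ
    have h3 : -1 / α < 0 := div_neg_of_neg_of_pos (by norm_num) h1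
    have h4 : -1 / β < 0 := div_neg_of_neg_of_pos (by norm_num) h2
    rcases hzα with rfl | rfl
    · refine hterm β (fun e => hne (Complex.ofReal_injective e).symm) fun e => ?_
      have := Complex.ofReal_injective e
      linarith
    · refine hterm β (fun e => ?_) fun e => ?_
      · have := Complex.ofReal_injective e
        linarith
      · have := Complex.ofReal_injective e
        rw [div_eq_div_iff h1.ne' h2.ne'] at this
        exact hne (by linarith)
  by_cases hcase : ∃ α ∈ Pf, z = α ∨ z = (-1 / α : ℝ)
  · obtain ⟨α, hα, hzα⟩ := hcase
    refine split α hα hzα ?_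
    have h1 := hpos α hα
    have h3 : -1 / α < 0 := div_neg_of_neg_of_pos (by norm_num) h1
    have hne : α ≠ -1 / α := by linarith
    rcases hzα with rfl | rfl
    · have r1 := hc α hα
      have r2 := regular_sub_principalPart (twoPoles k (α : ℂ) (conj p α : ℂ)) α
      have r3 : Regular (qPart p k (-1 / α)) (α : ℂ) :=
        regular_qPart fun e => hne (Complex.ofReal_injective e)
      convert (r1.add ((Regular.const (c α) _).mul r2)).add ((Regular.const (c α) _).mul r3) using 1
      rw [qPart]; ring
    · have r1 := h.regular_add_twoPoles_neg_inv hp ((hPf α).1 hα) (hc α hα)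
      have r2 := regular_sub_principalPart
        (twoPoles k ((-1 / α : ℝ) : ℂ) (conj p (-1 / α) : ℂ)) ((-1 / α : ℝ) : ℂ)
      have r3 : Regular (qPart p k α) ((-1 / α : ℝ) : ℂ) :=
        regular_qPart fun e => hne (Complex.ofReal_injective e).symm
      convert (r1.sub ((Regular.const (c α) _).mul r2)).sub ((Regular.const (c α) _).mul r3) using 1
      rw [qPart.eq_def p k (-1 / α)]; ring
  · push Not at hcase
    refine Regular.sub ?_ (Regular.sum _ fun β hβ => hterm β (hcase β hβ).1 (hcase β hβ).2)
    by_cases him : z.im = 0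
    · obtain ⟨x, rfl⟩ : ∃ x : ℝ, z = x := ⟨z.re, Complex.ext rfl (by simpa using him)⟩
      have hx0 : x ≠ 0 := by exact_mod_cast hz
      have hreg : ∀ y : ℝ, 0 < y → y ∉ Pf → Regular q (y : ℂ) := fun y hy hyP =>
        regular_iff_not_isPole.2 fun hpole => hyP ((hPf y).2 ⟨hy, hpole⟩)
      rcases lt_or_gt_of_ne hx0 with hneg | hpos'
      · have hy : 0 < -1 / x := div_pos_of_neg_of_neg (by norm_num) hneg
        have e : x = -1 / (-1 / x) := by field_simp
        have h5 := hreg _ hy fun hmem => (hcase _ hmem).2 (by rw [← e])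
        have h6 := h.regular_neg_inv (by exact_mod_cast hy.ne') h5
        convert h6 using 1
        exact_mod_cast e
      · exact hreg x hpos' fun hmem => (hcase x hmem).1 rfl
    · exact h.regular_of_im_ne_zero hp him

lemma substM_T_X : substM (T p) RatFunc.X = -1 / RatFunc.X := by
  rw [substM_X, mobius, numX_T, denX_T]

lemma hasVal_substM_T_qPart (α : ℝ) : HasVal (substM (T p) (qPart p k α)) 0 0 :=
  hasVal_substM_T_principalPart _ _

/-- A function with its only pole at `0`, with `z ^ (2 k) r` regular at `0` of value `e` and `r`
regular at infinity of value `-e`, is `-e (1 - z ^ (-2 k))` plus terms `b / z ^ n`,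
`1 ≤ n < 2 k`. -/
lemma exists_eq_of_regular (hk : 1 ≤ k) {r : RatFunc ℂ} (hr : ∀ z, z ≠ 0 → Regular r z) {e : ℂ}
    (h0 : HasVal (RatFunc.X ^ (2 * k) * r) 0 e) (hinf : HasVal (substM (T p) r) 0 (-e)) :
    ∃ (a₀ b₁ : ℂ) (c : ℕ → ℂ), r = RatFunc.C (c 0) * qZero k a₀ b₁
      + ∑ n ∈ Finset.Icc 1 (2 * k - 1), RatFunc.C (c n) / RatFunc.X ^ n := by
  have hX : (RatFunc.X : RatFunc ℂ) ≠ 0 := RatFunc.X_ne_zero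
  obtain ⟨P, hP⟩ := eq_algebraMap_of_forall_regular (f := RatFunc.X ^ (2 * k) * r) (by
    intro z
    by_cases hz : z = 0
    · rw [hz]; exact ⟨_, h0⟩
    · exact Regular.mul ⟨_, (HasVal.X z).pow _⟩ (hr z hz))
  have hP0 : P.coeff 0 = e := by
    rw [hP] at h0
    rw [Polynomial.coeff_zero_eq_eval_zero]
    exact (HasVal.poly P 0).unique h0
  have hinf' : HasVal (RatFunc.X ^ (2 * k) * substM (T p) (algebraMap _ _ P)) 0 (-e) := by
    rw [← hP, map_mul, map_pow, substM_T_X, ← mul_assoc, ← mul_pow, mul_div_cancel₀ _ hX, pow_mul,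
      neg_one_sq, one_pow, one_mul]
    exact hinf
  have hdeg := natDegree_le_of_hasVal hinf'
  have hPt : P.coeff (2 * k) = -e := by
    have := (hasVal_substM_T_polynomial (p := p) P hdeg).unique hinf'
    rwa [pow_mul, neg_one_sq, one_pow, one_mul] at this
  obtain ⟨m, hm⟩ : ∃ m, 2 * k = m + 1 := ⟨2 * k - 1, by omega⟩
  refine ⟨-e, 0, fun n => if n = 0 then 1 else P.coeff (2 * k - n), ?_⟩
  have hsum : RatFunc.X ^ (2 * k) * r =
      ∑ i ∈ Finset.range m, RatFunc.C (P.coeff (i + 1)) * RatFunc.X ^ (i + 1)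
        + RatFunc.C e - RatFunc.C e * RatFunc.X ^ (2 * k) := by
    rw [hP]
    conv_lhs => rw [P.as_sum_range' (2 * k + 1) (Nat.lt_succ_of_le hdeg), map_sum,
      Finset.sum_range_succ, hPt, hm, Finset.sum_range_succ']
    simp only [hP0, ← Polynomial.C_mul_X_pow_eq_monomial, map_mul, map_pow, RatFunc.algebraMap_C,
      RatFunc.algebraMap_X, map_neg, pow_zero, map_one, hm]
    ring
  have hz : qZero k (-e) 0 = RatFunc.C (-e) * (1 - (RatFunc.X ^ (2 * k))⁻¹) := by
    unfold qZero
    split_ifs with h2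
    · rw [h2, map_zero, zero_mul, add_zero]
    · rfl
  have hs : ∑ n ∈ Finset.Icc 1 (2 * k - 1),
      RatFunc.C (if n = 0 then 1 else P.coeff (2 * k - n)) / RatFunc.X ^ n =
      (∑ i ∈ Finset.range m, RatFunc.C (P.coeff (i + 1)) * RatFunc.X ^ (i + 1)) /
        RatFunc.X ^ (2 * k) := by
    rw [Finset.sum_div]
    refine Finset.sum_nbij' (fun n => 2 * k - n - 1) (fun i => 2 * k - (i + 1)) ?_ ?_ ?_ ?_ ?_
    · intro n hn; rw [Finset.mem_Icc] at hn; rw [Finset.mem_range]; omega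
    · intro i hi; rw [Finset.mem_range] at hi; rw [Finset.mem_Icc]; omega
    · intro n hn; rw [Finset.mem_Icc] at hn; omega
    · intro i hi; rw [Finset.mem_range] at hi; omega
    · intro n hn
      rw [Finset.mem_Icc] at hn
      rw [if_neg (by omega), show 2 * k - n - 1 + 1 = 2 * k - n by omega, div_eq_div_iff
        (pow_ne_zero _ hX) (pow_ne_zero _ hX), mul_assoc, ← pow_add, Nat.sub_add_cancel (by omega)]
  rw [hs, hz]
  change r = RatFunc.C (if 0 = 0 then 1 else P.coeff (2 * k - 0)) * _ + _
  rw [if_pos rfl, map_one, one_mul, map_neg,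
    ← mul_right_inj' (pow_ne_zero (2 * k) hX), hsum]
  field_simp
  ring

end Remainder

end Hecke

open Hecke in
theorem mainTheorem1 (p k : ℕ) (hp : 3 ≤ p) (hk : 1 ≤ k) (q : RatFunc ℂ)
    (hq : Hecke.IsRPF p k q) :
    ∃ (L : ℕ) (𝒜 : Fin L → Hecke.FormClass p) (Z : Fin L → Finset ℝ) (C : Fin L → ℂ)
      (a₀ b₁ : ℂ) (c : ℕ → ℂ),
      Function.Injective 𝒜 ∧
      (∀ ℓ, Hecke.IsHyperbolicClass (𝒜 ℓ)) ∧
      (∀ ℓ, (Z ℓ : Set ℝ) = Hecke.simplePoints (𝒜 ℓ) ∧ (Z ℓ).Nonempty) ∧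
      {x : ℝ | 0 < x ∧ Hecke.IsPole q (x : ℂ)} = ⋃ ℓ, (Z ℓ : Set ℝ) ∧
      q = ∑ ℓ, RatFunc.C (C ℓ) *
            ∑ α ∈ Z ℓ, (Hecke.qPart p k α - Hecke.qPart p k (-1 / α))
          + RatFunc.C (c 0) * Hecke.qZero k a₀ b₁
          + ∑ n ∈ Finset.Icc 1 (2 * k - 1), RatFunc.C (c n) / RatFunc.X ^ n := by
  classical
  let cls : ℝ → FormClass p := fun x => ⟦formOf p x⟧
  obtain ⟨Pf, hPf⟩ : ∃ Pf : Finset ℝ, ∀ x, x ∈ Pf ↔ x ∈ posPoles q :=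
    ⟨(finite_posPoles q).toFinset, fun x => Set.Finite.mem_toFinset _⟩
  -- one constant for each class
  have hconst : ∀ A : FormClass p, ∃ c : ℂ, ∀ x ∈ Pf, cls x = A →
      Regular (q - RatFunc.C c * twoPoles k (x : ℂ) (conj p x : ℂ)) (x : ℂ) := by
    intro A
    by_cases hA : ∃ x ∈ Pf, cls x = A
    · obtain ⟨x, hx, rfl⟩ := hA
      obtain ⟨c, hc⟩ := hq.exists_const hp ((hPf x).1 hx)
      exact ⟨c, fun y hy hyx => hq.const_of_formClass_eq hp ((hPf x).1 hx) ((hPf y).1 hy) hyx.symm hc⟩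
    · exact ⟨0, fun x hx hxA => absurd ⟨x, hx, hxA⟩ hA⟩
  choose cA hcA using hconst
  obtain ⟨e, he⟩ := hq.exists_hasVal_zero hp hk
  obtain ⟨s, hs⟩ : ∃ s, s = ∑ α ∈ Pf, RatFunc.C (cA (cls α)) *
      (qPart p k α - qPart p k (-1 / α)) := ⟨_, rfl⟩
  have hr : ∀ z, z ≠ 0 → Regular (q - s) z := fun z hz => by
    rw [hs]
    exact hq.regular_sub_sum_qPart hp hPf (c := fun x => cA (cls x))
      (fun x hx => hcA _ x hx rfl) hz
  have hs0 : Regular s 0 := by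
    rw [hs]
    refine Regular.sum _ fun α hα => (Regular.const _ _).mul ?_
    have hα0 := ((hPf α).1 hα).1.ne'
    refine (regular_qPart ?_).sub (regular_qPart ?_)
    · exact_mod_cast hα0.symm
    · exact_mod_cast (div_ne_zero (by norm_num) hα0).symm
  have hr0 : HasVal (RatFunc.X ^ (2 * k) * (q - s)) 0 e := by
    obtain ⟨v, hv⟩ := hs0
    have := he.sub (((HasVal.X (0 : ℂ)).pow (2 * k)).mul hv)
    rwa [zero_pow (by omega), zero_mul, sub_zero, ← mul_sub] at this
  have hrinf : HasVal (substM (T p) (q - s)) 0 (-e) := by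
    have h1 : HasVal (substM (T p) s) 0 0 := by
      rw [hs, map_sum]
      have := HasVal.sum (a := (0 : ℂ)) Pf fun α _ =>
        (HasVal.const (cA (cls α)) (0 : ℂ)).mul
          ((hasVal_substM_T_qPart (p := p) (k := k) α).sub
            (hasVal_substM_T_qPart (p := p) (k := k) (-1 / α)))
      simpa using this
    rw [map_sub, hq.substM_T, ← sub_zero (-e)]
    exact he.neg.sub h1
  obtain ⟨a₀, b₁, c, hrem⟩ := exists_eq_of_regular hk hr hr0 hrinf
  let Af : Finset (FormClass p) := Pf.image cls
  let E := Af.equivFin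
  have hmem : ∀ ℓ, ∃ x ∈ Pf, cls x = (E.symm ℓ).1 := fun ℓ => Finset.mem_image.1 (E.symm ℓ).2
  refine ⟨Af.card, fun ℓ => (E.symm ℓ).1, fun ℓ => Pf.filter (fun x => cls x = (E.symm ℓ).1),
    fun ℓ => cA (E.symm ℓ).1, a₀, b₁, c, Subtype.val_injective.comp E.symm.injective, ?_, ?_, ?_,
    ?_⟩
  · intro ℓ
    obtain ⟨x, hx, hxA⟩ := hmem ℓ
    simp only [← hxA]
    exact isHyperbolicClass_formOf hp (hq.isHyperbolicPoint hp ((hPf x).1 hx)).1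
  · intro ℓ
    obtain ⟨x, hx, hxA⟩ := hmem ℓ
    refine ⟨Set.ext fun y => ?_, x, Finset.mem_filter.2 ⟨hx, hxA⟩⟩
    rw [Finset.mem_coe, Finset.mem_filter]
    constructor
    · rintro ⟨hy, hyA⟩
      obtain ⟨h1, h2⟩ := hq.isHyperbolicPoint hp ((hPf y).1 hy)
      exact ⟨h1, hyA, h2⟩
    · intro hy
      refine ⟨(hPf y).2 (hq.simplePoints_subset hp ((hPf x).1 hx) ?_), hy.2.1⟩
      change y ∈ simplePoints (cls x)
      rwa [hxA]
  · ext x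
    rw [Set.mem_iUnion]
    constructor
    · intro hx
      have hx' := (hPf x).2 hx
      refine ⟨E ⟨cls x, Finset.mem_image_of_mem _ hx'⟩, ?_⟩
      rw [Finset.mem_coe, Finset.mem_filter, Equiv.symm_apply_apply]
      exact ⟨hx', rfl⟩
    · rintro ⟨ℓ, hx⟩
      exact (hPf x).1 (Finset.mem_filter.1 (Finset.mem_coe.1 hx)).1
  · rw [add_assoc, ← hrem]
    have : ∑ ℓ, RatFunc.C (cA (E.symm ℓ).1) * ∑ α ∈ Pf.filter (fun x => cls x = (E.symm ℓ).1),
        (qPart p k α - qPart p k (-1 / α)) = s := by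
      rw [Equiv.sum_comp E.symm (fun A : Af => RatFunc.C (cA A.1) *
        ∑ α ∈ Pf.filter (fun x => cls x = A.1), (qPart p k α - qPart p k (-1 / α))),
        Finset.sum_coe_sort Af (fun A => RatFunc.C (cA A) *
        ∑ α ∈ Pf.filter (fun x => cls x = A), (qPart p k α - qPart p k (-1 / α))), hs,
        ← Finset.sum_fiberwise_of_maps_to (fun x hx => Finset.mem_image_of_mem cls hx)]
      refine Finset.sum_congr rfl fun A _ => ?_
      rw [Finset.mul_sum]
      refine Finset.sum_congr rfl fun α hα => ?_
      rw [(Finset.mem_filter.1 hα).2]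
    rw [this, add_sub_cancel]

end
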